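/- Let $M$ be a smooth manifold of dimension $d$ and let $E\to M$ be an exact Courant algebroid with scalar product $\langle\cdot,\cdot\rangle$, anchor $\pi:E\to TM$ and Dorfman bracket $[\cdot,\cdot]$ satisfying, for all $a,b,c\in\Gamma(E)$, $$[a,[b,c]]=[[a,b],c]+[b,[a,c]],\quad \pi(a)\langle b,c\rangle=\langle[a,b],c\rangle+\langle b,[a,c]\rangle,\quad \pi(c)\langle a,b\rangle=\langle[a,b]+[b,a],c\rangle .$$ Let $\mathcal G$ be a semi-Riemannian generalised metric on $E$, i.e. a smooth symmetric bilinear form whose endomorphism $\mathcal G^{\mathrm{end}}$, $\langle\mathcal G^{\mathrm{end}}u,v\rangle=\mathcal G(u,v)$, is an involution and which is non-degenerate on $T^*M\cong\ker\pi$. Let $E_\pm$ be its $\pm1$-eigenbundles, write $u_\pm$ for the $E_\pm$-component of $u$ and $|u|^2_{\mathcal G}=\mathcal G(u,u)$. Let $g$ be the semi-Riemannian metric on $M$ for which $\pi|_{E_+}:(E_+,\mathcal G)\to(TM,g)$ is an isometry, let $\sigma:TM\to E$ be the isotropic splitting of $\pi$ with image $\mathcal G^{\mathrm{end}}(\ker\pi)$,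 and let $H(X,Y,Z)=2\langle[\sigma X,\sigma Y],\sigma Z\rangle$, $|H|^2=H_{ijk}H^{ijk}$. Write $\mathrm{Sc}$ for the scalar curvature of $g$ and $\mathrm{div}^{\mathcal G}(a)=\mathrm{div}_g(\pi a)$. Let $e\in\Gamma(E)$ and let $\mathrm{div}=\mathrm{div}^{\mathcal G}-\langle e,\cdot\rangle$. A generalised connection $D$ on $E$ (an $E$-connection on $E$ compatible with $\langle\cdot,\cdot\rangle$) is a Levi-Civita generalised connection of $\mathcal G$ with divergence $\mathrm{div}$ if $D\mathcal G=0$, its torsion $\langle D_ab-D_ba-[a,b],c\rangle+\langle D_ca,b\rangle$ vanishes, and $\mathrm{tr}(Da)=\mathrm{div}(a)$ for all $a\in\Gamma(E)$. For such $D$ put $R^D(v,w)b=D_vD_wb-D_wD_vb-D_{[v,w]}b$, $$2\,\mathcal Rm^D(a,b,v,w)=\langle R^D(v,w)b,a\rangle+\langle R^D(b,a)v,w\rangle+\mathrm{tr}_E\,\langle Dv,w\rangle\langle Db,a\rangle,$$ and $\overline{\mathcal Rc}^D(b,w)=\mathrm{tr}_E\,\mathcal Rm^D(\cdot,b,\cdot,w)$,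 the traces $\mathrm{tr}_E$ being taken with $\langle\cdot,\cdot\rangle$. The generalised scalar curvature is $\mathcal Sc(\mathcal G,\mathrm{div})=\tfrac12\mathrm{tr}_{\mathcal G}\,\overline{\mathcal Rc}^D$. Then a Levi-Civita generalised connection $D$ of $\mathcal G$ with divergence $\mathrm{div}$ exists whenever $d\ge2$ or $e=0$, and for every such $D$ (in any dimension) $$\tfrac12\mathrm{tr}_{\mathcal G}\,\overline{\mathcal Rc}^D=\mathrm{Sc}-\frac{|H|^2}{12}+\mathrm{div}^{\mathcal G}(e_+-e_-)-\frac12|e|^2_{\mathcal G}.$$ In particular $\mathcal Sc(\mathcal G,\mathrm{div})$ is well defined and equals the right-hand side. -/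

import Mathlib

open Bundle Module
open scoped Manifold ContDiff

noncomputable section

namespace ExactCourant

/-! ### Linear algebra: traces with respect to a scalar product -/

section Trace

variable {W : Type*} [AddCommGroup W] [Module ℝ W] [Module.Finite ℝ W]

/-- Inverse Gram matrix `β^{ij}` of a scalar product `β` (of any signature) in a basis of `W`. -/
def inverseGram (β : W → W → ℝ) : Matrix (Fin (finrank ℝ W)) (Fin (finrank ℝ W)) ℝ :=
  (Matrix.of fun i j => β (finBasis ℝ W i) (finBasis ℝ W j))⁻¹

/-- The metric trace `tr_β B = β^{ij} B_{ij}` of a bilinear form `B`. -/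
def metricTrace (β B : W → W → ℝ) : ℝ :=
  ∑ i, ∑ j, inverseGram β i j * B (finBasis ℝ W i) (finBasis ℝ W j)

/-- The square norm `T_{ijk} T^{ijk}` of a trilinear form `T`. -/
def normSq₃ (β : W → W → ℝ) (T : W → W → W → ℝ) : ℝ :=
  metricTrace β fun u u' => metricTrace β fun v v' => metricTrace β fun w w' =>
    T u v w * T u' v' w'

end Trace

/-! ### Smooth sections -/

section Sections

variable {V : Type*} [NormedAddCommGroup V] [NormedSpace ℝ V]
  {M : Type*} [TopologicalSpace M] [ChartedSpace V M]
  {F : Type*} [NormedAddCommGroup F] [NormedSpace ℝ F]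
  {E : M → Type*} [TopologicalSpace (TotalSpace F E)]
  [∀ x, TopologicalSpace (E x)] [∀ x, AddCommGroup (E x)] [∀ x, Module ℝ (E x)]
  [FiberBundle F E] [VectorBundle ℝ F E]

/-- Product of a smooth function and a smooth section. -/
def smulSection (f : C^∞⟮𝓘(ℝ, V), M; 𝓘(ℝ, ℝ), ℝ⟯) (s : Cₛ^∞⟮𝓘(ℝ, V); F, E⟯) :
    Cₛ^∞⟮𝓘(ℝ, V); F, E⟯ :=
  ⟨fun x => f x • s x, f.contMDiff.smul_section s.contMDiff⟩

open Classical in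
/-- Bundle a smooth map `x ↦ s x ∈ E x` as a smooth section. -/
def mkSection (s : ∀ x, E x) : Cₛ^∞⟮𝓘(ℝ, V); F, E⟯ :=
  if h : ContMDiff 𝓘(ℝ, V) (𝓘(ℝ, V).prod 𝓘(ℝ, F)) ∞ (fun x => TotalSpace.mk' F x (s x)) then
    ⟨s, h⟩ else 0

theorem exists_section [FiniteDimensional ℝ V] [IsManifold 𝓘(ℝ, V) ∞ M] [T2Space M]
    [ContMDiffVectorBundle ∞ F E 𝓘(ℝ, V)] (x : M) (v : E x) :
    ∃ s : Cₛ^∞⟮𝓘(ℝ, V); F, E⟯, s x = v := by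
  obtain ⟨u, hu, hs⟩ :=
    FiberBundle.exists_contMDiffOn_extend (k := ∞) 𝓘(ℝ, V) F v
  obtain ⟨u', hu', ho, hx⟩ := mem_nhds_iff.1 hu
  obtain ⟨f, -, hf⟩ := (SmoothBumpFunction.nhds_basis_tsupport (I := 𝓘(ℝ, V)) x).mem_iff.1
    (ho.mem_nhds hx)
  refine ⟨⟨(f : M → ℝ) • FiberBundle.extend F v, ContMDiffOn.smul_section_of_tsupport
    f.contMDiff.contMDiffOn ho hf (hs.mono hu')⟩, ?_⟩
  change f x • FiberBundle.extend F v x = v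
  simp

variable (V F) in
/-- A global smooth section with the prescribed value `v` at `x`. -/
def extendSection [FiniteDimensional ℝ V] [IsManifold 𝓘(ℝ, V) ∞ M] [T2Space M]
    [ContMDiffVectorBundle ∞ F E 𝓘(ℝ, V)] {x : M} (v : E x) : Cₛ^∞⟮𝓘(ℝ, V); F, E⟯ :=
  (exists_section x v).choose

theorem extendSection_apply [FiniteDimensional ℝ V] [IsManifold 𝓘(ℝ, V) ∞ M] [T2Space M]
    [ContMDiffVectorBundle ∞ F E 𝓘(ℝ, V)] {x : M} (v : E x) : extendSection V F v x = v :=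
  (exists_section x v).choose_spec

end Sections

/-! ### Semi-Riemannian geometry -/

section SemiRiemannian

variable {V : Type*} [NormedAddCommGroup V] [NormedSpace ℝ V] [FiniteDimensional ℝ V]
  {M : Type*} [TopologicalSpace M] [ChartedSpace V M] [IsManifold 𝓘(ℝ, V) ∞ M]

instance (x : M) : Module.Finite ℝ (TangentSpace 𝓘(ℝ, V) x) :=
  inferInstanceAs (Module.Finite ℝ V)

/-- The derivative `X(f)` of `f` along the tangent vector `X` at `x`. -/
def dirDeriv (f : M → ℝ) (x : M) (X : TangentSpace 𝓘(ℝ, V) x) : ℝ :=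
  mvfderiv 𝓘(ℝ, V) f x X

/-- The right-hand side of the Koszul formula for `2 g(∇_X Y, Z)`. -/
def koszul (g : ∀ x : M, TangentSpace 𝓘(ℝ, V) x → TangentSpace 𝓘(ℝ, V) x → ℝ)
    (X Y Z : ∀ x : M, TangentSpace 𝓘(ℝ, V) x) (x : M) : ℝ :=
  dirDeriv (fun y => g y (Y y) (Z y)) x (X x) + dirDeriv (fun y => g y (X y) (Z y)) x (Y x)
    - dirDeriv (fun y => g y (X y) (Y y)) x (Z x)
    + g x (VectorField.mlieBracket 𝓘(ℝ, V) X Y x) (Z x)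
    - g x (VectorField.mlieBracket 𝓘(ℝ, V) X Z x) (Y x)
    - g x (VectorField.mlieBracket 𝓘(ℝ, V) Y Z x) (X x)

/-- The Levi-Civita derivative `∇_X Y` at `x`: the unique tangent vector determined by the
Koszul formula. -/
def leviCivita (g : ∀ x : M, TangentSpace 𝓘(ℝ, V) x → TangentSpace 𝓘(ℝ, V) x → ℝ)
    (X Y : ∀ x : M, TangentSpace 𝓘(ℝ, V) x) (x : M) : TangentSpace 𝓘(ℝ, V) x :=
  Classical.epsilon fun v : TangentSpace 𝓘(ℝ, V) x =>
    ∀ Z : Cₛ^∞⟮𝓘(ℝ, V); V, (TangentSpace 𝓘(ℝ, V) : M → Type _)⟯,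
      2 * g x v (Z x) = koszul g X Y Z x

/-- `R(X,Y)Z = ∇_X ∇_Y Z - ∇_Y ∇_X Z - ∇_{[X,Y]} Z`. -/
def curvature (g : ∀ x : M, TangentSpace 𝓘(ℝ, V) x → TangentSpace 𝓘(ℝ, V) x → ℝ)
    (X Y Z : ∀ x : M, TangentSpace 𝓘(ℝ, V) x) (x : M) : TangentSpace 𝓘(ℝ, V) x :=
  leviCivita g X (leviCivita g Y Z) x - leviCivita g Y (leviCivita g X Z) x
    - leviCivita g (VectorField.mlieBracket 𝓘(ℝ, V) X Y) Z x

variable [T2Space M]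

/-- A global smooth vector field with the prescribed value `v` at `x`. -/
def extendVector {x : M} (v : TangentSpace 𝓘(ℝ, V) x) :
    Cₛ^∞⟮𝓘(ℝ, V); V, (TangentSpace 𝓘(ℝ, V) : M → Type _)⟯ :=
  extendSection V V (E := (TangentSpace 𝓘(ℝ, V) : M → Type _)) v

/-- The divergence `div_g X = tr (v ↦ ∇_v X)`. -/
def divergence (g : ∀ x : M, TangentSpace 𝓘(ℝ, V) x → TangentSpace 𝓘(ℝ, V) x → ℝ)
    (X : ∀ x : M, TangentSpace 𝓘(ℝ, V) x) (x : M) : ℝ :=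
  metricTrace (g x) fun u v => g x (leviCivita g (extendVector u) X x) v

/-- The Riemann tensor `Rm(a,b,v,w) = g(R(v,w)b, a)`. -/
def riemann (g : ∀ x : M, TangentSpace 𝓘(ℝ, V) x → TangentSpace 𝓘(ℝ, V) x → ℝ)
    (x : M) (a b v w : TangentSpace 𝓘(ℝ, V) x) : ℝ :=
  g x (curvature g (extendVector v) (extendVector w) (extendVector b) x) a

/-- The Ricci tensor `Rc(b,w) = tr_g Rm(·,b,·,w)`. -/
def ricci (g : ∀ x : M, TangentSpace 𝓘(ℝ, V) x → TangentSpace 𝓘(ℝ, V) x → ℝ)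
    (x : M) (b w : TangentSpace 𝓘(ℝ, V) x) : ℝ :=
  metricTrace (g x) fun a v => riemann g x a b v w

/-- The scalar curvature `Sc = tr_g Rc`. -/
def scalarCurvature (g : ∀ x : M, TangentSpace 𝓘(ℝ, V) x → TangentSpace 𝓘(ℝ, V) x → ℝ)
    (x : M) : ℝ :=
  metricTrace (g x) (ricci g x)

end SemiRiemannian

/-! ### Exact Courant algebroids -/

section Courant

variable (V : Type*) [NormedAddCommGroup V] [NormedSpace ℝ V]
  {M : Type*} [TopologicalSpace M] [ChartedSpace V M] [IsManifold 𝓘(ℝ, V) ∞ M]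
  (F : Type*) [NormedAddCommGroup F] [NormedSpace ℝ F]
  (E : M → Type*) [TopologicalSpace (TotalSpace F E)]
  [∀ x, TopologicalSpace (E x)] [∀ x, AddCommGroup (E x)] [∀ x, Module ℝ (E x)]
  [FiberBundle F E] [VectorBundle ℝ F E]

/-- A Courant algebroid structure on a smooth vector bundle `E → M`: scalar product
`⟨·,·⟩ = pairing` on the fibres, anchor `π : E → TM` and (Dorfman) bracket on smooth sections. -/
structure CourantAlgebroid where
  pairing : ∀ x, E x →ₗ[ℝ] E x →ₗ[ℝ] ℝ
  pairing_symm : ∀ x u v, pairing x u v = pairing x v u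
  pairing_nondegenerate : ∀ x u, (∀ v, pairing x u v = 0) → u = 0
  pairing_smooth : ∀ a b : Cₛ^∞⟮𝓘(ℝ, V); F, E⟯,
    ContMDiff 𝓘(ℝ, V) 𝓘(ℝ, ℝ) ∞ fun x => pairing x (a x) (b x)
  anchor : ∀ x, E x →ₗ[ℝ] TangentSpace 𝓘(ℝ, V) x
  anchor_smooth : ∀ a : Cₛ^∞⟮𝓘(ℝ, V); F, E⟯,
    ContMDiff 𝓘(ℝ, V) (𝓘(ℝ, V).prod 𝓘(ℝ, V)) ∞
      fun x => TotalSpace.mk' V (E := (TangentSpace 𝓘(ℝ, V) : M → Type _)) x (anchor x (a x))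
  bracket : Cₛ^∞⟮𝓘(ℝ, V); F, E⟯ →ₗ[ℝ] Cₛ^∞⟮𝓘(ℝ, V); F, E⟯ →ₗ[ℝ] Cₛ^∞⟮𝓘(ℝ, V); F, E⟯
  jacobi : ∀ a b c : Cₛ^∞⟮𝓘(ℝ, V); F, E⟯,
    bracket a (bracket b c) = bracket (bracket a b) c + bracket b (bracket a c)
  invariant : ∀ (a b c : Cₛ^∞⟮𝓘(ℝ, V); F, E⟯) (x : M),
    dirDeriv (fun y => pairing y (b y) (c y)) x (anchor x (a x)) =
      pairing x (bracket a b x) (c x) + pairing x (b x) (bracket a c x)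
  symmetric_part : ∀ (a b c : Cₛ^∞⟮𝓘(ℝ, V); F, E⟯) (x : M),
    dirDeriv (fun y => pairing y (a y) (b y)) x (anchor x (c x)) =
      pairing x (bracket a b x + bracket b a x) (c x)

/-- A Courant algebroid is exact if `0 → T*M → E → TM → 0` is exact, where `T*M → E` is dual to
the anchor: `ξ` is sent to the element `u` with `⟨u, ·⟩ = ξ ∘ π` (up to a normalising factor). -/
structure ExactCourantAlgebroid extends CourantAlgebroid V F E where
  anchor_surjective : ∀ x, Function.Surjective (anchor x)
  anchor_eq_zero_iff : ∀ x u, anchor x u = 0 ↔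
    ∃ ξ : TangentSpace 𝓘(ℝ, V) x →ₗ[ℝ] ℝ, ∀ w, pairing x u w = ξ (anchor x w)

end Courant

section Generalized

variable {V : Type*} [NormedAddCommGroup V] [NormedSpace ℝ V]
  {M : Type*} [TopologicalSpace M] [ChartedSpace V M] [IsManifold 𝓘(ℝ, V) ∞ M]
  {F : Type*} [NormedAddCommGroup F] [NormedSpace ℝ F]
  {E : M → Type*} [TopologicalSpace (TotalSpace F E)]
  [∀ x, TopologicalSpace (E x)] [∀ x, AddCommGroup (E x)] [∀ x, Module ℝ (E x)]
  [FiberBundle F E] [VectorBundle ℝ F E]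

/-- A semi-Riemannian generalised metric `𝒢`, given by its endomorphism `𝒢^end`, where
`𝒢(u, v) = ⟨𝒢^end u, v⟩`: the form `𝒢` is smooth and symmetric, `𝒢^end` is an involution and `𝒢` is
non-degenerate on `T*M = ker π`. -/
structure GeneralizedMetric (A : ExactCourantAlgebroid V F E) where
  endo : ∀ x, E x →ₗ[ℝ] E x
  endo_smooth : ∀ a : Cₛ^∞⟮𝓘(ℝ, V); F, E⟯,
    ContMDiff 𝓘(ℝ, V) (𝓘(ℝ, V).prod 𝓘(ℝ, F)) ∞ fun x => TotalSpace.mk' F x (endo x (a x))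
  endo_involutive : ∀ x u, endo x (endo x u) = u
  endo_symm : ∀ x u v, A.pairing x (endo x u) v = A.pairing x u (endo x v)
  nondegenerate : ∀ x u, A.anchor x u = 0 →
    (∀ v, A.anchor x v = 0 → A.pairing x (endo x u) v = 0) → u = 0

/-- A generalised connection `D` on `E`; `D b x u = (D_u b)(x)` for `u ∈ E x`, `b ∈ Γ(E)`. -/
structure GeneralizedConnection (A : ExactCourantAlgebroid V F E) where
  D : Cₛ^∞⟮𝓘(ℝ, V); F, E⟯ → ∀ x, E x →ₗ[ℝ] E x
  smooth : ∀ a b : Cₛ^∞⟮𝓘(ℝ, V); F, E⟯,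
    ContMDiff 𝓘(ℝ, V) (𝓘(ℝ, V).prod 𝓘(ℝ, F)) ∞ fun x => TotalSpace.mk' F x (D b x (a x))
  add : ∀ a b x, D (a + b) x = D a x + D b x
  leibniz : ∀ (f : C^∞⟮𝓘(ℝ, V), M; 𝓘(ℝ, ℝ), ℝ⟯) (b : Cₛ^∞⟮𝓘(ℝ, V); F, E⟯) (x) (u : E x),
    D (smulSection f b) x u = f x • D b x u + dirDeriv f x (A.anchor x u) • b x
  metric : ∀ (b c : Cₛ^∞⟮𝓘(ℝ, V); F, E⟯) (x) (u : E x),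
    dirDeriv (fun y => A.pairing y (b y) (c y)) x (A.anchor x u) =
      A.pairing x (D b x u) (c x) + A.pairing x (b x) (D c x u)

variable {A : ExactCourantAlgebroid V F E}

namespace GeneralizedMetric

variable (G : GeneralizedMetric A)

/-- The bilinear form `𝒢(u, v) = ⟨𝒢^end u, v⟩`. -/
def form (x : M) (u v : E x) : ℝ := A.pairing x (G.endo x u) v

/-- Projection of `u` to the `+1`-eigenbundle `E₊` of `𝒢^end`. -/
def plusPart (x : M) (u : E x) : E x := (1 / 2 : ℝ) • (u + G.endo x u)

/-- Projection of `u` to the `-1`-eigenbundle `E₋` of `𝒢^end`. -/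
def minusPart (x : M) (u : E x) : E x := (1 / 2 : ℝ) • (u - G.endo x u)

section Splitting

/-- The map `π ∘ 𝒢^end : T*M = ker π → TM`. -/
def cotangentMap (x : M) : LinearMap.ker (A.anchor x) →ₗ[ℝ] TangentSpace 𝓘(ℝ, V) x :=
  A.anchor x ∘ₗ G.endo x ∘ₗ (LinearMap.ker (A.anchor x)).subtype

theorem cotangentMap_bijective [FiniteDimensional ℝ F] (x : M) :
    Function.Bijective (G.cotangentMap x) := by
  have : FiniteDimensional ℝ (E x) := VectorBundle.finiteDimensional ℝ F E x
  have iso : ∀ u v, A.anchor x u = 0 → A.anchor x v = 0 → A.pairing x u v = 0 := by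
    intro u v hu hv
    obtain ⟨ξ, hξ⟩ := (A.anchor_eq_zero_iff x u).1 hu
    rw [hξ, hv, map_zero]
  constructor
  · rw [injective_iff_map_eq_zero]
    intro t ht
    apply Subtype.ext
    exact G.nondegenerate x t t.2 fun v hv => iso _ _ ht hv
  · have hsurj : Function.Surjective (A.pairing x) := by
      refine (LinearMap.injective_iff_surjective_of_finrank_eq_finrank
        (Subspace.dual_finrank_eq (K := ℝ) (V := E x)).symm).1 ?_
      rw [injective_iff_map_eq_zero]
      intro u hu
      exact A.pairing_nondegenerate x u fun v => by rw [hu]; rfl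
    rw [← LinearMap.range_eq_top]
    by_contra hne
    obtain ⟨ξ, hξ, hle⟩ := Submodule.exists_le_ker_of_lt_top _ (lt_top_iff_ne_top.2 hne)
    obtain ⟨u, hu⟩ := hsurj (ξ ∘ₗ A.anchor x)
    have huw : ∀ w, A.pairing x u w = ξ (A.anchor x w) := fun w => by rw [hu]; rfl
    have hu0 : u = 0 := by
      refine G.nondegenerate x u ((A.anchor_eq_zero_iff x u).2 ⟨ξ, huw⟩) fun t ht => ?_
      rw [G.endo_symm, huw]
      exact hle ⟨⟨t, ht⟩, rfl⟩
    apply hξ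
    ext X
    obtain ⟨w, rfl⟩ := A.anchor_surjective x X
    rw [← huw w, hu0]
    simp

variable [FiniteDimensional ℝ F]

/-- The isomorphism `T*M = ker π ≃ TM` induced by `𝒢` (it is `ξ ↦ g⁻¹ξ`). -/
def cotangentEquiv (x : M) : LinearMap.ker (A.anchor x) ≃ₗ[ℝ] TangentSpace 𝓘(ℝ, V) x :=
  LinearEquiv.ofBijective (G.cotangentMap x) (G.cotangentMap_bijective x)

/-- The isotropic splitting `σ : TM → E` of `π` with image `𝒢^end(T*M)`, the `𝒢`-orthogonal
complement of `T*M`. -/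
def splitting (x : M) : TangentSpace 𝓘(ℝ, V) x →ₗ[ℝ] E x :=
  G.endo x ∘ₗ (LinearMap.ker (A.anchor x)).subtype ∘ₗ (G.cotangentEquiv x).symm.toLinearMap

/-- The inverse `TM → E₊` of the isomorphism `π|_{E₊}`. -/
def plusLift (x : M) : TangentSpace 𝓘(ℝ, V) x →ₗ[ℝ] E x :=
  G.splitting x +
    (LinearMap.ker (A.anchor x)).subtype ∘ₗ (G.cotangentEquiv x).symm.toLinearMap

theorem anchor_splitting (x : M) (X : TangentSpace 𝓘(ℝ, V) x) :
    A.anchor x (G.splitting x X) = X :=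
  (G.cotangentEquiv x).apply_symm_apply X

theorem anchor_plusLift (x : M) (X : TangentSpace 𝓘(ℝ, V) x) :
    A.anchor x (G.plusLift x X) = X := by
  have h : A.anchor x ((G.cotangentEquiv x).symm X : E x) = 0 := ((G.cotangentEquiv x).symm X).2
  simpa [plusLift, h] using G.anchor_splitting x X

theorem endo_plusLift (x : M) (X : TangentSpace 𝓘(ℝ, V) x) :
    G.endo x (G.plusLift x X) = G.plusLift x X := by
  simp [plusLift, splitting, G.endo_involutive, add_comm]

/-- The semi-Riemannian metric `g` on `M` induced by `𝒢`, for which `π : (E₊, 𝒢) → (TM, g)` is an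
isometry. -/
def baseMetric (x : M) (X Y : TangentSpace 𝓘(ℝ, V) x) : ℝ :=
  G.form x (G.plusLift x X) (G.plusLift x Y)

variable [FiniteDimensional ℝ V] [T2Space M]

/-- The three-form `H` on `M` determined by `𝒢`, `H(X,Y,Z) = 2⟨[σX, σY], σZ⟩` at `x`; vectors at `x`
are extended to vector fields. -/
def threeForm (x : M) (X Y Z : TangentSpace 𝓘(ℝ, V) x) : ℝ :=
  2 * A.pairing x
    (A.bracket (mkSection fun y => G.splitting y (extendVector X y))
      (mkSection fun y => G.splitting y (extendVector Y y)) x)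
    (G.splitting x Z)

/-- The metric divergence operator `div^𝒢(a) = div_g(π a)`. -/
def metricDivergence (a : ∀ x, E x) (x : M) : ℝ :=
  divergence G.baseMetric (fun y => A.anchor y (a y)) x

/-- The divergence operator `div^𝒢 - ⟨e, ·⟩`. -/
def divergenceOperator (e a : Cₛ^∞⟮𝓘(ℝ, V); F, E⟯) (x : M) : ℝ :=
  G.metricDivergence a x - A.pairing x (e x) (a x)

end Splitting

end GeneralizedMetric

namespace GeneralizedConnection

variable (D : GeneralizedConnection A)

/-- `D_a b` as a section of `E`. -/
def cov (a b : Cₛ^∞⟮𝓘(ℝ, V); F, E⟯) : Cₛ^∞⟮𝓘(ℝ, V); F, E⟯ :=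
  ⟨fun x => D.D b x (a x), D.smooth a b⟩

/-- `D` is a Levi-Civita generalised connection of `𝒢`: `D𝒢 = 0` and the torsion
`T(a,b,c) = ⟨D_a b - D_b a - [a,b], c⟩ + ⟨D_c a, b⟩` vanishes. -/
structure IsLeviCivita (G : GeneralizedMetric A) : Prop where
  metric : ∀ (b c : Cₛ^∞⟮𝓘(ℝ, V); F, E⟯) (x) (u : E x),
    dirDeriv (fun y => G.form y (b y) (c y)) x (A.anchor x u) =
      G.form x (D.D b x u) (c x) + G.form x (b x) (D.D c x u)
  torsion : ∀ (a b c : Cₛ^∞⟮𝓘(ℝ, V); F, E⟯) (x),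
    A.pairing x ((D.cov a b - D.cov b a - A.bracket a b) x) (c x)
      + A.pairing x (D.cov c a x) (b x) = 0

/-- The divergence operator `div_D(a) = tr (D a)` of a generalised connection. -/
def divergence (a : Cₛ^∞⟮𝓘(ℝ, V); F, E⟯) (x : M) : ℝ :=
  LinearMap.trace ℝ (E x) (D.D a x)

/-- `⟨R(v,w)b, a⟩` where `R(v,w)b = D_v D_w b - D_w D_v b - D_{[v,w]} b`. -/
def naiveCurvature (a b v w : Cₛ^∞⟮𝓘(ℝ, V); F, E⟯) (x : M) : ℝ :=
  A.pairing x
    ((D.cov v (D.cov w b) - D.cov w (D.cov v b) - D.cov (A.bracket v w) b) x) (a x)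

variable [FiniteDimensional ℝ F]

/-- The generalised Riemann tensor of a torsion-free generalised connection,
`2 ℛm^D(a,b,v,w) = ⟨R(v,w)b, a⟩ + ⟨R(b,a)v, w⟩ + tr_E ⟨Dv, w⟩⟨Db, a⟩`. -/
def riemann (a b v w : Cₛ^∞⟮𝓘(ℝ, V); F, E⟯) (x : M) : ℝ :=
  haveI : Module.Finite ℝ (E x) := VectorBundle.finiteDimensional ℝ F E x
  (1 / 2) * (D.naiveCurvature a b v w x + D.naiveCurvature w v b a x
    + metricTrace (fun u u' => A.pairing x u u') fun u u' =>
        A.pairing x (D.D v x u) (w x) * A.pairing x (D.D b x u') (a x))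

variable [FiniteDimensional ℝ V] [T2Space M] [ContMDiffVectorBundle ∞ F E 𝓘(ℝ, V)]

/-- The full generalised Ricci tensor at `x`: the trace `tr_E ℛm^D(·,b,·,w)` with respect to
`⟨·,·⟩`. -/
def ricci (x : M) (b w : E x) : ℝ :=
  haveI : Module.Finite ℝ (E x) := VectorBundle.finiteDimensional ℝ F E x
  metricTrace (fun u u' => A.pairing x u u') fun a v =>
    D.riemann (extendSection V F a) (extendSection V F b) (extendSection V F v)
      (extendSection V F w) x

/-- The generalised scalar curvature: half the `𝒢`-trace of the full generalised Ricci tensor. -/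
def scalarCurvature (G : GeneralizedMetric A) (x : M) : ℝ :=
  haveI : Module.Finite ℝ (E x) := VectorBundle.finiteDimensional ℝ F E x
  (1 / 2) * metricTrace (G.form x) (D.ricci x)

end GeneralizedConnection

end Generalized

end ExactCourant

open Bundle Module
open scoped Manifold ContDiff Topology

noncomputable section

namespace ExactCourant

set_option linter.unusedSectionVars false

/-! ### Derivatives of functions -/

section DirDeriv

variable {V : Type*} [NormedAddCommGroup V] [NormedSpace ℝ V]
  {M : Type*} [TopologicalSpace M] [ChartedSpace V M]

/-! The endomorphism `𝒢^end` splits E into E₊ ⊕ E₋. The anchor identifies each summand with TM, and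
the pairing becomes g on E₊ and -g on E₋. Writing X_s for `lift s` of X, with s = ±1 (and s = 0 for
σ), one computation with a sign q, q² = 1, serves both eigenbundles. Let e_q be the vector field
whose lift is the E_q-part of e.

The axioms determine ⟨[X_p, Y_q], Z_r⟩ in terms of g, H and Lie brackets
(`pairing_bracket_lift_lift`). In particular the E_q-part of [X_{-q}, Y_q] is the lift of ∇_X Y +
(q/2) g⁻¹H(X,Y,·) (`baseMetric_bismut`).

Let D be a Levi-Civita generalised connection. D𝒢 = 0 says that D preserves E_±. Torsion of mixed
type then forces D_{X_{-q}} Y_q = [X_{-q}, Y_q]_q. All freedom lies in D_{X_q} Y_q = (∇_X Y +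
κ(X,Y))_q. Here g(κ(X,Y),Z) is skew in Y, Z (`contorsion_skew`), its cyclic sum is (q/2) H
(`contorsion_cyclic`), and the divergence fixes tr κ(·,Y) = -q g(e_q, Y) (`trace_contorsionMap`).

The form ℛm is a tensor, skew in each pair and symmetric under exchange of the pairs, so its traces
may be taken in a basis adapted to E₊ ⊕ E₋. The mixed blocks cancel, and the scalar curvature is (S₊
- S₋)/2 with S_q the contraction over E_q. In a frame that is ∇-parallel at the point, the curvature
of D consists of the Riemann tensor of g, first derivatives of κ, and quadratic terms in κ and H.
After contraction the derivative terms and one quadratic term see only the trace of κ and give 2q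
div e_q - |e_q|². The remaining quadratic sum depends only on the cyclic sum of κ and equals
-|H|²/12 (`tripleSum_contorsion`). Hence q S_q = Sc - |H|²/12 + 2q div e_q - |e_q|² (`sum_riemann`),
and averaging over q = ±1 gives the formula, whatever κ is.

For existence take for κ the sum of (q/6) H and qc (g(X,Y) W - g(W,Y) X) with W = e_q. The trace of
the latter over X is -qc (d-1) g(W,Y), so c = 1/(d-1) does it, and any c does if e = 0. -/

theorem dirDeriv_add {f h : M → ℝ} {x : M} (hf : MDifferentiableAt 𝓘(ℝ, V) 𝓘(ℝ, ℝ) f x)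
    (hh : MDifferentiableAt 𝓘(ℝ, V) 𝓘(ℝ, ℝ) h x) (X : TangentSpace 𝓘(ℝ, V) x) :
    dirDeriv (fun y => f y + h y) x X = dirDeriv f x X + dirDeriv h x X := by
  have := mvfderiv_add hf hh
  exact congrArg (fun L => L X) this

theorem dirDeriv_sub {f h : M → ℝ} {x : M} (hf : MDifferentiableAt 𝓘(ℝ, V) 𝓘(ℝ, ℝ) f x)
    (hh : MDifferentiableAt 𝓘(ℝ, V) 𝓘(ℝ, ℝ) h x) (X : TangentSpace 𝓘(ℝ, V) x) :
    dirDeriv (fun y => f y - h y) x X = dirDeriv f x X - dirDeriv h x X := by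
  have := mvfderiv_sub hf hh
  exact congrArg (fun L => L X) this

theorem dirDeriv_neg (f : M → ℝ) (x : M) (X : TangentSpace 𝓘(ℝ, V) x) :
    dirDeriv (fun y => -f y) x X = -dirDeriv f x X := by
  have := mvfderiv_neg (I := 𝓘(ℝ, V)) (g := f) (x := x)
  exact congrArg (fun L => L X) this

theorem dirDeriv_mul {f h : M → ℝ} {x : M} (hf : MDifferentiableAt 𝓘(ℝ, V) 𝓘(ℝ, ℝ) f x)
    (hh : MDifferentiableAt 𝓘(ℝ, V) 𝓘(ℝ, ℝ) h x) (X : TangentSpace 𝓘(ℝ, V) x) :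
    dirDeriv (fun y => f y * h y) x X = f x * dirDeriv h x X + h x * dirDeriv f x X := by
  have := mvfderiv_mul hf hh
  exact congrArg (fun L => L X) this

theorem dirDeriv_const (c : ℝ) (x : M) (X : TangentSpace 𝓘(ℝ, V) x) :
    dirDeriv (fun _ : M => c) x X = 0 := by
  have := mvfderiv_const (I := 𝓘(ℝ, V)) c (x := x)
  exact congrArg (fun L => L X) this

theorem dirDeriv_congr {f h : M → ℝ} {x : M} (e : f =ᶠ[𝓝 x] h) (X : TangentSpace 𝓘(ℝ, V) x) :
    dirDeriv f x X = dirDeriv h x X := by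
  simp only [dirDeriv, mvfderiv]
  have h1 := e.mfderiv_eq (I := 𝓘(ℝ, V)) (I' := 𝓘(ℝ, ℝ))
  have h2 := e.self_of_nhds
  simp only [ContinuousLinearMap.coe_comp, Function.comp_apply]
  rw [h1]; rfl

theorem dirDeriv_const_mul (c : ℝ) {f : M → ℝ} {x : M}
    (hf : MDifferentiableAt 𝓘(ℝ, V) 𝓘(ℝ, ℝ) f x) (X : TangentSpace 𝓘(ℝ, V) x) :
    dirDeriv (fun y => c * f y) x X = c * dirDeriv f x X := by
  rw [dirDeriv_mul mdifferentiableAt_const hf, dirDeriv_const, mul_zero, add_zero]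

theorem mdifferentiableAt_sum {ι : Type*} (s : Finset ι) {f : ι → M → ℝ} {x : M}
    (hf : ∀ i, MDifferentiableAt 𝓘(ℝ, V) 𝓘(ℝ, ℝ) (f i) x) :
    MDifferentiableAt 𝓘(ℝ, V) 𝓘(ℝ, ℝ) (fun y => ∑ i ∈ s, f i y) x := by
  classical
  induction s using Finset.induction_on with
  | empty => simpa using mdifferentiableAt_const
  | insert a s ha ih =>
    simp only [Finset.sum_insert ha]
    exact (hf a).add ih

theorem dirDeriv_sum {ι : Type*} (s : Finset ι) {f : ι → M → ℝ} {x : M}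
    (hf : ∀ i, MDifferentiableAt 𝓘(ℝ, V) 𝓘(ℝ, ℝ) (f i) x) (X : TangentSpace 𝓘(ℝ, V) x) :
    dirDeriv (fun y => ∑ i ∈ s, f i y) x X = ∑ i ∈ s, dirDeriv (f i) x X := by
  classical
  induction s using Finset.induction_on with
  | empty => simpa using dirDeriv_const 0 x X
  | insert a s ha ih =>
    simp only [Finset.sum_insert ha]
    rw [dirDeriv_add (hf a) (mdifferentiableAt_sum s hf), ih]

theorem dirDeriv_add_right (f : M → ℝ) (x : M) (X Y : TangentSpace 𝓘(ℝ, V) x) :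
    dirDeriv f x (X + Y) = dirDeriv f x X + dirDeriv f x Y := map_add _ _ _

theorem dirDeriv_zero_right (f : M → ℝ) (x : M) :
    dirDeriv f x (0 : TangentSpace 𝓘(ℝ, V) x) = 0 := map_zero _

end DirDeriv

/-! ### Smooth functions: matrix inverses, cut-offs, prescribed differentials -/

section Functions

variable {V : Type*} [NormedAddCommGroup V] [NormedSpace ℝ V]
  {M : Type*} [TopologicalSpace M] [ChartedSpace V M]

theorem contMDiffOn_det {ι : Type*} [Fintype ι] [DecidableEq ι] {u : Set M}
    {A : M → Matrix ι ι ℝ}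
    (hA : ∀ i j, ContMDiffOn 𝓘(ℝ, V) 𝓘(ℝ, ℝ) ∞ (fun y => A y i j) u) :
    ContMDiffOn 𝓘(ℝ, V) 𝓘(ℝ, ℝ) ∞ (fun y => (A y).det) u := by
  simp only [Matrix.det_apply']
  refine contMDiffOn_finsetSum fun p _ => ?_
  exact contMDiffOn_const.mul (contMDiffOn_finsetProd fun i _ => hA _ _)

theorem contMDiffOn_inv_matrix {ι : Type*} [Fintype ι] [DecidableEq ι] {u : Set M}
    {A : M → Matrix ι ι ℝ}
    (hA : ∀ i j, ContMDiffOn 𝓘(ℝ, V) 𝓘(ℝ, ℝ) ∞ (fun y => A y i j) u)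
    (h0 : ∀ y ∈ u, (A y).det ≠ 0) (i j : ι) :
    ContMDiffOn 𝓘(ℝ, V) 𝓘(ℝ, ℝ) ∞ (fun y => (A y)⁻¹ i j) u := by
  have hadj : ContMDiffOn 𝓘(ℝ, V) 𝓘(ℝ, ℝ) ∞ (fun y => (A y).adjugate i j) u := by
    simp only [Matrix.adjugate_apply]
    refine contMDiffOn_det fun k l => ?_
    by_cases hk : k = j
    · subst hk; simpa using contMDiffOn_const
    · simpa [Matrix.updateRow_ne hk] using hA k l
  have : ContMDiffOn 𝓘(ℝ, V) 𝓘(ℝ, ℝ) ∞ (fun y => ((A y).det)⁻¹) u := fun y hy =>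
    (contDiffAt_inv ℝ (h0 y hy)).contMDiffAt.comp_contMDiffWithinAt y (contMDiffOn_det hA y hy)
  refine (this.mul hadj).congr fun y _ => ?_
  simp [Matrix.inv_def]

variable [FiniteDimensional ℝ V] [IsManifold 𝓘(ℝ, V) ∞ M] [T2Space M]

theorem exists_bump {x : M} {u : Set M} (hu : u ∈ 𝓝 x) :
    ∃ f : C^∞⟮𝓘(ℝ, V), M; 𝓘(ℝ, ℝ), ℝ⟯, (∀ᶠ y in 𝓝 x, f y = 1) ∧ tsupport f ⊆ u := by
  obtain ⟨f, -, hf⟩ := (SmoothBumpFunction.nhds_basis_tsupport (I := 𝓘(ℝ, V)) x).mem_iff.1 hu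
  exact ⟨⟨f, f.contMDiff⟩, f.eventuallyEq_one, hf⟩

/-- A cut-off makes local coefficients global. The agreement survives only near the point, which is
enough for values and derivatives there. -/
theorem exists_function_eventuallyEq {x : M} {u : Set M} (ho : IsOpen u) (hx : x ∈ u) {f : M → ℝ}
    (hf : ContMDiffOn 𝓘(ℝ, V) 𝓘(ℝ, ℝ) ∞ f u) :
    ∃ h : C^∞⟮𝓘(ℝ, V), M; 𝓘(ℝ, ℝ), ℝ⟯, ∀ᶠ y in 𝓝 x, h y = f y := by
  obtain ⟨b, hb, hs⟩ := exists_bump (V := V) (ho.mem_nhds hx)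
  refine ⟨⟨fun y => b y * f y, contMDiff_of_tsupport fun y hy => ?_⟩, ?_⟩
  · have hy' : y ∈ tsupport b := closure_mono (Function.support_mul_subset_left _ _) hy
    exact (b.contMDiff y).mul (hf.contMDiffAt (ho.mem_nhds (hs hy')))
  · filter_upwards [hb] with y hy
    change b y * f y = f y
    rw [hy, one_mul]

theorem exists_function_dirDeriv (x : M) (l : TangentSpace 𝓘(ℝ, V) x →ₗ[ℝ] ℝ) :
    ∃ f : C^∞⟮𝓘(ℝ, V), M; 𝓘(ℝ, ℝ), ℝ⟯, f x = 0 ∧ ∀ X, dirDeriv f x X = l X := by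
  -- The tangent space at x is V itself, in the coordinates of the preferred chart at x. So `l`,
  -- read as a functional on V and composed with that chart, has differential `l` at x.
  let l' : V →L[ℝ] ℝ := LinearMap.toContinuousLinearMap (show V →ₗ[ℝ] ℝ from l)
  let φ : M → ℝ := fun y => l' (extChartAt 𝓘(ℝ, V) x y - extChartAt 𝓘(ℝ, V) x x)
  have hφ : ContMDiffOn 𝓘(ℝ, V) 𝓘(ℝ, ℝ) ∞ φ (chartAt V x).source :=
    l'.contMDiff.comp_contMDiffOn ((contMDiffOn_extChartAt).sub contMDiffOn_const)
  obtain ⟨h, hh⟩ := exists_function_eventuallyEq (chartAt V x).open_source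
    (mem_chart_source V x) hφ
  have hx : h x = 0 := by rw [hh.self_of_nhds]; simp [φ]
  refine ⟨h, hx, fun X => ?_⟩
  rw [dirDeriv_congr hh]
  have hd : MDifferentiableAt 𝓘(ℝ, V) 𝓘(ℝ, ℝ) φ x :=
    ((hφ.contMDiffAt ((chartAt V x).open_source.mem_nhds (mem_chart_source V x)))).mdifferentiableAt
      (by simp)
  have key : HasFDerivAt (φ ∘ (extChartAt 𝓘(ℝ, V) x).symm) l' (extChartAt 𝓘(ℝ, V) x x) := by
    have h1 : HasFDerivAt (fun v : V => l' (v - extChartAt 𝓘(ℝ, V) x x)) l'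
        (extChartAt 𝓘(ℝ, V) x x) :=
      l'.hasFDerivAt.comp _ ((hasFDerivAt_id _).sub_const _)
    refine h1.congr_of_eventuallyEq ?_
    filter_upwards [extChartAt_target_mem_nhds (I := 𝓘(ℝ, V)) x] with v hv
    simp only [φ, Function.comp_apply, PartialEquiv.right_inv _ hv]
  have hm : HasMFDerivAt 𝓘(ℝ, V) 𝓘(ℝ, ℝ) φ x l' := by
    refine ⟨hd.continuousAt, ?_⟩
    exact key.hasFDerivWithinAt
  simp only [dirDeriv, mvfderiv, hm.mfderiv]
  rfl

theorem eq_of_forall_dirDeriv {x : M} {X Y : TangentSpace 𝓘(ℝ, V) x}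
    (h : ∀ f : C^∞⟮𝓘(ℝ, V), M; 𝓘(ℝ, ℝ), ℝ⟯, dirDeriv f x X = dirDeriv f x Y) : X = Y := by
  rw [← sub_eq_zero, ← Module.forall_dual_apply_eq_zero_iff ℝ]
  intro l
  obtain ⟨f, -, hf⟩ := exists_function_dirDeriv x l
  rw [map_sub, ← hf, ← hf, h, sub_self]

end Functions

/-! ### Local frames and tensoriality -/

section Frames

variable {V : Type*} [NormedAddCommGroup V] [NormedSpace ℝ V]
  {M : Type*} [TopologicalSpace M] [ChartedSpace V M]
  {F : Type*} [NormedAddCommGroup F] [NormedSpace ℝ F]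
  {E : M → Type*} [TopologicalSpace (TotalSpace F E)]
  [∀ x, TopologicalSpace (E x)] [∀ x, AddCommGroup (E x)] [∀ x, Module ℝ (E x)]
  [FiberBundle F E] [VectorBundle ℝ F E]

@[simp] theorem smulSection_apply (f : C^∞⟮𝓘(ℝ, V), M; 𝓘(ℝ, ℝ), ℝ⟯) (s : Cₛ^∞⟮𝓘(ℝ, V); F, E⟯)
    (x : M) : smulSection f s x = f x • s x := rfl

theorem mkSection_apply {s : ∀ x, E x}
    (h : ContMDiff 𝓘(ℝ, V) (𝓘(ℝ, V).prod 𝓘(ℝ, F)) ∞ (fun x => TotalSpace.mk' F x (s x))) (x : M) :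
    (mkSection s : Cₛ^∞⟮𝓘(ℝ, V); F, E⟯) x = s x := by
  rw [mkSection, dif_pos h]; rfl

@[simp] theorem add_section_apply (s t : Cₛ^∞⟮𝓘(ℝ, V); F, E⟯) (x : M) :
    (s + t) x = s x + t x := rfl

@[simp] theorem sub_section_apply (s t : Cₛ^∞⟮𝓘(ℝ, V); F, E⟯) (x : M) :
    (s - t) x = s x - t x := rfl

@[simp] theorem smul_section_apply (c : ℝ) (s : Cₛ^∞⟮𝓘(ℝ, V); F, E⟯) (x : M) :
    (c • s) x = c • s x := rfl

theorem sum_section_apply {ι : Type*} (t : Finset ι) (s : ι → Cₛ^∞⟮𝓘(ℝ, V); F, E⟯) (x : M) :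
    (∑ i ∈ t, s i) x = ∑ i ∈ t, s i x := by
  classical
  induction t using Finset.induction_on with
  | empty => simp
  | insert a t ha ih => simp [Finset.sum_insert ha, ih]

variable [FiniteDimensional ℝ V] [IsManifold 𝓘(ℝ, V) ∞ M] [T2Space M]
  [FiniteDimensional ℝ F] [ContMDiffVectorBundle ∞ F E 𝓘(ℝ, V)]

/-- Sections whose values at `x` form a basis of `E x` form a frame near `x`, in which all smooth
sections have smooth coefficients. -/
theorem exists_frame_coefficients {ι : Type*} [Fintype ι] {x : M} (b : Basis ι ℝ (E x))
    (s : ι → Cₛ^∞⟮𝓘(ℝ, V); F, E⟯) (hs : ∀ i, s i x = b i) :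
    (∀ᶠ y in 𝓝 x, LinearIndependent ℝ fun i => s i y) ∧
    ∀ t : Cₛ^∞⟮𝓘(ℝ, V); F, E⟯, ∃ c : ι → C^∞⟮𝓘(ℝ, V), M; 𝓘(ℝ, ℝ), ℝ⟯,
      ∀ᶠ y in 𝓝 x, t y = ∑ i, c i y • s i y := by
  classical
  let e := trivializationAt F E x
  have hx : x ∈ e.baseSet := FiberBundle.mem_baseSet_trivializationAt F E x
  -- Transporting `b` to the model fibre makes the local frame agree with `b` at x. The matrix
  -- expressing the sections in the frame is then the identity at x, hence invertible nearby.
  let b₀ : Basis ι ℝ F := b.map (e.linearEquivAt (R := ℝ) x hx)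
  let A : M → Matrix ι ι ℝ := fun y => Matrix.of fun i k =>
    e.localFrameCoeff 𝓘(ℝ, V) b₀ k y (s i y)
  have : ContMDiffVectorBundle 1 F E 𝓘(ℝ, V) := ContMDiffVectorBundle.of_le (n := ∞) (by simp)
  have hco : ∀ (t : Cₛ^∞⟮𝓘(ℝ, V); F, E⟯) k, ContMDiffOn 𝓘(ℝ, V) 𝓘(ℝ, ℝ) ∞
      (fun y => e.localFrameCoeff 𝓘(ℝ, V) b₀ k y (t y)) e.baseSet := fun t k =>
    contMDiffOn_baseSet_localFrameCoeff b₀ t.contMDiff.contMDiffOn k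
  have hA : ∀ i j, ContMDiffOn 𝓘(ℝ, V) 𝓘(ℝ, ℝ) ∞ (fun y => A y i j) e.baseSet := fun i j =>
    hco (s i) j
  have hAx : A x = 1 := by
    ext i k
    simp only [A, Matrix.of_apply]
    rw [e.localFrameCoeff_apply_of_mem_baseSet b₀ hx, hs]
    have : e.basisAt b₀ hx = b := by
      ext i
      simp only [Trivialization.basisAt, b₀, Basis.map_apply, LinearEquiv.symm_apply_apply]
    rw [this, Basis.repr_self, Matrix.one_apply, Finsupp.single_apply]
  have hdet : ContMDiffOn 𝓘(ℝ, V) 𝓘(ℝ, ℝ) ∞ (fun y => (A y).det) e.baseSet := contMDiffOn_det hA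
  obtain ⟨u, hu, ho, hxu⟩ : ∃ u ⊆ e.baseSet ∩ {y | (A y).det ≠ 0}, IsOpen u ∧ x ∈ u := by
    refine mem_nhds_iff.1 (Filter.inter_mem (e.open_baseSet.mem_nhds hx) ?_)
    refine (hdet.contMDiffAt (e.open_baseSet.mem_nhds hx)).continuousAt.eventually_ne ?_
    simp [hAx]
  have hsA : ∀ y ∈ u, ∀ i, s i y = ∑ k, A y i k • e.localFrame b₀ k y := fun y hy i =>
    e.eq_sum_localFrameCoeff_smul (s := s i) (hu hy).1
  have hσ : ∀ y ∈ u, ∀ k, e.localFrame b₀ k y = ∑ i, (A y)⁻¹ k i • s i y := by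
    intro y hy k
    simp only [hsA y hy, Finset.smul_sum, smul_smul]
    rw [Finset.sum_comm]
    simp only [← Finset.sum_smul, ← Matrix.mul_apply]
    rw [Matrix.nonsing_inv_mul _ (isUnit_iff_ne_zero.2 (hu hy).2)]
    simp [Matrix.one_apply]
  constructor
  · filter_upwards [ho.mem_nhds hxu] with y hy
    have hσi := (e.isLocalFrameOn_localFrame_baseSet 𝓘(ℝ, V) ∞ b₀)
    let B := hσi.toBasisAt (hu hy).1
    have hfin : Fintype.card ι = finrank ℝ (E y) := (finrank_eq_card_basis B).symm
    refine linearIndependent_of_top_le_span_of_card_eq_finrank ?_ hfin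
    refine (hσi.generating (hu hy).1).trans (Submodule.span_le.2 ?_)
    rintro _ ⟨k, rfl⟩
    simp only [hσ y hy k]
    exact Submodule.sum_mem _ fun i _ => Submodule.smul_mem _ _ (Submodule.subset_span ⟨i, rfl⟩)
  · intro t
    have hc : ∀ i, ContMDiffOn 𝓘(ℝ, V) 𝓘(ℝ, ℝ) ∞
        (fun y => ∑ k, e.localFrameCoeff 𝓘(ℝ, V) b₀ k y (t y) * (A y)⁻¹ k i) u := fun i =>
      contMDiffOn_finsetSum fun k _ => ((hco t k).mono fun y hy => (hu hy).1).mul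
        (contMDiffOn_inv_matrix (fun i j => (hA i j).mono fun y hy => (hu hy).1)
          (fun y hy => (hu hy).2) k i)
    choose c hc' using fun i => exists_function_eventuallyEq ho hxu (hc i)
    refine ⟨c, ?_⟩
    filter_upwards [ho.mem_nhds hxu, Filter.eventually_all.2 hc'] with y hy hcy
    simp only [hcy, Finset.sum_smul, mul_smul]
    rw [Finset.sum_comm]
    simp only [← Finset.smul_sum, ← hσ y hy]
    exact e.eq_sum_localFrameCoeff_smul (s := t) (hu hy).1

/-- An operation on smooth sections which is linear over smooth functions at `x` only depends on
the value of the section at `x`. -/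
theorem eq_zero_of_tensorial {W : Type*} [AddCommMonoid W] [Module ℝ W] {x : M}
    (Φ : Cₛ^∞⟮𝓘(ℝ, V); F, E⟯ → W) (hadd : ∀ s t, Φ (s + t) = Φ s + Φ t)
    (hsmul : ∀ f s, Φ (smulSection f s) = f x • Φ s) {s : Cₛ^∞⟮𝓘(ℝ, V); F, E⟯} (h : s x = 0) :
    Φ s = 0 := by
  classical
  have : FiniteDimensional ℝ (E x) := VectorBundle.finiteDimensional ℝ F E x
  let b := finBasis ℝ (E x)
  have hb : ∀ i, extendSection V F (b i) x = b i := fun i => extendSection_apply _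
  obtain ⟨hli, hc⟩ := exists_frame_coefficients b (fun i => extendSection V F (b i)) hb
  obtain ⟨c, hc⟩ := hc s
  have hc0 : ∀ i, c i x = 0 := by
    have h1 := hc.self_of_nhds
    rw [h] at h1
    exact fun i => Fintype.linearIndependent_iff.1 hli.self_of_nhds (fun i => c i x) h1.symm i
  obtain ⟨v, hv, ho, hxv⟩ := mem_nhds_iff.1 hc
  obtain ⟨β, hβ, hsupp⟩ := exists_bump (V := V) (ho.mem_nhds hxv)
  have hsum : ∀ t : Finset _, Φ (∑ i ∈ t, smulSection (c i) (extendSection V F (b i))) = 0 := by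
    intro t
    induction t using Finset.induction_on with
    | empty =>
      -- `W` has no subtraction, so additivity alone does not give Φ 0 = 0; linearity with the zero
      -- function does.
      have h0 := hsmul 0 0
      rw [show smulSection 0 0 = (0 : Cₛ^∞⟮𝓘(ℝ, V); F, E⟯) by ext y; exact zero_smul ℝ _] at h0
      rw [Finset.sum_empty, h0]
      exact zero_smul ℝ _
    | insert a t ha ih => rw [Finset.sum_insert ha, hadd, ih, hsmul, hc0, zero_smul, zero_add]
  -- The expansion of `s` holds only on `v`. Multiplication by β, supported in `v`, turns it into an
  -- identity of global sections to which Φ applies, and β x = 1 removes β again.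
  have hβs : smulSection β s
      = smulSection β (∑ i, smulSection (c i) (extendSection V F (b i))) := by
    ext y
    by_cases hy : y ∈ v
    · simp only [smulSection_apply, sum_section_apply]
      rw [show s y = _ from hv hy]
    · have : β y = 0 := by
        by_contra h0
        exact hy (hsupp (subset_tsupport _ h0))
      simp [this]
  have hΦ := congrArg Φ hβs
  rwa [hsmul, hsmul, hsum, smul_zero, hβ.self_of_nhds, one_smul] at hΦ

theorem eq_of_tensorial {W : Type*} [AddCommMonoid W] [Module ℝ W] {x : M}
    (Φ : Cₛ^∞⟮𝓘(ℝ, V); F, E⟯ → W) (hadd : ∀ s t, Φ (s + t) = Φ s + Φ t)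
    (hsmul : ∀ f s, Φ (smulSection f s) = f x • Φ s) {s t : Cₛ^∞⟮𝓘(ℝ, V); F, E⟯} (h : s x = t x) :
    Φ s = Φ t := by
  have h0 : Φ (s - t) = 0 := eq_zero_of_tensorial Φ hadd hsmul (by simp [h])
  have := hadd (s - t) t
  rwa [sub_add_cancel, h0, zero_add] at this

/-- The linear map on `E x` induced by an operation on sections which is tensorial at `x`. -/
def tensorialMap {W : Type*} [AddCommMonoid W] [Module ℝ W] {x : M}
    (Φ : Cₛ^∞⟮𝓘(ℝ, V); F, E⟯ → W) (hadd : ∀ s t, Φ (s + t) = Φ s + Φ t)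
    (hsmul : ∀ f s, Φ (smulSection f s) = f x • Φ s) : E x →ₗ[ℝ] W where
  toFun u := Φ (extendSection V F u)
  map_add' u v := by
    rw [← hadd]
    exact eq_of_tensorial Φ hadd hsmul (by simp [extendSection_apply])
  map_smul' c u := by
    have hf : Φ (smulSection ⟨fun _ => c, contMDiff_const⟩ (extendSection V F u))
        = c • Φ (extendSection V F u) := hsmul _ _
    rw [RingHom.id_apply, ← hf]
    refine eq_of_tensorial Φ hadd hsmul ?_
    rw [extendSection_apply]
    exact (congrArg (c • ·) (extendSection_apply u)).symm

theorem tensorialMap_apply {W : Type*} [AddCommMonoid W] [Module ℝ W] {x : M}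
    (Φ : Cₛ^∞⟮𝓘(ℝ, V); F, E⟯ → W) (hadd : ∀ s t, Φ (s + t) = Φ s + Φ t)
    (hsmul : ∀ f s, Φ (smulSection f s) = f x • Φ s) (s : Cₛ^∞⟮𝓘(ℝ, V); F, E⟯) :
    tensorialMap Φ hadd hsmul (s x) = Φ s :=
  eq_of_tensorial Φ hadd hsmul (extendSection_apply _)

end Frames

/-! ### Metric traces in a basis -/

section TraceLemmas

variable {W : Type*} [AddCommGroup W] [Module ℝ W]

/-- Gram matrix of a bilinear form in a basis. -/
def gram {ι : Type*} (β : W →ₗ[ℝ] W →ₗ[ℝ] ℝ) (e : ι → W) : Matrix ι ι ℝ :=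
  Matrix.of fun i j => β (e i) (e j)

variable {β : W →ₗ[ℝ] W →ₗ[ℝ] ℝ}

theorem isUnit_det_gram {ι : Type*} [Fintype ι] [DecidableEq ι] (e : Basis ι ℝ W)
    (hβ : ∀ u, (∀ v, β u v = 0) → u = 0) : IsUnit (gram β e).det := by
  rw [isUnit_iff_ne_zero]
  intro h
  obtain ⟨c, hc, h0⟩ := Matrix.exists_vecMul_eq_zero_iff.2 h
  apply hc
  have hz : ∑ i, c i • e i = 0 := by
    refine hβ _ fun v => ?_
    have : (β (∑ i, c i • e i)) = 0 := by
      refine e.ext fun j => ?_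
      simpa [Matrix.vecMul, dotProduct, gram] using congrFun h0 j
    rw [this]; rfl
  exact funext fun i => Fintype.linearIndependent_iff.1 e.linearIndependent c hz i

theorem sum_inv_gram_mul {ι : Type*} [Fintype ι] [DecidableEq ι] (e : Basis ι ℝ W)
    (hβ : ∀ u, (∀ v, β u v = 0) → u = 0) (u : W) (k : ι) :
    ∑ l, (gram β e)⁻¹ k l * β (e l) u = e.repr u k := by
  conv_lhs => rw [← e.sum_repr u]
  simp only [map_sum, map_smul, smul_eq_mul, Finset.mul_sum]
  rw [Finset.sum_comm]
  have h : ∀ m, ∑ l, (gram β e)⁻¹ k l * β (e l) (e m) = if k = m then 1 else 0 := fun m => by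
    have := congrFun (congrFun (Matrix.nonsing_inv_mul _ (isUnit_det_gram e hβ)) k) m
    rwa [Matrix.mul_apply, Matrix.one_apply] at this
  calc _ = ∑ m, e.repr u m * ∑ l, (gram β e)⁻¹ k l * β (e l) (e m) := by
        refine Finset.sum_congr rfl fun m _ => ?_
        rw [Finset.mul_sum]
        exact Finset.sum_congr rfl fun l _ => by ring
    _ = e.repr u k := by simp [h]

theorem inv_gram_of_orthogonal {ι : Type*} [Fintype ι] [DecidableEq ι] {e : ι → W}
    (h : ∀ i j, i ≠ j → β (e i) (e j) = 0) (h0 : ∀ i, β (e i) (e i) ≠ 0) :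
    (gram β e)⁻¹ = Matrix.diagonal fun i => (β (e i) (e i))⁻¹ := by
  have : gram β e = Matrix.diagonal fun i => β (e i) (e i) := by
    ext i j
    by_cases hij : i = j
    · subst hij; simp [gram]
    · simp [gram, Matrix.diagonal_apply_ne _ hij, h i j hij]
  rw [this]
  refine Matrix.inv_eq_left_inv ?_
  rw [Matrix.diagonal_mul_diagonal, ← Matrix.diagonal_one]
  congr 1
  ext i
  exact inv_mul_cancel₀ (h0 i)

variable [Module.Finite ℝ W]

/-- The numbers β^{ij} β(z, e_j) are the coordinates of z. Rank-one forms span all bilinear forms,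
so this case carries the trace from the fixed basis of its definition to any other basis. -/
theorem metricTrace_mul (hβ : ∀ u, (∀ v, β u v = 0) → u = 0) (hs : ∀ u v, β u v = β v u)
    (L : W →ₗ[ℝ] ℝ) (z : W) :
    metricTrace (fun u v => β u v) (fun u v => L u * β z v) = L z := by
  have h := sum_inv_gram_mul (finBasis ℝ W) hβ z
  conv_rhs => rw [← (finBasis ℝ W).sum_repr z, map_sum]
  refine Finset.sum_congr rfl fun i _ => ?_
  rw [map_smul, ← h, smul_eq_mul, Finset.sum_mul]
  refine Finset.sum_congr rfl fun j _ => ?_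
  simp only [hs z]
  change (gram β (finBasis ℝ W))⁻¹ i j * _ = _
  ring

theorem metricTrace_add (β B C : W → W → ℝ) :
    metricTrace β (fun u v => B u v + C u v) = metricTrace β B + metricTrace β C := by
  simp only [metricTrace, mul_add, Finset.sum_add_distrib]

theorem metricTrace_const_mul (β B : W → W → ℝ) (c : ℝ) :
    metricTrace β (fun u v => c * B u v) = c * metricTrace β B := by
  simp only [metricTrace, Finset.mul_sum]
  exact Finset.sum_congr rfl fun i _ => Finset.sum_congr rfl fun j _ => by ring

theorem metricTrace_sum {ι : Type*} (s : Finset ι) (β : W → W → ℝ) (B : ι → W → W → ℝ) :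
    metricTrace β (fun u v => ∑ i ∈ s, B i u v) = ∑ i ∈ s, metricTrace β (B i) := by
  classical
  induction s using Finset.induction_on with
  | empty => simp [metricTrace]
  | insert a s ha ih => simp only [Finset.sum_insert ha, metricTrace_add, ih]

theorem metricTrace_eq_sum_inv_gram {ι : Type*} [Fintype ι] [DecidableEq ι] (e : Basis ι ℝ W)
    (hβ : ∀ u, (∀ v, β u v = 0) → u = 0) (hs : ∀ u v, β u v = β v u) (B : W →ₗ[ℝ] W →ₗ[ℝ] ℝ) :
    metricTrace (fun u v => β u v) (fun u v => B u v)
      = ∑ k, ∑ l, (gram β e)⁻¹ k l * B (e l) (e k) := by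
  -- Expanding `v` in the basis `e` by its inverse Gram matrix writes B as a sum of rank-one forms.
  have hB : (fun u v => B u v)
      = fun u v => ∑ k, ∑ l, (gram β e)⁻¹ k l * (B.flip (e k) u * β (e l) v) := by
    funext u v
    conv_lhs => rw [← e.sum_repr v]
    simp only [map_sum, map_smul, smul_eq_mul, ← sum_inv_gram_mul e hβ v, Finset.sum_mul]
    exact Finset.sum_congr rfl fun k _ => Finset.sum_congr rfl fun l _ => by
      rw [LinearMap.flip_apply]; ring
  rw [hB, metricTrace_sum]
  refine Finset.sum_congr rfl fun k _ => ?_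
  rw [metricTrace_sum]
  refine Finset.sum_congr rfl fun l _ => ?_
  rw [metricTrace_const_mul, metricTrace_mul hβ hs, LinearMap.flip_apply]

/-- Orthogonality is enough: the weights are the inverse squares β(e_i, e_i)⁻¹ of either sign, and
no normalisation of the basis is needed. -/
theorem metricTrace_eq_sum {ι : Type*} [Fintype ι] (e : Basis ι ℝ W)
    (hβ : ∀ u, (∀ v, β u v = 0) → u = 0) (hs : ∀ u v, β u v = β v u)
    (h : ∀ i j, i ≠ j → β (e i) (e j) = 0) (h0 : ∀ i, β (e i) (e i) ≠ 0)
    (B : W →ₗ[ℝ] W →ₗ[ℝ] ℝ) :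
    metricTrace (fun u v => β u v) (fun u v => B u v)
      = ∑ i, (β (e i) (e i))⁻¹ * B (e i) (e i) := by
  classical
  rw [metricTrace_eq_sum_inv_gram e hβ hs B, inv_gram_of_orthogonal h h0]
  simp [Matrix.diagonal_apply]

theorem exists_orthogonal_basis_of_nondegenerate
    (hβ : ∀ u, (∀ v, β u v = 0) → u = 0) (hs : ∀ u v, β u v = β v u) :
    ∃ e : Basis (Fin (finrank ℝ W)) ℝ W, (∀ i j, i ≠ j → β (e i) (e j) = 0) ∧
      ∀ i, β (e i) (e i) ≠ 0 := by
  obtain ⟨e, he⟩ := LinearMap.BilinForm.exists_orthogonal_basis (B := β) ⟨hs⟩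
  have h : ∀ i j, i ≠ j → β (e i) (e j) = 0 := fun i j hij => he hij
  refine ⟨e, h, fun i hi => e.ne_zero i (hβ _ fun v => ?_)⟩
  have : β (e i) = 0 := e.ext fun j => by
    by_cases hij : i = j
    · subst hij; simpa using hi
    · simpa using h i j hij
  rw [this]; rfl

theorem normSq₃_eq_sum {ι : Type*} [Fintype ι] (e : Basis ι ℝ W)
    (hβ : ∀ u, (∀ v, β u v = 0) → u = 0) (hs : ∀ u v, β u v = β v u)
    (h : ∀ i j, i ≠ j → β (e i) (e j) = 0) (h0 : ∀ i, β (e i) (e i) ≠ 0)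
    (T : W →ₗ[ℝ] W →ₗ[ℝ] W →ₗ[ℝ] ℝ) :
    normSq₃ (fun u v => β u v) (fun u v w => T u v w)
      = ∑ i, ∑ j, ∑ k, (β (e i) (e i))⁻¹ * (β (e j) (e j))⁻¹ * (β (e k) (e k))⁻¹ *
          (T (e i) (e j) (e k)) ^ 2 := by
  have h3 : ∀ u u' v v', metricTrace (fun u v => β u v) (fun w w' => T u v w * T u' v' w')
      = ∑ k, (β (e k) (e k))⁻¹ * (T u v (e k) * T u' v' (e k)) := fun u u' v v' =>
    metricTrace_eq_sum e hβ hs h h0 ((LinearMap.mul ℝ ℝ).compl₁₂ (T u v) (T u' v'))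
  have h2 : ∀ u u', metricTrace (fun u v => β u v) (fun v v' =>
      ∑ k, (β (e k) (e k))⁻¹ * (T u v (e k) * T u' v' (e k)))
      = ∑ k, (β (e k) (e k))⁻¹ * ∑ j, (β (e j) (e j))⁻¹ *
          (T u (e j) (e k) * T u' (e j) (e k)) := fun u u' => by
    rw [metricTrace_sum]
    refine Finset.sum_congr rfl fun k _ => ?_
    rw [metricTrace_const_mul]
    exact congrArg _ (metricTrace_eq_sum e hβ hs h h0
      ((LinearMap.mul ℝ ℝ).compl₁₂ ((T u).flip (e k)) ((T u').flip (e k))))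
  have h1 : ∀ j k, metricTrace (fun u v => β u v) (fun u u' => T u (e j) (e k) * T u' (e j) (e k))
      = ∑ i, (β (e i) (e i))⁻¹ * (T (e i) (e j) (e k) * T (e i) (e j) (e k)) := fun j k =>
    metricTrace_eq_sum e hβ hs h h0 ((LinearMap.mul ℝ ℝ).compl₁₂ ((T.flip (e j)).flip (e k))
      ((T.flip (e j)).flip (e k)))
  simp only [normSq₃, h3, h2]
  rw [metricTrace_sum]
  simp only [metricTrace_const_mul, metricTrace_sum, h1, Finset.mul_sum]
  symm
  rw [Finset.sum_congr rfl fun i _ => Finset.sum_comm, Finset.sum_comm]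
  refine Finset.sum_congr rfl fun k _ => ?_
  rw [Finset.sum_comm]
  exact Finset.sum_congr rfl fun j _ => Finset.sum_congr rfl fun i _ => by ring

end TraceLemmas

/-! ### Vector fields acting on functions -/

section VectorFields

variable {V : Type*} [NormedAddCommGroup V] [NormedSpace ℝ V] [FiniteDimensional ℝ V]
  {M : Type*} [TopologicalSpace M] [ChartedSpace V M] [IsManifold 𝓘(ℝ, V) ∞ M]

local notation "C∞M" => C^∞⟮𝓘(ℝ, V), M; 𝓘(ℝ, ℝ), ℝ⟯
local notation "𝔛" => Cₛ^∞⟮𝓘(ℝ, V); V, (TangentSpace 𝓘(ℝ, V) : M → Type _)⟯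

theorem contMDiff_dirDeriv (f : C∞M) (X : 𝔛) :
    ContMDiff 𝓘(ℝ, V) 𝓘(ℝ, ℝ) ∞ fun y => dirDeriv f y (X y) := by
  have h1 := f.contMDiff.contMDiff_tangentMap (m := ∞) (by simp)
  have h2 := (contMDiff_snd_tangentBundle_modelSpace ℝ 𝓘(ℝ, ℝ) (n := ∞)).comp
    (h1.comp X.contMDiff)
  exact h2

/-- The smooth function `X(f)`. -/
def derivFun (X : 𝔛) (f : C∞M) : C∞M := ⟨fun y => dirDeriv f y (X y), contMDiff_dirDeriv f X⟩

theorem derivFun_apply (X : 𝔛) (f : C∞M) (x : M) : derivFun X f x = dirDeriv f x (X x) := rfl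

theorem mdiffAt_fun (f : C∞M) (x : M) : MDifferentiableAt 𝓘(ℝ, V) 𝓘(ℝ, ℝ) f x :=
  f.contMDiff.contMDiffAt.mdifferentiableAt (by simp)

theorem mdiffAt_of_contMDiff {f : M → ℝ} (hf : ContMDiff 𝓘(ℝ, V) 𝓘(ℝ, ℝ) ∞ f) (x : M) :
    MDifferentiableAt 𝓘(ℝ, V) 𝓘(ℝ, ℝ) f x :=
  hf.contMDiffAt.mdifferentiableAt (by simp)

theorem two_le_infty : (2 : WithTop ℕ∞) ≤ ∞ := by
  exact ENat.LEInfty.out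

theorem three_le_infty : (3 : WithTop ℕ∞) ≤ ∞ := by
  exact ENat.LEInfty.out

theorem contMDiff_mlieBracket (X Y : 𝔛) :
    ContMDiff 𝓘(ℝ, V) (𝓘(ℝ, V).prod 𝓘(ℝ, V)) ∞ fun x =>
      TotalSpace.mk' V (E := (TangentSpace 𝓘(ℝ, V) : M → Type _)) x
        (VectorField.mlieBracket 𝓘(ℝ, V) X Y x) := by
  have : IsManifold 𝓘(ℝ, V) (minSmoothness ℝ 2) M :=
    IsManifold.of_le (n := ∞) (by simpa using two_le_infty)
  have : IsManifold 𝓘(ℝ, V) (∞ + 1) M := ‹IsManifold 𝓘(ℝ, V) ∞ M›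
  exact ContDiff.mlieBracket_vectorField (m := ⊤) (n := ⊤) X.contMDiff Y.contMDiff (by simp)

/-- The Lie bracket as a smooth vector field. -/
def lieSection (X Y : 𝔛) : 𝔛 :=
  ⟨fun x => VectorField.mlieBracket 𝓘(ℝ, V) X Y x, contMDiff_mlieBracket X Y⟩

theorem coe_lieSection (X Y : 𝔛) :
    (lieSection X Y : ∀ x, TangentSpace 𝓘(ℝ, V) x) = VectorField.mlieBracket 𝓘(ℝ, V) X Y := rfl

theorem lieSection_smul_right (X Y : 𝔛) (f : C∞M) :
    lieSection X (smulSection f Y) = smulSection (derivFun X f) Y + smulSection f (lieSection X Y)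
    := by
  ext x
  exact VectorField.mlieBracket_smul_right (mdiffAt_fun f x) (Y.mdifferentiableAt (x := x))

theorem lieSection_add_right (X Y Z : 𝔛) :
    lieSection X (Y + Z) = lieSection X Y + lieSection X Z := by
  ext x
  exact VectorField.mlieBracket_add_right (Y.mdifferentiableAt (x := x)) Z.mdifferentiableAt

theorem lieSection_jacobi (X Y Z : 𝔛) :
    lieSection X (lieSection Y Z) = lieSection (lieSection X Y) Z + lieSection Y (lieSection X Z)
    := by
  ext x
  have h : ∀ W : 𝔛, ContMDiffAt 𝓘(ℝ, V) (𝓘(ℝ, V).prod 𝓘(ℝ, V)) (minSmoothness ℝ 2)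
      (fun x => TotalSpace.mk' V (E := (TangentSpace 𝓘(ℝ, V) : M → Type _)) x (W x)) x := fun W =>
    W.contMDiff.contMDiffAt.of_le (by simpa using two_le_infty)
  have : IsManifold 𝓘(ℝ, V) (minSmoothness ℝ 3) M :=
    IsManifold.of_le (n := ∞) (by simpa using three_le_infty)
  exact VectorField.leibniz_identity_mlieBracket_apply (h X) (h Y) (h Z)

section Anchored

variable {F : Type*} [NormedAddCommGroup F] [NormedSpace ℝ F]
  {E : M → Type*} [TopologicalSpace (TotalSpace F E)]
  [∀ x, TopologicalSpace (E x)] [∀ x, AddCommGroup (E x)] [∀ x, Module ℝ (E x)]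
  [FiberBundle F E] [VectorBundle ℝ F E]

local notation "Γ" => Cₛ^∞⟮𝓘(ℝ, V); F, E⟯

/-- The anchor of a bracket satisfying the Leibniz rule and the Jacobi identity is a morphism of
brackets. -/
theorem dirDeriv_anchor_bracket (br : Γ → Γ → Γ) (ρ : Γ → 𝔛)
    (hadd : ∀ a b c, br a (b + c) = br a b + br a c)
    (hsmul : ∀ a b f, br a (smulSection f b) = smulSection (derivFun (ρ a) f) b
      + smulSection f (br a b))
    (hjac : ∀ a b c, br a (br b c) = br (br a b) c + br b (br a c))
    (a b c : Γ) {x : M} (hx : c x ≠ 0) (f : C∞M) :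
    dirDeriv f x (ρ (br a b) x)
      = dirDeriv (derivFun (ρ b) f) x (ρ a x) - dirDeriv (derivFun (ρ a) f) x (ρ b x) := by
  -- In the Jacobi identity for (a, b, fc) the terms with f undifferentiated cancel by the identity
  -- for c, and the mixed first-order terms cancel in pairs. What is left is a multiple of c.
  have h := hjac a b (smulSection f c)
  simp only [hsmul, hadd, hjac a b c] at h
  have h2 := DFunLike.congr_fun h x
  rw [← sub_eq_zero] at h2
  have h3 : ((dirDeriv f x (ρ (br a b) x)
      - (dirDeriv (derivFun (ρ b) f) x (ρ a x) - dirDeriv (derivFun (ρ a) f) x (ρ b x)))) • c x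
      = 0 := by
    rw [← neg_eq_zero, ← h2]
    simp only [add_section_apply, smulSection_apply, derivFun_apply]
    module
  exact sub_eq_zero.1 ((smul_eq_zero.1 h3).resolve_right hx)

end Anchored

/-- The Lie bracket has a Leibniz rule and a Jacobi identity with the identity as anchor, so the
preceding argument covers it. That argument needs a field which is nonzero at x, hence the separate
case of a zero tangent space. -/
theorem dirDeriv_mlieBracket [T2Space M] (X Y : 𝔛) (f : C∞M) (x : M) :
    dirDeriv f x (VectorField.mlieBracket 𝓘(ℝ, V) X Y x)
      = dirDeriv (derivFun Y f) x (X x) - dirDeriv (derivFun X f) x (Y x) := by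
  by_cases h : ∃ v : TangentSpace 𝓘(ℝ, V) x, v ≠ 0
  · obtain ⟨v, hv⟩ := h
    have := dirDeriv_anchor_bracket (lieSection (V := V) (M := M)) id lieSection_add_right
      (fun X Y f => lieSection_smul_right X Y f) lieSection_jacobi X Y (extendVector v) (x := x)
      (by rw [extendVector, extendSection_apply]; exact hv) f
    exact this
  · push Not at h
    rw [h (VectorField.mlieBracket 𝓘(ℝ, V) X Y x), h (X x), h (Y x), dirDeriv_zero_right,
      dirDeriv_zero_right, dirDeriv_zero_right, sub_self]

end VectorFields

/-! ### Fibrewise algebra of a generalised metric -/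

section Fibre

variable {V : Type*} [NormedAddCommGroup V] [NormedSpace ℝ V]
  {M : Type*} [TopologicalSpace M] [ChartedSpace V M] [IsManifold 𝓘(ℝ, V) ∞ M]
  {F : Type*} [NormedAddCommGroup F] [NormedSpace ℝ F]
  {E : M → Type*} [TopologicalSpace (TotalSpace F E)]
  [∀ x, TopologicalSpace (E x)] [∀ x, AddCommGroup (E x)] [∀ x, Module ℝ (E x)]
  [FiberBundle F E] [VectorBundle ℝ F E]
  {A : ExactCourantAlgebroid V F E}

theorem pairing_eq_zero_of_anchor (x : M) {u v : E x} (hu : A.anchor x u = 0)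
    (hv : A.anchor x v = 0) : A.pairing x u v = 0 := by
  obtain ⟨ξ, hξ⟩ := (A.anchor_eq_zero_iff x u).1 hu
  rw [hξ, hv, map_zero]

theorem pairing_eq_of_anchor (x : M) {u v w : E x} (hu : A.anchor x u = 0)
    (h : A.anchor x v = A.anchor x w) : A.pairing x u v = A.pairing x u w := by
  obtain ⟨ξ, hξ⟩ := (A.anchor_eq_zero_iff x u).1 hu
  rw [hξ, hξ, h]

theorem pairing_ext {x : M} {u v : E x} (h : ∀ w, A.pairing x u w = A.pairing x v w) : u = v := by
  rw [← sub_eq_zero]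
  exact A.pairing_nondegenerate x _ fun w => by rw [map_sub, LinearMap.sub_apply, h, sub_self]

namespace GeneralizedMetric

variable (G : GeneralizedMetric A)

/-- Since ker π is isotropic, an eigenvector of `𝒢^end` in ker π lies in the radical of 𝒢 restricted
to ker π. Thus π is injective on E_±. -/
theorem endo_eq_zero_of_anchor (x : M) {s : ℝ} {k : E x} (hk : A.anchor x k = 0)
    (h : G.endo x k = s • k) : k = 0 :=
  G.nondegenerate x k hk fun v hv => by
    rw [h, map_smul, LinearMap.smul_apply, pairing_eq_zero_of_anchor x hk hv, smul_zero]

variable [FiniteDimensional ℝ F]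

/-- The inclusion `TM ≃ T*M → E` given by `𝒢`. -/
def covector (x : M) : TangentSpace 𝓘(ℝ, V) x →ₗ[ℝ] E x :=
  (LinearMap.ker (A.anchor x)).subtype ∘ₗ (G.cotangentEquiv x).symm.toLinearMap

theorem anchor_covector (x : M) (X : TangentSpace 𝓘(ℝ, V) x) :
    A.anchor x (G.covector x X) = 0 := ((G.cotangentEquiv x).symm X).2

theorem splitting_eq (x : M) (X : TangentSpace 𝓘(ℝ, V) x) :
    G.splitting x X = G.endo x (G.covector x X) := rfl

/-- The lift of tangent vectors to `E` with cotangent part scaled by `s`: for `s = ±1` this is the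
inverse of `π : E_± → TM`, and for `s = 0` it is the isotropic splitting. -/
def lift (s : ℝ) (x : M) : TangentSpace 𝓘(ℝ, V) x →ₗ[ℝ] E x :=
  G.splitting x + s • G.covector x

theorem lift_apply (s : ℝ) (x : M) (X : TangentSpace 𝓘(ℝ, V) x) :
    G.lift s x X = G.splitting x X + s • G.covector x X := rfl

theorem plusLift_eq (x : M) (X : TangentSpace 𝓘(ℝ, V) x) : G.plusLift x X = G.lift 1 x X := by
  rw [lift_apply, one_smul]; rfl

theorem splitting_eq_lift (x : M) (X : TangentSpace 𝓘(ℝ, V) x) :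
    G.splitting x X = G.lift 0 x X := by
  rw [lift_apply, zero_smul, add_zero]

theorem anchor_lift (s : ℝ) (x : M) (X : TangentSpace 𝓘(ℝ, V) x) :
    A.anchor x (G.lift s x X) = X := by
  rw [lift_apply, map_add, map_smul, G.anchor_splitting, G.anchor_covector, smul_zero, add_zero]

theorem endo_lift {s : ℝ} (hs : s * s = 1) (x : M) (X : TangentSpace 𝓘(ℝ, V) x) :
    G.endo x (G.lift s x X) = s • G.lift s x X := by
  rw [lift_apply, map_add, map_smul, splitting_eq, G.endo_involutive, smul_add, smul_smul, hs,
    one_smul, add_comm]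

theorem lift_anchor {s : ℝ} (hs : s * s = 1) {x : M} {u : E x} (hu : G.endo x u = s • u) :
    G.lift s x (A.anchor x u) = u := by
  rw [← sub_eq_zero]
  refine G.endo_eq_zero_of_anchor x (s := s) ?_ ?_
  · rw [map_sub, G.anchor_lift, sub_self]
  · rw [map_sub, G.endo_lift hs, hu, smul_sub]

theorem baseMetric_eq_pairing (x : M) (X Y : TangentSpace 𝓘(ℝ, V) x) :
    G.baseMetric x X Y = A.pairing x (G.plusLift x X) (G.plusLift x Y) := by
  rw [baseMetric, form, G.endo_plusLift]

theorem pairing_covector_covector (x : M) (X Y : TangentSpace 𝓘(ℝ, V) x) :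
    A.pairing x (G.covector x X) (G.covector x Y) = 0 :=
  pairing_eq_zero_of_anchor x (G.anchor_covector x X) (G.anchor_covector x Y)

theorem pairing_splitting_splitting (x : M) (X Y : TangentSpace 𝓘(ℝ, V) x) :
    A.pairing x (G.splitting x X) (G.splitting x Y) = 0 := by
  rw [splitting_eq, splitting_eq, G.endo_symm, G.endo_involutive, pairing_covector_covector]

theorem pairing_splitting_covector (x : M) (X Y : TangentSpace 𝓘(ℝ, V) x) :
    A.pairing x (G.splitting x X) (G.covector x Y) = 1 / 2 * G.baseMetric x X Y := by
  have h : A.pairing x (G.covector x X) (G.splitting x Y)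
      = A.pairing x (G.splitting x X) (G.covector x Y) := by
    rw [splitting_eq, splitting_eq, G.endo_symm]
  rw [baseMetric_eq_pairing, plusLift_eq, plusLift_eq, lift_apply, lift_apply, one_smul, one_smul,
    map_add, map_add, LinearMap.add_apply, LinearMap.add_apply,
    pairing_splitting_splitting, pairing_covector_covector, h]
  ring

theorem pairing_covector_splitting (x : M) (X Y : TangentSpace 𝓘(ℝ, V) x) :
    A.pairing x (G.covector x X) (G.splitting x Y) = 1 / 2 * G.baseMetric x X Y := by
  rw [← pairing_splitting_covector, splitting_eq, splitting_eq, G.endo_symm]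

theorem pairing_covector (x : M) (X : TangentSpace 𝓘(ℝ, V) x) (u : E x) :
    A.pairing x (G.covector x X) u = 1 / 2 * G.baseMetric x X (A.anchor x u) := by
  rw [← pairing_covector_splitting]
  exact pairing_eq_of_anchor x (G.anchor_covector x X) (G.anchor_splitting x _).symm

/-- The coefficient (s + t)/2 records three facts at once: σ is isotropic (s = t = 0), E₊ ⟂ E₋ (t =
-s), and the pairing is s·g on E_s. -/
theorem pairing_lift_lift (s t : ℝ) (x : M) (X Y : TangentSpace 𝓘(ℝ, V) x) :
    A.pairing x (G.lift s x X) (G.lift t x Y) = (s + t) / 2 * G.baseMetric x X Y := by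
  simp only [lift_apply, map_add, LinearMap.add_apply, map_smul, LinearMap.smul_apply, smul_eq_mul,
    pairing_splitting_splitting, pairing_covector_covector, pairing_splitting_covector,
    pairing_covector_splitting]
  ring

theorem baseMetric_symm (x : M) (X Y : TangentSpace 𝓘(ℝ, V) x) :
    G.baseMetric x X Y = G.baseMetric x Y X := by
  rw [baseMetric_eq_pairing, baseMetric_eq_pairing, A.pairing_symm]

/-- The metric `g` as a bilinear map. -/
def metricMap (x : M) : TangentSpace 𝓘(ℝ, V) x →ₗ[ℝ] TangentSpace 𝓘(ℝ, V) x →ₗ[ℝ] ℝ :=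
  (A.pairing x).compl₁₂ (G.plusLift x) (G.plusLift x)

theorem metricMap_apply (x : M) (X Y : TangentSpace 𝓘(ℝ, V) x) :
    G.metricMap x X Y = G.baseMetric x X Y := (G.baseMetric_eq_pairing x X Y).symm

theorem coe_metricMap (x : M) : (fun X Y => G.metricMap x X Y) = G.baseMetric x := by
  funext X Y; exact G.metricMap_apply x X Y

theorem baseMetric_add_left (x : M) (X Y Z : TangentSpace 𝓘(ℝ, V) x) :
    G.baseMetric x (X + Y) Z = G.baseMetric x X Z + G.baseMetric x Y Z := by
  simp [← metricMap_apply]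

theorem baseMetric_sub_left (x : M) (X Y Z : TangentSpace 𝓘(ℝ, V) x) :
    G.baseMetric x (X - Y) Z = G.baseMetric x X Z - G.baseMetric x Y Z := by
  simp [← metricMap_apply]

theorem baseMetric_smul_left (x : M) (c : ℝ) (X Z : TangentSpace 𝓘(ℝ, V) x) :
    G.baseMetric x (c • X) Z = c * G.baseMetric x X Z := by
  simp [← metricMap_apply]

theorem baseMetric_add_right (x : M) (X Y Z : TangentSpace 𝓘(ℝ, V) x) :
    G.baseMetric x X (Y + Z) = G.baseMetric x X Y + G.baseMetric x X Z := by
  simp [← metricMap_apply]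

theorem baseMetric_smul_right (x : M) (c : ℝ) (X Z : TangentSpace 𝓘(ℝ, V) x) :
    G.baseMetric x X (c • Z) = c * G.baseMetric x X Z := by
  simp [← metricMap_apply]

theorem baseMetric_zero_left (x : M) (Z : TangentSpace 𝓘(ℝ, V) x) :
    G.baseMetric x 0 Z = 0 := by
  simp [← metricMap_apply]

theorem baseMetric_zero_right (x : M) (Z : TangentSpace 𝓘(ℝ, V) x) :
    G.baseMetric x Z 0 = 0 := by
  simp [← metricMap_apply]

/-- The tangent vector whose lift to `E_s` is the `E_s`-part of `u`, for `s = ±1`. -/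
def part (s : ℝ) (x : M) : E x →ₗ[ℝ] TangentSpace 𝓘(ℝ, V) x :=
  A.anchor x ∘ₗ ((1 / 2 : ℝ) • (LinearMap.id + s • G.endo x))

theorem lift_part {s : ℝ} (hs : s * s = 1) (x : M) (u : E x) :
    G.lift s x (G.part s x u) = (1 / 2 : ℝ) • (u + s • G.endo x u) := by
  refine G.lift_anchor hs ?_
  simp only [LinearMap.smul_apply, LinearMap.add_apply, LinearMap.id_apply, map_smul, map_add,
    G.endo_involutive]
  rw [smul_comm]
  congr 1
  rw [smul_add, smul_smul, hs, one_smul, add_comm]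

theorem lift_part_plus (x : M) (u : E x) : G.lift 1 x (G.part 1 x u) = G.plusPart x u := by
  rw [G.lift_part (by norm_num), plusPart, one_smul]

theorem lift_part_minus (x : M) (u : E x) :
    G.lift (-1) x (G.part (-1) x u) = G.minusPart x u := by
  rw [G.lift_part (by norm_num), minusPart, neg_smul, one_smul, sub_eq_add_neg]

theorem eq_lift_add_lift (x : M) (u : E x) :
    u = G.lift 1 x (G.part 1 x u) + G.lift (-1) x (G.part (-1) x u) := by
  rw [lift_part_plus, lift_part_minus, plusPart, minusPart]
  module

theorem part_lift_self {s : ℝ} (hs : s * s = 1) (x : M) (X : TangentSpace 𝓘(ℝ, V) x) :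
    G.part s x (G.lift s x X) = X := by
  simp only [part, LinearMap.comp_apply, LinearMap.smul_apply, LinearMap.add_apply,
    LinearMap.id_apply, G.endo_lift hs, smul_smul, hs, one_smul, map_smul, map_add, G.anchor_lift]
  module

theorem part_lift_neg {s : ℝ} (hs : s * s = 1) (x : M) (X : TangentSpace 𝓘(ℝ, V) x) :
    G.part s x (G.lift (-s) x X) = 0 := by
  simp only [part, LinearMap.comp_apply, LinearMap.smul_apply, LinearMap.add_apply,
    LinearMap.id_apply, G.endo_lift (s := -s) (by linarith), smul_smul, map_smul, map_add,
    G.anchor_lift, mul_neg, hs]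
  module

theorem pairing_lift_right {s : ℝ} (hs : s * s = 1) (x : M) (u : E x)
    (X : TangentSpace 𝓘(ℝ, V) x) :
    A.pairing x u (G.lift s x X) = s * G.baseMetric x (G.part s x u) X := by
  have h : A.pairing x (G.lift s x (G.part s x u)) (G.lift s x X)
      = A.pairing x u (G.lift s x X) := by
    rw [G.lift_part hs, map_smul, map_add, map_smul]
    simp only [LinearMap.smul_apply, LinearMap.add_apply, smul_eq_mul]
    rw [G.endo_symm, G.endo_lift hs, map_smul, smul_eq_mul, ← mul_assoc, hs]
    ring
  rw [← h, pairing_lift_lift]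
  ring

theorem metricMap_nondegenerate (x : M) (X : TangentSpace 𝓘(ℝ, V) x)
    (h : ∀ Y, G.metricMap x X Y = 0) : X = 0 := by
  have : G.covector x X = 0 := A.pairing_nondegenerate x _ fun u => by
    rw [pairing_covector, ← metricMap_apply, h, mul_zero]
  rw [← G.anchor_splitting x X, splitting_eq, this, map_zero, map_zero]

theorem baseMetric_ext (x : M) {X Y : TangentSpace 𝓘(ℝ, V) x}
    (h : ∀ Z, G.baseMetric x X Z = G.baseMetric x Y Z) : X = Y := by
  rw [← sub_eq_zero]
  refine G.metricMap_nondegenerate x _ fun Z => ?_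
  rw [map_sub, LinearMap.sub_apply, metricMap_apply, metricMap_apply, h, sub_self]

/-- The form `𝒢` as a bilinear map. -/
def formMap (x : M) : E x →ₗ[ℝ] E x →ₗ[ℝ] ℝ := A.pairing x ∘ₗ G.endo x

theorem form_lift_lift {s t : ℝ} (hs : s * s = 1) (x : M)
    (X Y : TangentSpace 𝓘(ℝ, V) x) :
    G.form x (G.lift s x X) (G.lift t x Y) = (1 + s * t) / 2 * G.baseMetric x X Y := by
  rw [form, G.endo_lift hs, map_smul, LinearMap.smul_apply, pairing_lift_lift, smul_eq_mul]
  linear_combination (1 / 2 * G.baseMetric x X Y) * hs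

end GeneralizedMetric

end Fibre

/-! ### Lifts of vector fields -/

section Lifts

variable {V : Type*} [NormedAddCommGroup V] [NormedSpace ℝ V] [FiniteDimensional ℝ V]
  {M : Type*} [TopologicalSpace M] [ChartedSpace V M] [IsManifold 𝓘(ℝ, V) ∞ M]
  [T2Space M]
  {F : Type*} [NormedAddCommGroup F] [NormedSpace ℝ F] [FiniteDimensional ℝ F]
  {E : M → Type*} [TopologicalSpace (TotalSpace F E)]
  [∀ x, TopologicalSpace (E x)] [∀ x, AddCommGroup (E x)] [∀ x, Module ℝ (E x)]
  [FiberBundle F E] [VectorBundle ℝ F E] [ContMDiffVectorBundle ∞ F E 𝓘(ℝ, V)]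

local notation "C∞M" => C^∞⟮𝓘(ℝ, V), M; 𝓘(ℝ, ℝ), ℝ⟯
local notation "𝔛" => Cₛ^∞⟮𝓘(ℝ, V); V, (TangentSpace 𝓘(ℝ, V) : M → Type _)⟯
local notation "Γ" => Cₛ^∞⟮𝓘(ℝ, V); F, E⟯

/-- The vector field `π(a)`. -/
def anchorSection (A : ExactCourantAlgebroid V F E) (a : Γ) : 𝔛 :=
  ⟨fun x => A.anchor x (a x), A.anchor_smooth a⟩

@[simp] theorem anchorSection_apply (A : ExactCourantAlgebroid V F E) (a : Γ) (x : M) :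
    anchorSection A a x = A.anchor x (a x) := rfl

@[simp] theorem extendVector_apply {x : M} (v : TangentSpace 𝓘(ℝ, V) x) :
    extendVector v x = v := extendSection_apply v

variable {A : ExactCourantAlgebroid V F E}

namespace GeneralizedMetric

variable (G : GeneralizedMetric A)

/-- The section `𝒢^end a`. -/
def endoSection (a : Γ) : Γ := ⟨fun x => G.endo x (a x), G.endo_smooth a⟩

theorem endoSection_apply (a : Γ) (x : M) : G.endoSection a x = G.endo x (a x) := rfl

theorem contMDiff_lift_of_sq {s : ℝ} (hs : s * s = 1) (X : 𝔛) :
    ContMDiff 𝓘(ℝ, V) (𝓘(ℝ, V).prod 𝓘(ℝ, F)) ∞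
      fun y => TotalSpace.mk' F y (G.lift s y (X y)) := by
  intro x
  let b := finBasis ℝ (TangentSpace 𝓘(ℝ, V) x)
  -- Projections to E_s of extensions of a basis: they are eigensections everywhere and their
  -- anchors form a frame near x. A vector field expanded in that frame lifts with the same smooth
  -- coefficients.
  let a : Fin (finrank ℝ (TangentSpace 𝓘(ℝ, V) x)) → Γ := fun i =>
    (1 / 2 : ℝ) • (extendSection V F (G.lift s x (b i))
      + s • G.endoSection (extendSection V F (G.lift s x (b i))))
  have ha : ∀ i y, G.endo y (a i y) = s • a i y := by
    intro i y
    simp only [a, smul_section_apply, add_section_apply, map_smul, map_add, endoSection_apply,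
      G.endo_involutive]
    rw [smul_comm]
    congr 1
    rw [smul_add, smul_smul, hs, one_smul, add_comm]
  have hax : ∀ i, anchorSection A (a i) x = b i := by
    intro i
    simp only [a, smul_section_apply, add_section_apply, anchorSection_apply, endoSection_apply,
      extendSection_apply, G.endo_lift hs, smul_smul, hs, map_smul, map_add, G.anchor_lift]
    module
  obtain ⟨-, hc⟩ := exists_frame_coefficients b (fun i => anchorSection A (a i)) hax
  obtain ⟨c, hc⟩ := hc X
  have hsm := (∑ i, smulSection (c i) (a i)).contMDiff.contMDiffAt (x := x)
  refine hsm.congr_of_eventuallyEq ?_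
  filter_upwards [hc] with y hy
  congr 1
  rw [hy, map_sum, sum_section_apply]
  refine Finset.sum_congr rfl fun i _ => ?_
  rw [map_smul, anchorSection_apply, G.lift_anchor hs (ha i y), smulSection_apply]

/-- The section `X ↦ lift s X`. -/
def liftSection (s : ℝ) (X : 𝔛) : Γ :=
  ⟨fun y => G.lift s y (X y), by
    have h1 := G.contMDiff_lift_of_sq (s := 1) (by norm_num) X
    have h2 := G.contMDiff_lift_of_sq (s := -1) (by norm_num) X
    -- The weights (1 ± s)/2 add up to 1 and differ by s, so they give σ + s·ξ. This reduces
    -- smoothness for arbitrary s, in particular of σ, to s = ±1.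
    have h3 := (h1.const_smul_section (a := (1 + s) / 2)).add_section
      (h2.const_smul_section (a := (1 - s) / 2))
    refine h3.congr fun y => ?_
    congr 1
    simp only [Pi.add_apply, Pi.smul_apply, lift_apply]
    module⟩

@[simp] theorem liftSection_apply (s : ℝ) (X : 𝔛) (x : M) :
    G.liftSection s X x = G.lift s x (X x) := rfl

/-- The vector field whose lift to `E_s` is the `E_s`-part of `a`. -/
def partSection (s : ℝ) (a : Γ) : 𝔛 :=
  anchorSection A ((1 / 2 : ℝ) • (a + s • G.endoSection a))

@[simp] theorem partSection_apply (s : ℝ) (a : Γ) (x : M) :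
    G.partSection s a x = G.part s x (a x) := rfl

theorem eq_liftSection_add (a : Γ) :
    a = G.liftSection 1 (G.partSection 1 a) + G.liftSection (-1) (G.partSection (-1) a) := by
  ext x
  exact G.eq_lift_add_lift x (a x)

theorem contMDiff_baseMetric (X Y : 𝔛) :
    ContMDiff 𝓘(ℝ, V) 𝓘(ℝ, ℝ) ∞ fun y => G.baseMetric y (X y) (Y y) := by
  refine (A.pairing_smooth (G.liftSection 1 X) (G.liftSection 1 Y)).congr fun y => ?_
  rw [baseMetric_eq_pairing, plusLift_eq, plusLift_eq]
  rfl

theorem mdiffAt_baseMetric (X Y : 𝔛) (x : M) :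
    MDifferentiableAt 𝓘(ℝ, V) 𝓘(ℝ, ℝ) (fun y => G.baseMetric y (X y) (Y y)) x :=
  mdiffAt_of_contMDiff (G.contMDiff_baseMetric X Y) x

end GeneralizedMetric

end Lifts

/-! ### The Courant bracket: Leibniz rules, anchor, three-form -/

section Calculus

variable {V : Type*} [NormedAddCommGroup V] [NormedSpace ℝ V] [FiniteDimensional ℝ V]
  {M : Type*} [TopologicalSpace M] [ChartedSpace V M] [IsManifold 𝓘(ℝ, V) ∞ M]
  [T2Space M]
  {F : Type*} [NormedAddCommGroup F] [NormedSpace ℝ F] [FiniteDimensional ℝ F]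
  {E : M → Type*} [TopologicalSpace (TotalSpace F E)]
  [∀ x, TopologicalSpace (E x)] [∀ x, AddCommGroup (E x)] [∀ x, Module ℝ (E x)]
  [FiberBundle F E] [VectorBundle ℝ F E] [ContMDiffVectorBundle ∞ F E 𝓘(ℝ, V)]

local notation "C∞M" => C^∞⟮𝓘(ℝ, V), M; 𝓘(ℝ, ℝ), ℝ⟯
local notation "𝔛" => Cₛ^∞⟮𝓘(ℝ, V); V, (TangentSpace 𝓘(ℝ, V) : M → Type _)⟯
local notation "Γ" => Cₛ^∞⟮𝓘(ℝ, V); F, E⟯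

variable {A : ExactCourantAlgebroid V F E}

theorem pairing_section_ext {x : M} {u v : E x}
    (h : ∀ c : Γ, A.pairing x u (c x) = A.pairing x v (c x)) : u = v :=
  pairing_ext fun w => by
    obtain ⟨c, rfl⟩ := exists_section (V := V) (F := F) x w
    exact h c

theorem mdiffAt_pairing (a b : Γ) (x : M) :
    MDifferentiableAt 𝓘(ℝ, V) 𝓘(ℝ, ℝ) (fun y => A.pairing y (a y) (b y)) x :=
  mdiffAt_of_contMDiff (A.pairing_smooth a b) x

theorem dirDeriv_pairing_smul_left (f : C∞M) (a b : Γ) (x : M) (X : TangentSpace 𝓘(ℝ, V) x) :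
    dirDeriv (fun y => A.pairing y (smulSection f a y) (b y)) x X
      = f x * dirDeriv (fun y => A.pairing y (a y) (b y)) x X
        + A.pairing x (a x) (b x) * dirDeriv f x X := by
  rw [← dirDeriv_mul (mdiffAt_fun f x) (mdiffAt_pairing a b x)]
  simp only [smulSection_apply, map_smul, LinearMap.smul_apply, smul_eq_mul]

/-- The Leibniz rule is not an axiom here. It follows by differentiating ⟨fb, c⟩ in the invariance
axiom, the pairing being non-degenerate. -/
theorem bracket_smul_right (a b : Γ) (f : C∞M) :
    A.bracket a (smulSection f b) = smulSection (derivFun (anchorSection A a) f) b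
      + smulSection f (A.bracket a b) := by
  ext x
  refine pairing_section_ext (A := A) fun c => ?_
  have h1 := A.invariant a (smulSection f b) c x
  have h2 := A.invariant a b c x
  rw [dirDeriv_pairing_smul_left] at h1
  simp only [smulSection_apply, add_section_apply, map_smul, LinearMap.smul_apply, map_add,
    LinearMap.add_apply, smul_eq_mul, derivFun_apply, anchorSection_apply] at h1 ⊢
  linear_combination f x * h2 - h1

theorem pairing_bracket_swap (a b c : Γ) (x : M) :
    A.pairing x (A.bracket b a x) (c x) =
      dirDeriv (fun y => A.pairing y (a y) (b y)) x (A.anchor x (c x))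
        - A.pairing x (A.bracket a b x) (c x) := by
  rw [A.symmetric_part, map_add, LinearMap.add_apply]
  ring

/-- The symmetric part of the bracket transfers the Leibniz rule to the first argument. The two
correction terms carry the factors ⟨a,c⟩ and ⟨a,b⟩, and vanish when a lies in E_{-s} and b, c lie in
E_s. -/
theorem pairing_bracket_smul_left (a b c : Γ) (f : C∞M) (x : M) :
    A.pairing x (A.bracket (smulSection f a) b x) (c x)
      = f x * A.pairing x (A.bracket a b x) (c x)
        - dirDeriv f x (A.anchor x (b x)) * A.pairing x (a x) (c x)
        + A.pairing x (a x) (b x) * dirDeriv f x (A.anchor x (c x)) := by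
  have h1 := pairing_bracket_swap (A := A) (smulSection f a) b c x
  have h2 := pairing_bracket_swap (A := A) a b c x
  rw [dirDeriv_pairing_smul_left, bracket_smul_right] at h1
  simp only [smulSection_apply, add_section_apply, map_smul, LinearMap.smul_apply, map_add,
    LinearMap.add_apply, smul_eq_mul, derivFun_apply, anchorSection_apply] at h1
  linear_combination h1 - f x * h2

theorem anchor_bracket (a b : Γ) (x : M) :
    A.anchor x (A.bracket a b x)
      = VectorField.mlieBracket 𝓘(ℝ, V) (anchorSection A a) (anchorSection A b) x := by
  by_cases h : ∃ v : E x, v ≠ 0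
  · obtain ⟨v, hv⟩ := h
    refine eq_of_forall_dirDeriv fun f => ?_
    rw [dirDeriv_mlieBracket]
    exact dirDeriv_anchor_bracket (fun a b => A.bracket a b) (anchorSection A)
      (fun a b c => map_add _ _ _) bracket_smul_right A.jacobi a b (extendSection V F v)
      (by rwa [extendSection_apply]) f
  · push Not at h
    have h0 : ∀ X : TangentSpace 𝓘(ℝ, V) x, X = 0 := fun X => by
      obtain ⟨u, rfl⟩ := A.anchor_surjective x X
      rw [h u, map_zero]
    rw [h0 (A.anchor x _), h0 (VectorField.mlieBracket 𝓘(ℝ, V) _ _ x)]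

namespace GeneralizedMetric

variable (G : GeneralizedMetric A)

/-- The section of `ker π` corresponding to a vector field. -/
def covectorSection (X : 𝔛) : Γ := G.liftSection 1 X - G.liftSection 0 X

@[simp] theorem covectorSection_apply (X : 𝔛) (x : M) :
    G.covectorSection X x = G.covector x (X x) := by
  simp only [covectorSection, sub_section_apply, liftSection_apply, lift_apply]
  module

theorem liftSection_eq (s : ℝ) (X : 𝔛) :
    G.liftSection s X = G.liftSection 0 X + s • G.covectorSection X := by
  ext x
  simp only [add_section_apply, smul_section_apply, liftSection_apply, covectorSection_apply,
    lift_apply]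
  module

theorem anchorSection_liftSection (s : ℝ) (X : 𝔛) : anchorSection A (G.liftSection s X) = X := by
  ext x
  exact G.anchor_lift s x _

theorem anchorSection_covectorSection (X : 𝔛) : anchorSection A (G.covectorSection X) = 0 := by
  ext x
  rw [anchorSection_apply, covectorSection_apply, anchor_covector]; rfl

theorem anchor_bracket_liftSection (s t : ℝ) (X Y : 𝔛) (x : M) :
    A.anchor x (A.bracket (G.liftSection s X) (G.liftSection t Y) x) = lieSection X Y x := by
  rw [anchor_bracket, anchorSection_liftSection, anchorSection_liftSection]; rfl

theorem anchor_bracket_covectorSection_right (a : Γ) (X : 𝔛) (x : M) :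
    A.anchor x (A.bracket a (G.covectorSection X) x) = 0 := by
  rw [anchor_bracket, anchorSection_covectorSection, ContMDiffSection.coe_zero,
    VectorField.mlieBracket_zero_right]
  rfl

theorem anchor_bracket_covectorSection_left (a : Γ) (X : 𝔛) (x : M) :
    A.anchor x (A.bracket (G.covectorSection X) a x) = 0 := by
  rw [anchor_bracket, anchorSection_covectorSection, ContMDiffSection.coe_zero,
    VectorField.mlieBracket_zero_left]
  rfl

/-- The three-form evaluated on vector fields. -/
def flux (X Y Z : 𝔛) (x : M) : ℝ :=
  2 * A.pairing x (A.bracket (G.liftSection 0 X) (G.liftSection 0 Y) x) (G.splitting x (Z x))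

theorem pairing_liftSection (s t : ℝ) (X Y : 𝔛) :
    (fun y => A.pairing y (G.liftSection s X y) (G.liftSection t Y y))
      = fun y => (s + t) / 2 * G.baseMetric y (X y) (Y y) := by
  funext y
  rw [liftSection_apply, liftSection_apply, pairing_lift_lift]

theorem dirDeriv_pairing_liftSection (s t : ℝ) (X Y : 𝔛) (x : M) (Z : TangentSpace 𝓘(ℝ, V) x) :
    dirDeriv (fun y => A.pairing y (G.liftSection s X y) (G.liftSection t Y y)) x Z
      = (s + t) / 2 * dirDeriv (fun y => G.baseMetric y (X y) (Y y)) x Z := by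
  rw [pairing_liftSection, dirDeriv_const_mul _ (G.mdiffAt_baseMetric X Y x)]

/-- The image of σ is isotropic, so the derivative in `symmetric_part` vanishes. The same reason,
applied to `invariant`, gives skewness in the last two arguments. -/
theorem flux_swap (X Y Z : 𝔛) (x : M) : G.flux Y X Z x = -G.flux X Y Z x := by
  have h := pairing_bracket_swap (A := A) (G.liftSection 0 X) (G.liftSection 0 Y)
    (G.liftSection 0 Z) x
  rw [dirDeriv_pairing_liftSection] at h
  simp only [flux, splitting_eq_lift, liftSection_apply] at h ⊢
  linear_combination 2 * h

theorem flux_swap_right (X Y Z : 𝔛) (x : M) : G.flux X Z Y x = -G.flux X Y Z x := by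
  have h := A.invariant (G.liftSection 0 X) (G.liftSection 0 Y) (G.liftSection 0 Z) x
  rw [dirDeriv_pairing_liftSection, A.pairing_symm x (G.liftSection 0 Y x)] at h
  simp only [flux, splitting_eq_lift, liftSection_apply] at h ⊢
  linear_combination -2 * h

theorem flux_congr_right (X Y : 𝔛) {Z Z' : 𝔛} {x : M} (h : Z x = Z' x) :
    G.flux X Y Z x = G.flux X Y Z' x := by
  rw [flux, flux, h]

/-- Dependence on the value at x alone is evident in the last argument only; skewness spreads it to
the others. This makes H independent of the chosen extensions. -/
theorem flux_congr_middle (X Z : 𝔛) {Y Y' : 𝔛} {x : M} (h : Y x = Y' x) :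
    G.flux X Y Z x = G.flux X Y' Z x := by
  rw [flux_swap_right, flux_swap_right (Y := Z) (Z := Y'), G.flux_congr_right X Z h]

theorem flux_congr_left (Y Z : 𝔛) {X X' : 𝔛} {x : M} (h : X x = X' x) :
    G.flux X Y Z x = G.flux X' Y Z x := by
  rw [flux_swap, flux_swap (X := Y) (Y := X'), G.flux_congr_middle Y Z h]

theorem threeForm_eq_flux (X Y Z : 𝔛) (x : M) :
    G.threeForm x (X x) (Y x) (Z x) = G.flux X Y Z x := by
  have h : ∀ W : 𝔛, (mkSection fun y => G.splitting y (W y)) = G.liftSection 0 W := fun W => by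
    ext y
    rw [mkSection_apply, liftSection_apply, splitting_eq_lift]
    refine (G.liftSection 0 W).contMDiff.congr fun y => ?_
    rw [splitting_eq_lift]; rfl
  rw [← G.flux_congr_left Y Z (extendVector_apply (X x)),
    ← G.flux_congr_middle (extendVector (X x)) Z (extendVector_apply (Y x))]
  rw [threeForm, h, h, flux]

theorem exists_threeForm_eq_flux (x : M) (X Y Z : TangentSpace 𝓘(ℝ, V) x) :
    G.threeForm x X Y Z = G.flux (extendVector X) (extendVector Y) (extendVector Z) x := by
  rw [← threeForm_eq_flux]; simp only [extendVector_apply]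

theorem threeForm_swap (x : M) (X Y Z : TangentSpace 𝓘(ℝ, V) x) :
    G.threeForm x Y X Z = -G.threeForm x X Y Z := by
  rw [exists_threeForm_eq_flux, exists_threeForm_eq_flux, flux_swap]

theorem threeForm_swap_right (x : M) (X Y Z : TangentSpace 𝓘(ℝ, V) x) :
    G.threeForm x X Z Y = -G.threeForm x X Y Z := by
  rw [exists_threeForm_eq_flux, exists_threeForm_eq_flux, flux_swap_right]

/-- The three-form as a trilinear map. -/
def threeFormMap (x : M) : TangentSpace 𝓘(ℝ, V) x →ₗ[ℝ] TangentSpace 𝓘(ℝ, V) x →ₗ[ℝ]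
    TangentSpace 𝓘(ℝ, V) x →ₗ[ℝ] ℝ :=
  have add_right : ∀ X Y Z Z', G.threeForm x X Y (Z + Z')
      = G.threeForm x X Y Z + G.threeForm x X Y Z' := fun X Y Z Z' => by
    simp only [threeForm, map_add, mul_add]
  have smul_right : ∀ (c : ℝ) X Y Z, G.threeForm x X Y (c • Z) = c * G.threeForm x X Y Z :=
    fun c X Y Z => by simp only [threeForm, map_smul, smul_eq_mul]; ring
  have add_mid : ∀ X Y Y' Z, G.threeForm x X (Y + Y') Z
      = G.threeForm x X Y Z + G.threeForm x X Y' Z := fun X Y Y' Z => by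
    rw [threeForm_swap_right, add_right, threeForm_swap_right, threeForm_swap_right (Y := Y')]
    ring
  have smul_mid : ∀ (c : ℝ) X Y Z, G.threeForm x X (c • Y) Z = c * G.threeForm x X Y Z :=
    fun c X Y Z => by rw [threeForm_swap_right, smul_right, threeForm_swap_right]; ring
  LinearMap.mk₂ ℝ
    (fun X Y => (⟨⟨fun Z => G.threeForm x X Y Z, add_right X Y⟩, fun c Z => smul_right c X Y Z⟩ :
      TangentSpace 𝓘(ℝ, V) x →ₗ[ℝ] ℝ))
    (fun X X' Y => LinearMap.ext fun Z => by
      change G.threeForm x (X + X') Y Z = G.threeForm x X Y Z + G.threeForm x X' Y Z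
      rw [threeForm_swap, add_mid, threeForm_swap, threeForm_swap (Y := X')]
      ring)
    (fun c X Y => LinearMap.ext fun Z => by
      change G.threeForm x (c • X) Y Z = c * G.threeForm x X Y Z
      rw [threeForm_swap, smul_mid, threeForm_swap]
      ring)
    (fun X Y Y' => LinearMap.ext fun Z => add_mid X Y Y' Z)
    (fun c X Y => LinearMap.ext fun Z => smul_mid c X Y Z)

end GeneralizedMetric

/-! ### Brackets of lifts; the Bismut and Levi-Civita connections -/

namespace GeneralizedMetric

variable (G : GeneralizedMetric A)

/-- Decompose every lift as σX + sξ_X with ξ_X in ker π. The bracket [σX, σY] gives H, [σX, ξ_Y] is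
evaluated by invariance, [ξ_X, σY] by the symmetric part, and [ξ_X, ξ_Y] pairs to zero with σZ.
Pairing with ξ_Z sees only the anchor of the bracket, which is a Lie bracket. -/
theorem pairing_bracket_lift_lift (p q r : ℝ) (X Y Z : 𝔛) (x : M) :
    A.pairing x (A.bracket (G.liftSection p X) (G.liftSection q Y) x) (G.lift r x (Z x))
      = 1 / 2 * G.flux X Y Z x + 1 / 2 *
        (r * G.baseMetric x (lieSection X Y x) (Z x)
        + q * (dirDeriv (fun y => G.baseMetric y (Y y) (Z y)) x (X x)
          - G.baseMetric x (lieSection X Z x) (Y x))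
        + p * (dirDeriv (fun y => G.baseMetric y (X y) (Y y)) x (Z x)
          - dirDeriv (fun y => G.baseMetric y (X y) (Z y)) x (Y x)
          + G.baseMetric x (lieSection Y Z x) (X x))) := by
  have hcc : ∀ (u : E x) (W : TangentSpace 𝓘(ℝ, V) x), A.pairing x u (G.covector x W)
      = 1 / 2 * G.baseMetric x (A.anchor x u) W := fun u W => by
    rw [A.pairing_symm, pairing_covector, baseMetric_symm]
  have hξ : ∀ W U : 𝔛, (fun y => A.pairing y (G.covectorSection W y) (G.liftSection 0 U y))
      = fun y => 1 / 2 * G.baseMetric y (W y) (U y) := fun W U => by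
    funext y
    rw [covectorSection_apply, liftSection_apply, ← splitting_eq_lift, pairing_covector_splitting]
  have hd : ∀ (W U : 𝔛) (v : TangentSpace 𝓘(ℝ, V) x),
      dirDeriv (fun y => 1 / 2 * G.baseMetric y (W y) (U y)) x v
        = 1 / 2 * dirDeriv (fun y => G.baseMetric y (W y) (U y)) x v := fun W U v =>
    dirDeriv_const_mul _ (G.mdiffAt_baseMetric W U x) v
  -- `[σX, ξ_W]` paired with `σU`
  have hR : ∀ W U : 𝔛, A.pairing x (A.bracket (G.liftSection 0 X) (G.covectorSection W) x)
      (G.splitting x (U x)) = 1 / 2 * (dirDeriv (fun y => G.baseMetric y (W y) (U y)) x (X x)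
        - G.baseMetric x (lieSection X U x) (W x)) := fun W U => by
    have h := A.invariant (G.liftSection 0 X) (G.covectorSection W) (G.liftSection 0 U) x
    rw [hξ, hd, liftSection_apply, liftSection_apply, anchor_lift, covectorSection_apply,
      pairing_covector, anchor_bracket_liftSection, ← splitting_eq_lift] at h
    rw [G.baseMetric_symm x (lieSection X U x)]
    linear_combination -h
  -- `[ξ_X, σY]` paired with `σZ`
  have hL : A.pairing x (A.bracket (G.covectorSection X) (G.liftSection 0 Y) x)
      (G.splitting x (Z x)) = 1 / 2 * (dirDeriv (fun y => G.baseMetric y (X y) (Y y)) x (Z x)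
        - dirDeriv (fun y => G.baseMetric y (X y) (Z y)) x (Y x)
        + G.baseMetric x (lieSection Y Z x) (X x)) := by
    have h := pairing_bracket_swap (A := A) (G.covectorSection X) (G.liftSection 0 Y)
      (G.liftSection 0 Z) x
    have h' := A.invariant (G.liftSection 0 Y) (G.covectorSection X) (G.liftSection 0 Z) x
    rw [hξ, hd, liftSection_apply, liftSection_apply, anchor_lift, covectorSection_apply,
      pairing_covector, anchor_bracket_liftSection, ← splitting_eq_lift] at h'
    rw [hξ, hd, liftSection_apply, anchor_lift, ← splitting_eq_lift] at h
    rw [G.baseMetric_symm x (lieSection Y Z x)]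
    linear_combination h + h'
  have hxx : A.pairing x (A.bracket (G.covectorSection X) (G.covectorSection Y) x)
      (G.splitting x (Z x)) = 0 := by
    have h := A.invariant (G.covectorSection X) (G.covectorSection Y) (G.liftSection 0 Z) x
    rw [hξ, covectorSection_apply, anchor_covector, dirDeriv_zero_right, covectorSection_apply,
      pairing_covector, anchor_bracket_covectorSection_left, baseMetric_zero_right,
      liftSection_apply, ← splitting_eq_lift] at h
    linear_combination -h
  rw [G.liftSection_eq p, G.liftSection_eq q, lift_apply]
  simp only [map_add, map_smul, LinearMap.add_apply, LinearMap.smul_apply, add_section_apply,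
    smul_section_apply, hcc, anchor_bracket_covectorSection_left,
    anchor_bracket_covectorSection_right, smul_eq_mul, hR, hL, hxx, anchor_bracket_liftSection,
    baseMetric_zero_left, flux]
  ring

/-- The connection `X, Y ↦ π([X₋, Y₊]₊)` and its analogue with exchanged signs, for `s = ±1`. -/
def bismut (s : ℝ) (X Y : 𝔛) : 𝔛 :=
  G.partSection s (A.bracket (G.liftSection (-s) X) (G.liftSection s Y))

/-- For the signs (-s, s, s) the derivative and Lie bracket terms of `pairing_bracket_lift_lift`
assemble to s times the Koszul expression. -/
theorem baseMetric_bismut {s : ℝ} (hs : s * s = 1) (X Y Z : 𝔛) (x : M) :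
    G.baseMetric x (G.bismut s X Y x) (Z x)
      = 1 / 2 * koszul G.baseMetric X Y Z x + s / 2 * G.flux X Y Z x := by
  have h := G.pairing_bracket_lift_lift (-s) s s X Y Z x
  rw [G.pairing_lift_right hs] at h
  have h2 : s * (s * G.baseMetric x (G.bismut s X Y x) (Z x))
      = s * (s * (1 / 2 * koszul G.baseMetric X Y Z x + s / 2 * G.flux X Y Z x)) := by
    rw [bismut, partSection_apply, h, koszul]
    simp only [coe_lieSection]
    linear_combination -(1 / 2 * s * G.flux X Y Z x) * hs
  rwa [← mul_assoc, ← mul_assoc, hs, one_mul, one_mul] at h2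

/-- The Levi-Civita connection of `g` on smooth vector fields. -/
def nabla (X Y : 𝔛) : 𝔛 := (1 / 2 : ℝ) • (G.bismut 1 X Y + G.bismut (-1) X Y)

theorem baseMetric_nabla (X Y Z : 𝔛) (x : M) :
    2 * G.baseMetric x (G.nabla X Y x) (Z x) = koszul G.baseMetric X Y Z x := by
  rw [nabla, smul_section_apply, add_section_apply, baseMetric_smul_left, baseMetric_add_left,
    G.baseMetric_bismut (by norm_num), G.baseMetric_bismut (by norm_num)]
  ring

theorem baseMetric_section_ext {x : M} {X Y : TangentSpace 𝓘(ℝ, V) x}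
    (h : ∀ Z : 𝔛, G.baseMetric x X (Z x) = G.baseMetric x Y (Z x)) : X = Y :=
  G.baseMetric_ext x fun Z => by simpa using h (extendVector Z)

/-- `nabla` solves the Koszul equation, so the chosen value solves it as well, and non-degeneracy of
g makes the solution unique. From here on ∇ is a smooth operation on vector fields. -/
theorem leviCivita_eq (X Y : 𝔛) (x : M) :
    leviCivita G.baseMetric X Y x = G.nabla X Y x := by
  have h := Classical.epsilon_spec (p := fun v : TangentSpace 𝓘(ℝ, V) x =>
    ∀ Z : 𝔛, 2 * G.baseMetric x v (Z x) = koszul G.baseMetric X Y Z x)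
    ⟨G.nabla X Y x, fun Z => G.baseMetric_nabla X Y Z x⟩
  refine G.baseMetric_section_ext fun Z => ?_
  have h1 := h Z
  have h2 := G.baseMetric_nabla X Y Z x
  change 2 * G.baseMetric x (leviCivita G.baseMetric X Y x) (Z x) = _ at h1
  linarith

theorem coe_leviCivita (X Y : 𝔛) : leviCivita G.baseMetric X Y = G.nabla X Y :=
  funext (G.leviCivita_eq X Y)

theorem baseMetric_fun_symm (X Y : 𝔛) :
    (fun y => G.baseMetric y (X y) (Y y)) = fun y => G.baseMetric y (Y y) (X y) :=
  funext fun y => G.baseMetric_symm y _ _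

theorem lieSection_swap (X Y : 𝔛) (x : M) : lieSection X Y x = -lieSection Y X x :=
  VectorField.mlieBracket_swap_apply

theorem nabla_metric (X Y Z : 𝔛) (x : M) :
    dirDeriv (fun y => G.baseMetric y (Y y) (Z y)) x (X x)
      = G.baseMetric x (G.nabla X Y x) (Z x) + G.baseMetric x (Y x) (G.nabla X Z x) := by
  have h1 := G.baseMetric_nabla X Y Z x
  have h2 := G.baseMetric_nabla X Z Y x
  simp only [koszul, ← coe_lieSection] at h1 h2
  rw [G.baseMetric_fun_symm Z Y, lieSection_swap Z Y, ← neg_one_smul ℝ (lieSection Y Z x),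
    baseMetric_smul_left] at h2
  rw [G.baseMetric_symm x (Y x)]
  linarith

theorem nabla_torsion (X Y : 𝔛) (x : M) :
    G.nabla X Y x - G.nabla Y X x = lieSection X Y x := by
  refine G.baseMetric_section_ext fun Z => ?_
  have h1 := G.baseMetric_nabla X Y Z x
  have h2 := G.baseMetric_nabla Y X Z x
  simp only [koszul, ← coe_lieSection] at h1 h2
  rw [G.baseMetric_fun_symm Y X, lieSection_swap Y X, ← neg_one_smul ℝ (lieSection X Y x),
    baseMetric_smul_left] at h2
  rw [baseMetric_sub_left]
  linarith

theorem liftSection_add (s : ℝ) (X Y : 𝔛) :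
    G.liftSection s (X + Y) = G.liftSection s X + G.liftSection s Y := by
  ext x; exact map_add (G.lift s x) _ _

theorem liftSection_smulSection (s : ℝ) (f : C∞M) (X : 𝔛) :
    G.liftSection s (smulSection f X) = smulSection f (G.liftSection s X) := by
  ext x; exact map_smul (G.lift s x) _ _

theorem partSection_add (s : ℝ) (a b : Γ) :
    G.partSection s (a + b) = G.partSection s a + G.partSection s b := by
  ext x; exact map_add (G.part s x) _ _

theorem partSection_smulSection (s : ℝ) (f : C∞M) (a : Γ) :
    G.partSection s (smulSection f a) = smulSection f (G.partSection s a) := by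
  ext x; exact map_smul (G.part s x) _ _

theorem partSection_liftSection {s : ℝ} (hs : s * s = 1) (X : 𝔛) :
    G.partSection s (G.liftSection s X) = X := by
  ext x; exact G.part_lift_self hs x _

theorem bismut_add_left (s : ℝ) (X X' Y : 𝔛) :
    G.bismut s (X + X') Y = G.bismut s X Y + G.bismut s X' Y := by
  rw [bismut, liftSection_add, map_add, LinearMap.add_apply, partSection_add]; rfl

theorem bismut_add_right (s : ℝ) (X Y Y' : 𝔛) :
    G.bismut s X (Y + Y') = G.bismut s X Y + G.bismut s X Y' := by
  rw [bismut, liftSection_add, map_add, partSection_add]; rfl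

theorem bismut_smul_right {s : ℝ} (hs : s * s = 1) (f : C∞M) (X Y : 𝔛) :
    G.bismut s X (smulSection f Y)
      = smulSection (derivFun X f) Y + smulSection f (G.bismut s X Y) := by
  rw [bismut, liftSection_smulSection, bracket_smul_right, anchorSection_liftSection,
    partSection_add, partSection_smulSection, partSection_smulSection,
    G.partSection_liftSection hs]
  rfl

/-- E_{-s} ⟂ E_s removes both correction terms of `pairing_bracket_smul_left`. -/
theorem bismut_smul_left {s : ℝ} (hs : s * s = 1) (f : C∞M) (X Y : 𝔛) :
    G.bismut s (smulSection f X) Y = smulSection f (G.bismut s X Y) := by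
  ext x
  refine G.baseMetric_section_ext fun Z => ?_
  have h := pairing_bracket_smul_left (A := A) (G.liftSection (-s) X) (G.liftSection s Y)
    (G.liftSection s Z) f x
  simp only [liftSection_apply, G.pairing_lift_right hs, G.part_lift_neg hs,
    baseMetric_zero_left] at h
  have h2 : s * (s * G.baseMetric x (G.bismut s (smulSection f X) Y x) (Z x))
      = s * (s * (f x * G.baseMetric x (G.bismut s X Y x) (Z x))) := by
    rw [bismut, bismut, liftSection_smulSection, partSection_apply, partSection_apply, h]
    ring
  rw [smulSection_apply, baseMetric_smul_left]
  rwa [← mul_assoc, ← mul_assoc, hs, one_mul, one_mul] at h2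

theorem nabla_add_left (X X' Y : 𝔛) : G.nabla (X + X') Y = G.nabla X Y + G.nabla X' Y := by
  rw [nabla, bismut_add_left, bismut_add_left, nabla, nabla]
  module

theorem nabla_add_right (X Y Y' : 𝔛) : G.nabla X (Y + Y') = G.nabla X Y + G.nabla X Y' := by
  rw [nabla, bismut_add_right, bismut_add_right, nabla, nabla]
  module

theorem nabla_smul_left (f : C∞M) (X Y : 𝔛) :
    G.nabla (smulSection f X) Y = smulSection f (G.nabla X Y) := by
  ext x
  rw [nabla, G.bismut_smul_left (by norm_num), G.bismut_smul_left (by norm_num), nabla]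
  simp only [smul_section_apply, add_section_apply, smulSection_apply]
  module

theorem nabla_smul_right (f : C∞M) (X Y : 𝔛) :
    G.nabla X (smulSection f Y)
      = smulSection (derivFun X f) Y + smulSection f (G.nabla X Y) := by
  ext x
  rw [nabla, G.bismut_smul_right (by norm_num), G.bismut_smul_right (by norm_num), nabla]
  simp only [smul_section_apply, add_section_apply, smulSection_apply]
  module

end GeneralizedMetric

/-- Skewness in each pair reduces tensoriality to one slot of each pair. This serves both the
Riemann tensor of g and ℛm. -/
theorem exists_quadrilinear {x : M} (R : Γ → Γ → Γ → Γ → ℝ)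
    (add₁ : ∀ a a' b v w, R (a + a') b v w = R a b v w + R a' b v w)
    (smul₁ : ∀ f a b v w, R (smulSection f a) b v w = f x * R a b v w)
    (add₃ : ∀ a b v v' w, R a b (v + v') w = R a b v w + R a b v' w)
    (smul₃ : ∀ f a b v w, R a b (smulSection f v) w = f x * R a b v w)
    (skew₁₂ : ∀ a b v w, R b a v w = -R a b v w) (skew₃₄ : ∀ a b v w, R a b w v = -R a b v w) :
    ∃ T : E x →ₗ[ℝ] E x →ₗ[ℝ] E x →ₗ[ℝ] E x →ₗ[ℝ] ℝ,
      ∀ a b v w, R a b v w = T (a x) (b x) (v x) (w x) := by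
  have add₂ : ∀ a b b' v w, R a (b + b') v w = R a b v w + R a b' v w := fun a b b' v w => by
    rw [skew₁₂, add₁, skew₁₂ a b, skew₁₂ a b']; ring
  have smul₂ : ∀ f a b v w, R a (smulSection f b) v w = f x * R a b v w := fun f a b v w => by
    rw [skew₁₂, smul₁, skew₁₂ a b]; ring
  have add₄ : ∀ a b v w w', R a b v (w + w') = R a b v w + R a b v w' := fun a b v w w' => by
    rw [skew₃₄, add₃, skew₃₄ a b v w, skew₃₄ a b v w']; ring
  have smul₄ : ∀ f a b v w, R a b v (smulSection f w) = f x * R a b v w := fun f a b v w => by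
    rw [skew₃₄, smul₃, skew₃₄ a b v w]; ring
  let T₄ : Γ → Γ → Γ → E x →ₗ[ℝ] ℝ := fun a b v =>
    tensorialMap (fun w => R a b v w) (add₄ a b v) (fun f w => smul₄ f a b v w)
  let T₃ : Γ → Γ → E x →ₗ[ℝ] E x →ₗ[ℝ] ℝ := fun a b =>
    tensorialMap (fun v => T₄ a b v) (fun v v' => LinearMap.ext fun w => add₃ a b v v' _)
      (fun f v => LinearMap.ext fun w => smul₃ f a b v _)
  let T₂ : Γ → E x →ₗ[ℝ] E x →ₗ[ℝ] E x →ₗ[ℝ] ℝ := fun a =>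
    tensorialMap (fun b => T₃ a b)
      (fun b b' => LinearMap.ext fun v => LinearMap.ext fun w => add₂ a b b' _ _)
      (fun f b => LinearMap.ext fun v => LinearMap.ext fun w => smul₂ f a b _ _)
  refine ⟨tensorialMap (fun a => T₂ a)
    (fun a a' => LinearMap.ext fun b => LinearMap.ext fun v => LinearMap.ext fun w =>
      add₁ a a' _ _ _)
    (fun f a => LinearMap.ext fun b => LinearMap.ext fun v => LinearMap.ext fun w =>
      smul₁ f a _ _ _), fun a b v w => ?_⟩
  rw [tensorialMap_apply]
  simp only [T₂, T₃, T₄, tensorialMap_apply]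

section Contraction

variable {W : Type*} [AddCommGroup W] [Module ℝ W] [Module.Finite ℝ W]
  {β γ : W →ₗ[ℝ] W →ₗ[ℝ] ℝ}

/-- The two traces may use different forms, provided that one basis is orthogonal for both: on E
these are the pairing and 𝒢. -/
theorem metricTrace_metricTrace {ι : Type*} [Fintype ι] (e : Basis ι ℝ W)
    (hβ : ∀ u, (∀ v, β u v = 0) → u = 0) (hs : ∀ u v, β u v = β v u)
    (h : ∀ i j, i ≠ j → β (e i) (e j) = 0) (h0 : ∀ i, β (e i) (e i) ≠ 0)
    (gβ : ∀ u, (∀ v, γ u v = 0) → u = 0) (gs : ∀ u v, γ u v = γ v u)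
    (g : ∀ i j, i ≠ j → γ (e i) (e j) = 0) (g0 : ∀ i, γ (e i) (e i) ≠ 0)
    (T : W →ₗ[ℝ] W →ₗ[ℝ] W →ₗ[ℝ] W →ₗ[ℝ] ℝ) :
    metricTrace (fun u v => γ u v) (fun b w => metricTrace (fun u v => β u v)
        (fun a v => T a b v w))
      = ∑ j, ∑ i, (γ (e j) (e j))⁻¹ * ((β (e i) (e i))⁻¹ * T (e i) (e j) (e i) (e j)) := by
  have h1 : ∀ b w, metricTrace (fun u v => β u v) (fun a v => T a b v w)
      = ∑ i, (β (e i) (e i))⁻¹ * T (e i) b (e i) w := fun b w =>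
    metricTrace_eq_sum e hβ hs h h0 (LinearMap.mk₂ ℝ (fun a v => T a b v w)
      (fun _ _ _ => by simp) (fun _ _ _ => by simp) (fun _ _ _ => by simp)
      (fun _ _ _ => by simp))
  simp only [h1]
  rw [metricTrace_sum, Finset.sum_comm]
  refine Finset.sum_congr rfl fun i _ => ?_
  have h2 := metricTrace_eq_sum e gβ gs g g0 (LinearMap.mk₂ ℝ (fun b w => T (e i) b (e i) w)
    (fun _ _ _ => by simp) (fun _ _ _ => by simp) (fun _ _ _ => by simp) (fun _ _ _ => by simp))
  rw [metricTrace_const_mul]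
  refine (congrArg _ h2).trans ?_
  rw [Finset.mul_sum]
  exact Finset.sum_congr rfl fun j _ => by rw [LinearMap.mk₂_apply]; ring

end Contraction

/-! ### Curvature and divergence of g; normal frames -/

namespace GeneralizedMetric

variable (G : GeneralizedMetric A)

/-- The Riemann curvature of `g` on smooth vector fields. -/
def curv (X Y Z : 𝔛) : 𝔛 :=
  G.nabla X (G.nabla Y Z) - G.nabla Y (G.nabla X Z) - G.nabla (lieSection X Y) Z

theorem curvature_eq (X Y Z : 𝔛) (x : M) :
    curvature G.baseMetric X Y Z x = G.curv X Y Z x := by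
  simp only [curvature, ← coe_lieSection, coe_leviCivita, curv]
  rfl

theorem lieSection_add_left (X X' Y : 𝔛) :
    lieSection (X + X') Y = lieSection X Y + lieSection X' Y := by
  ext x
  rw [lieSection_swap, lieSection_add_right, add_section_apply, add_section_apply,
    lieSection_swap X Y, lieSection_swap X' Y, neg_add]

theorem lieSection_smul_left (f : C∞M) (X Y : 𝔛) :
    lieSection (smulSection f X) Y
      = smulSection f (lieSection X Y) - smulSection (derivFun Y f) X := by
  ext x
  rw [lieSection_swap, lieSection_smul_right, add_section_apply, sub_section_apply,
    smulSection_apply, smulSection_apply, smulSection_apply,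
    lieSection_swap X Y]
  module

theorem nabla_sub_left (X X' Y : 𝔛) : G.nabla (X - X') Y = G.nabla X Y - G.nabla X' Y := by
  rw [eq_sub_iff_add_eq, ← nabla_add_left, sub_add_cancel]

theorem curv_add_left (X X' Y Z : 𝔛) : G.curv (X + X') Y Z = G.curv X Y Z + G.curv X' Y Z := by
  simp only [curv, nabla_add_left, nabla_add_right, lieSection_add_left]
  abel

theorem curv_smul_left (f : C∞M) (X Y Z : 𝔛) :
    G.curv (smulSection f X) Y Z = smulSection f (G.curv X Y Z) := by
  simp only [curv, nabla_smul_left, nabla_smul_right, lieSection_smul_left, nabla_sub_left]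
  ext x
  simp only [sub_section_apply, add_section_apply, smulSection_apply, smul_sub]
  abel

theorem curv_swap (X Y Z : 𝔛) (x : M) : G.curv Y X Z x = -G.curv X Y Z x := by
  have h : G.nabla (lieSection Y X) Z x = -G.nabla (lieSection X Y) Z x := by
    have h0 : lieSection X Y + lieSection Y X = 0 := by
      ext y
      rw [add_section_apply, lieSection_swap, neg_add_cancel]; rfl
    have h1 := G.nabla_add_left (lieSection X Y) (lieSection Y X) Z
    have h2 : G.nabla 0 Z = 0 := by
      have := G.nabla_add_left 0 0 Z
      simpa using this
    rw [h0, h2] at h1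
    exact eq_neg_of_add_eq_zero_right (DFunLike.congr_fun h1 x).symm
  simp only [curv, sub_section_apply, h]
  abel

theorem dirDeriv_dirDeriv_baseMetric (X Y Z W : 𝔛) (x : M) :
    dirDeriv (fun y => dirDeriv (fun z => G.baseMetric z (Z z) (W z)) y (Y y)) x (X x)
      = G.baseMetric x (G.nabla X (G.nabla Y Z) x) (W x)
        + G.baseMetric x (G.nabla Y Z x) (G.nabla X W x)
        + (G.baseMetric x (G.nabla X Z x) (G.nabla Y W x)
        + G.baseMetric x (Z x) (G.nabla X (G.nabla Y W) x)) := by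
  rw [funext fun y => G.nabla_metric Y Z W y,
    dirDeriv_add (G.mdiffAt_baseMetric _ _ x) (G.mdiffAt_baseMetric _ _ x), nabla_metric,
    nabla_metric]

/-- Apply [X, Y] = XY - YX to the function g(Z, W) and expand with metricity; the products of first
derivatives cancel. -/
theorem baseMetric_curv_skew (X Y Z W : 𝔛) (x : M) :
    G.baseMetric x (G.curv X Y W x) (Z x) = -G.baseMetric x (G.curv X Y Z x) (W x) := by
  have h := dirDeriv_mlieBracket X Y ⟨_, G.contMDiff_baseMetric Z W⟩ x
  have h1 := G.dirDeriv_dirDeriv_baseMetric X Y Z W x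
  have h2 := G.dirDeriv_dirDeriv_baseMetric Y X Z W x
  have h3 := G.nabla_metric (lieSection X Y) Z W x
  have h4 : dirDeriv (fun z => G.baseMetric z (Z z) (W z)) x (lieSection X Y x)
    = dirDeriv (fun y => dirDeriv (fun z => G.baseMetric z (Z z) (W z)) y (Y y)) x (X x)
      - dirDeriv (fun y => dirDeriv (fun z => G.baseMetric z (Z z) (W z)) y (X y)) x (Y x) := h
  simp only [curv, sub_section_apply, baseMetric_sub_left]
  rw [G.baseMetric_symm x (Z x), G.baseMetric_symm x (G.nabla Y Z x)] at h1
  rw [G.baseMetric_symm x (Z x), G.baseMetric_symm x (G.nabla Y Z x)] at h2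
  rw [G.baseMetric_symm x (Z x)] at h3
  rw [h1, h2, h3] at h4
  linarith

theorem exists_riemann_eq (x : M) :
    ∃ T : TangentSpace 𝓘(ℝ, V) x →ₗ[ℝ] TangentSpace 𝓘(ℝ, V) x →ₗ[ℝ]
      TangentSpace 𝓘(ℝ, V) x →ₗ[ℝ] TangentSpace 𝓘(ℝ, V) x →ₗ[ℝ] ℝ,
      (∀ a b v w, ExactCourant.riemann G.baseMetric x a b v w = T a b v w) ∧
      ∀ X Y Z W : 𝔛, G.baseMetric x (G.curv Z W Y x) (X x) = T (X x) (Y x) (Z x) (W x) := by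
  obtain ⟨T, hT⟩ := exists_quadrilinear (V := V) (F := V)
    (E := (TangentSpace 𝓘(ℝ, V) : M → Type _)) (x := x)
    (fun X Y Z W : 𝔛 => G.baseMetric x (G.curv Z W Y x) (X x))
    (fun X X' Y Z W => by rw [add_section_apply, baseMetric_add_right])
    (fun f X Y Z W => by rw [smulSection_apply, baseMetric_smul_right])
    (fun X Y Z Z' W => by rw [curv_add_left, add_section_apply, baseMetric_add_left])
    (fun f X Y Z W => by rw [curv_smul_left, smulSection_apply, baseMetric_smul_left])
    (fun X Y Z W => G.baseMetric_curv_skew Z W Y X x)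
    (fun X Y Z W => by rw [curv_swap, ← neg_one_smul ℝ, baseMetric_smul_left, neg_one_mul])
  refine ⟨T, fun a b v w => ?_, hT⟩
  have := hT (extendVector a) (extendVector b) (extendVector v) (extendVector w)
  simp only [extendVector_apply] at this
  rw [← this, ExactCourant.riemann, curvature_eq]

theorem scalarCurvature_eq_sum {ι : Type*} [Fintype ι] {x : M}
    (e : Basis ι ℝ (TangentSpace 𝓘(ℝ, V) x)) (Y : ι → 𝔛) (hY : ∀ i, Y i x = e i)
    (h : ∀ i j, i ≠ j → G.baseMetric x (e i) (e j) = 0)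
    (h0 : ∀ i, G.baseMetric x (e i) (e i) ≠ 0) :
    ExactCourant.scalarCurvature G.baseMetric x = ∑ j, ∑ i, (G.baseMetric x (e j) (e j))⁻¹ *
      ((G.baseMetric x (e i) (e i))⁻¹ *
        G.baseMetric x (G.curv (Y i) (Y j) (Y j) x) (Y i x)) := by
  obtain ⟨T, hT, hT'⟩ := G.exists_riemann_eq x
  simp only [hT']
  simp only [hY]
  have hric : ricci G.baseMetric x = fun b w =>
      metricTrace (G.baseMetric x) fun a v => T a b v w := by
    funext b w
    simp only [ricci, hT]
  rw [ExactCourant.scalarCurvature, hric]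
  simp only [← coe_metricMap, ← metricMap_apply] at h h0 ⊢
  exact metricTrace_metricTrace e (G.metricMap_nondegenerate x)
    (fun u v => by rw [metricMap_apply, metricMap_apply, baseMetric_symm]) h h0
    (G.metricMap_nondegenerate x)
    (fun u v => by rw [metricMap_apply, metricMap_apply, baseMetric_symm]) h h0 T

theorem normSq₃_threeForm_eq_sum {ι : Type*} [Fintype ι] {x : M}
    (e : Basis ι ℝ (TangentSpace 𝓘(ℝ, V) x))
    (h : ∀ i j, i ≠ j → G.baseMetric x (e i) (e j) = 0)
    (h0 : ∀ i, G.baseMetric x (e i) (e i) ≠ 0) :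
    normSq₃ (G.baseMetric x) (G.threeForm x) = ∑ i, ∑ j, ∑ k, (G.baseMetric x (e i) (e i))⁻¹ *
      (G.baseMetric x (e j) (e j))⁻¹ * (G.baseMetric x (e k) (e k))⁻¹ *
        (G.threeForm x (e i) (e j) (e k)) ^ 2 := by
  simp only [← coe_metricMap, ← metricMap_apply] at h h0 ⊢
  exact normSq₃_eq_sum e (G.metricMap_nondegenerate x)
    (fun u v => by rw [metricMap_apply, metricMap_apply, baseMetric_symm]) h h0
    (G.threeFormMap x)

/-- The covariant derivative `v ↦ ∇_v X` at a point. -/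
def nablaMap (X : 𝔛) (x : M) : TangentSpace 𝓘(ℝ, V) x →ₗ[ℝ] TangentSpace 𝓘(ℝ, V) x :=
  tensorialMap (fun Z : 𝔛 => G.nabla Z X x) (fun X X' => by rw [nabla_add_left]; rfl)
    (fun f X => by rw [nabla_smul_left]; rfl)

theorem nablaMap_apply (X Z : 𝔛) (x : M) : G.nablaMap X x (Z x) = G.nabla Z X x :=
  tensorialMap_apply (fun Z : 𝔛 => G.nabla Z X x) _ _ Z

theorem divergence_eq_sum {ι : Type*} [Fintype ι] [DecidableEq ι] {x : M}
    (e : Basis ι ℝ (TangentSpace 𝓘(ℝ, V) x)) (Y : ι → 𝔛) (hY : ∀ i, Y i x = e i) (X : 𝔛) :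
    ExactCourant.divergence G.baseMetric X x = ∑ k, ∑ l, (gram (G.metricMap x) e)⁻¹ k l *
      G.baseMetric x (G.nabla (Y l) X x) (Y k x) := by
  have h := metricTrace_eq_sum_inv_gram e (G.metricMap_nondegenerate x)
    (fun u v => by rw [metricMap_apply, metricMap_apply, baseMetric_symm])
    (G.metricMap x ∘ₗ G.nablaMap X x)
  have h1 : (fun u v => (G.metricMap x ∘ₗ G.nablaMap X x) u v)
      = fun u v => G.baseMetric x (leviCivita G.baseMetric (extendVector u) X x) v := by
    funext u v
    rw [LinearMap.comp_apply, metricMap_apply, leviCivita_eq, ← nablaMap_apply, extendVector_apply]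
  rw [h1, coe_metricMap] at h
  rw [ExactCourant.divergence, h]
  simp only [← nablaMap_apply, hY, LinearMap.comp_apply, metricMap_apply]

theorem nabla_sum_right {ι : Type*} (t : Finset ι) (Z : 𝔛) (X : ι → 𝔛) :
    G.nabla Z (∑ i ∈ t, X i) = ∑ i ∈ t, G.nabla Z (X i) :=
  map_sum (AddMonoidHom.mk' (G.nabla Z) (G.nabla_add_right Z)) X t

/-- Every basis of a tangent space extends to vector fields with vanishing covariant derivative at
the base point. -/
theorem exists_normal_frame {ι : Type*} [Fintype ι] {x : M}
    (e : Basis ι ℝ (TangentSpace 𝓘(ℝ, V) x)) :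
    ∃ Y : ι → 𝔛, (∀ i, Y i x = e i) ∧ ∀ i Z, G.nabla Z (Y i) x = 0 := by
  -- The coefficients vanish at x, so the values stay; their differentials are minus the coordinates
  -- of ∇e_i, so the Leibniz rule cancels the covariant derivative.
  choose f hf0 hf using fun i j => exists_function_dirDeriv (V := V) x
    (-(e.coord j ∘ₗ G.nablaMap (extendVector (e i)) x))
  refine ⟨fun i => extendVector (e i) + ∑ j, smulSection (f i j) (extendVector (e j)),
    fun i => ?_, fun i Z => ?_⟩
  · rw [add_section_apply, sum_section_apply, extendVector_apply]
    simp only [smulSection_apply, hf0, zero_smul, Finset.sum_const_zero, add_zero]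
  · rw [nabla_add_right, nabla_sum_right, add_section_apply, sum_section_apply]
    simp only [nabla_smul_right, add_section_apply, smulSection_apply, derivFun_apply, hf, hf0,
      zero_smul, add_zero, extendVector_apply, LinearMap.neg_apply, LinearMap.comp_apply,
      nablaMap_apply, neg_smul, Finset.sum_neg_distrib]
    rw [← sub_eq_add_neg, sub_eq_zero]
    exact (e.sum_repr _).symm

end GeneralizedMetric

section Flip

variable {W : Type*} [AddCommGroup W] [Module ℝ W] [Module.Finite ℝ W]

theorem metricTrace_flip {β : W → W → ℝ} (hs : ∀ u v, β u v = β v u) (B : W → W → ℝ) :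
    metricTrace β (fun u v => B v u) = metricTrace β B := by
  have h : (inverseGram β).transpose = inverseGram β := by
    rw [inverseGram, Matrix.transpose_nonsing_inv]
    congr 1
    ext i j
    exact hs _ _
  rw [metricTrace, Finset.sum_comm, metricTrace]
  refine Finset.sum_congr rfl fun i _ => Finset.sum_congr rfl fun j _ => ?_
  rw [← congrFun (congrFun h i) j, Matrix.transpose_apply]

end Flip

/-! ### The generalised Riemann tensor: symmetries and tensoriality -/

namespace GeneralizedConnection

variable (D : GeneralizedConnection A)

theorem cov_apply (a b : Γ) (x : M) : D.cov a b x = D.D b x (a x) := rfl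

theorem cov_add_left (a a' b : Γ) : D.cov (a + a') b = D.cov a b + D.cov a' b := by
  ext x; exact map_add (D.D b x) _ _

theorem cov_smul_left (f : C∞M) (a b : Γ) :
    D.cov (smulSection f a) b = smulSection f (D.cov a b) := by
  ext x; exact map_smul (D.D b x) _ _

theorem cov_add_right (a b b' : Γ) : D.cov a (b + b') = D.cov a b + D.cov a b' := by
  ext x
  rw [cov_apply, D.add]; rfl

theorem cov_smul_right (f : C∞M) (a b : Γ) :
    D.cov a (smulSection f b)
      = smulSection f (D.cov a b) + smulSection (derivFun (anchorSection A a) f) b := by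
  ext x
  rw [cov_apply, D.leibniz]; rfl

theorem dirDeriv_pairing (a b c : Γ) (x : M) :
    dirDeriv (fun y => A.pairing y (b y) (c y)) x (A.anchor x (a x))
      = A.pairing x (D.cov a b x) (c x) + A.pairing x (b x) (D.cov a c x) :=
  D.metric b c x (a x)

/-- The operator `D_v D_w b - D_w D_v b - D_{[v,w]} b`. -/
def curvOp (v w b : Γ) : Γ :=
  D.cov v (D.cov w b) - D.cov w (D.cov v b) - D.cov (A.bracket v w) b

theorem naiveCurvature_eq (a b v w : Γ) (x : M) :
    D.naiveCurvature a b v w x = A.pairing x (D.curvOp v w b x) (a x) := rfl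

theorem curvOp_add_middle (v w w' b : Γ) :
    D.curvOp v (w + w') b = D.curvOp v w b + D.curvOp v w' b := by
  simp only [curvOp, cov_add_left, cov_add_right, map_add]
  abel

theorem curvOp_smul_middle (f : C∞M) (v w b : Γ) :
    D.curvOp v (smulSection f w) b = smulSection f (D.curvOp v w b) := by
  simp only [curvOp, cov_smul_left, cov_smul_right, bracket_smul_right, cov_add_left]
  ext x
  simp only [sub_section_apply, add_section_apply, smulSection_apply, smul_sub]
  abel

theorem dirDeriv_dirDeriv_pairing (a b v w : Γ) (x : M) :
    dirDeriv (fun y => dirDeriv (fun z => A.pairing z (b z) (a z)) y (A.anchor y (w y))) x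
        (A.anchor x (v x))
      = A.pairing x (D.cov v (D.cov w b) x) (a x) + A.pairing x (D.cov w b x) (D.cov v a x)
        + (A.pairing x (D.cov v b x) (D.cov w a x)
          + A.pairing x (b x) (D.cov v (D.cov w a) x)) := by
  rw [funext fun y => D.dirDeriv_pairing w b a y,
    dirDeriv_add (mdiffAt_pairing _ _ x) (mdiffAt_pairing _ _ x), D.dirDeriv_pairing,
    D.dirDeriv_pairing]

theorem naiveCurvature_skew (a b v w : Γ) (x : M) :
    D.naiveCurvature b a v w x = -D.naiveCurvature a b v w x := by
  have h := dirDeriv_mlieBracket (anchorSection A v) (anchorSection A w)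
    ⟨_, A.pairing_smooth b a⟩ x
  rw [← anchor_bracket] at h
  have h1 := D.dirDeriv_dirDeriv_pairing a b v w x
  have h2 := D.dirDeriv_dirDeriv_pairing a b w v x
  have h3 := D.dirDeriv_pairing (A.bracket v w) b a x
  have h4 : dirDeriv (fun z => A.pairing z (b z) (a z)) x (A.anchor x (A.bracket v w x))
    = dirDeriv (fun y => dirDeriv (fun z => A.pairing z (b z) (a z)) y (A.anchor y (w y))) x
        (A.anchor x (v x))
      - dirDeriv (fun y => dirDeriv (fun z => A.pairing z (b z) (a z)) y (A.anchor y (v y))) x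
        (A.anchor x (w x)) := h
  rw [naiveCurvature_eq, A.pairing_symm, naiveCurvature_eq]
  simp only [curvOp, sub_section_apply, map_sub, LinearMap.sub_apply]
  linarith

/-- The trace `tr_E ⟨Dv, w⟩⟨Db, a⟩`. -/
def derivTrace (a b v w : Γ) (x : M) : ℝ :=
  haveI : Module.Finite ℝ (E x) := VectorBundle.finiteDimensional ℝ F E x
  metricTrace (fun u u' => A.pairing x u u') fun u u' =>
    A.pairing x (D.D v x u) (w x) * A.pairing x (D.D b x u') (a x)

theorem riemann_eq (a b v w : Γ) (x : M) :
    D.riemann a b v w x = 1 / 2 * (D.naiveCurvature a b v w x + D.naiveCurvature w v b a x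
      + D.derivTrace a b v w x) := rfl

theorem derivTrace_swap (a b v w : Γ) (x : M) :
    D.derivTrace w v b a x = D.derivTrace a b v w x := by
  have : Module.Finite ℝ (E x) := VectorBundle.finiteDimensional ℝ F E x
  rw [derivTrace, ← metricTrace_flip (A.pairing_symm x), derivTrace]
  simp only [mul_comm]

theorem riemann_swap (a b v w : Γ) (x : M) : D.riemann w v b a x = D.riemann a b v w x := by
  rw [riemann_eq, riemann_eq, derivTrace_swap]
  ring

/-- By metricity the symmetrised second factor is the derivative of ⟨a,b⟩ along π(u'), that is, the
pairing of u' with [a,b] + [b,a]. The trace against ⟨D_u v, w⟩ then inserts this element for u. -/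
theorem derivTrace_add_swap (a b v w : Γ) (x : M) :
    D.derivTrace a b v w x + D.derivTrace b a v w x
      = A.pairing x (D.cov (A.bracket a b + A.bracket b a) v x) (w x) := by
  have : Module.Finite ℝ (E x) := VectorBundle.finiteDimensional ℝ F E x
  have h := metricTrace_mul (β := A.pairing x) (A.pairing_nondegenerate x) (A.pairing_symm x)
    ((A.pairing x).flip (w x) ∘ₗ D.D v x) (A.bracket a b x + A.bracket b a x)
  rw [derivTrace, derivTrace, ← metricTrace_add]
  refine Eq.trans ?_ h
  congr 1
  funext u u'
  obtain ⟨c, rfl⟩ := exists_section (V := V) (F := F) x u'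
  rw [← A.symmetric_part a b c, D.dirDeriv_pairing, A.pairing_symm x (a x)]
  simp only [LinearMap.comp_apply, LinearMap.flip_apply, cov_apply]
  ring

/-- The Dorfman bracket is not skew, so R(b,a) + R(a,b) = -D_{[a,b]+[b,a]}. The trace term in the
definition of ℛm compensates exactly for this. -/
theorem riemann_skew (a b v w : Γ) (x : M) : D.riemann b a v w x = -D.riemann a b v w x := by
  have h : D.naiveCurvature w v b a x + D.naiveCurvature w v a b x
      = -A.pairing x (D.cov (A.bracket a b + A.bracket b a) v x) (w x) := by
    rw [cov_add_left]
    simp only [naiveCurvature_eq, curvOp, sub_section_apply, add_section_apply, map_sub, map_add,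
      LinearMap.sub_apply, LinearMap.add_apply]
    ring
  have h2 := D.derivTrace_add_swap a b v w x
  rw [riemann_eq, riemann_eq, naiveCurvature_skew]
  linarith

/-- The slot `a` is the convenient one to test. It occurs as the vector paired with, and as the
second argument of R, in which R is tensorial because the bracket satisfies the plain Leibniz rule
there. -/
theorem riemann_add (a a' b v w : Γ) (x : M) :
    D.riemann (a + a') b v w x = D.riemann a b v w x + D.riemann a' b v w x := by
  have : Module.Finite ℝ (E x) := VectorBundle.finiteDimensional ℝ F E x
  simp only [riemann_eq, naiveCurvature_eq, curvOp_add_middle, add_section_apply, map_add,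
    LinearMap.add_apply, derivTrace, mul_add, metricTrace_add]
  ring

theorem riemann_smul (f : C∞M) (a b v w : Γ) (x : M) :
    D.riemann (smulSection f a) b v w x = f x * D.riemann a b v w x := by
  have : Module.Finite ℝ (E x) := VectorBundle.finiteDimensional ℝ F E x
  have h : D.derivTrace (smulSection f a) b v w x = f x * D.derivTrace a b v w x := by
    rw [derivTrace, derivTrace, ← metricTrace_const_mul]
    congr 1
    funext u u'
    rw [smulSection_apply, map_smul, smul_eq_mul]
    ring
  simp only [riemann_eq, naiveCurvature_eq, curvOp_smul_middle, smulSection_apply, map_smul,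
    LinearMap.smul_apply, smul_eq_mul, h]
  ring

theorem exists_riemann_eq (x : M) :
    ∃ T : E x →ₗ[ℝ] E x →ₗ[ℝ] E x →ₗ[ℝ] E x →ₗ[ℝ] ℝ,
      ∀ a b v w, D.riemann a b v w x = T (a x) (b x) (v x) (w x) := by
  have skew₃₄ : ∀ a b v w, D.riemann a b w v x = -D.riemann a b v w x := fun a b v w => by
    rw [← D.riemann_swap, riemann_skew, riemann_swap]
  refine exists_quadrilinear (fun a b v w => D.riemann a b v w x)
    (fun a a' b v w => D.riemann_add a a' b v w x) (fun f a b v w => D.riemann_smul f a b v w x)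
    (fun a b v v' w => ?_) (fun f a b v w => ?_) (fun a b v w => D.riemann_skew a b v w x) skew₃₄
  · rw [skew₃₄, ← D.riemann_swap, riemann_add, D.riemann_swap a b w v, D.riemann_swap a b w v',
      skew₃₄ a b v w, skew₃₄ a b v' w]
    ring
  · rw [skew₃₄, ← D.riemann_swap, riemann_smul, D.riemann_swap, skew₃₄]
    ring

end GeneralizedConnection

/-! ### Bases adapted to E₊ ⊕ E₋ and the scalar curvature -/

namespace GeneralizedMetric

variable (G : GeneralizedMetric A)

/-- The decomposition of `E x` into two copies of the tangent space. -/
def liftEquiv (x : M) : (TangentSpace 𝓘(ℝ, V) x × TangentSpace 𝓘(ℝ, V) x) ≃ₗ[ℝ] E x where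
  toFun p := G.lift 1 x p.1 + G.lift (-1) x p.2
  invFun u := (G.part 1 x u, G.part (-1) x u)
  map_add' p q := by
    simp only [Prod.fst_add, Prod.snd_add, map_add]; abel
  map_smul' c p := by
    simp only [Prod.smul_fst, Prod.smul_snd, map_smul, RingHom.id_apply, smul_add]
  left_inv p := by
    have h : G.part (-1) x (G.lift 1 x p.1) = 0 := by
      have := G.part_lift_neg (s := -1) (by norm_num) x p.1
      rwa [neg_neg] at this
    simp only [map_add, G.part_lift_self (s := 1) (by norm_num),
      G.part_lift_self (s := -1) (by norm_num), G.part_lift_neg (s := 1) (by norm_num), h,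
      add_zero, zero_add]
  right_inv u := (G.eq_lift_add_lift x u).symm

/-- The basis of `E x` given by the lifts of a basis of the tangent space to `E_±`. -/
def liftBasis {ι : Type*} {x : M} (e : Basis ι ℝ (TangentSpace 𝓘(ℝ, V) x)) :
    Basis (ι ⊕ ι) ℝ (E x) := (e.prod e).map (G.liftEquiv x)

theorem liftBasis_inl {ι : Type*} {x : M} (e : Basis ι ℝ (TangentSpace 𝓘(ℝ, V) x)) (i : ι) :
    G.liftBasis e (Sum.inl i) = G.lift 1 x (e i) := by
  simp [liftBasis, liftEquiv]

theorem liftBasis_inr {ι : Type*} {x : M} (e : Basis ι ℝ (TangentSpace 𝓘(ℝ, V) x)) (i : ι) :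
    G.liftBasis e (Sum.inr i) = G.lift (-1) x (e i) := by
  simp [liftBasis, liftEquiv]

section OrthogonalBasis

variable {ι : Type*} {x : M} {e : Basis ι ℝ (TangentSpace 𝓘(ℝ, V) x)}

theorem pairing_liftBasis_orthogonal (h : ∀ i j, i ≠ j → G.baseMetric x (e i) (e j) = 0)
    (i j : ι ⊕ ι) (hij : i ≠ j) : A.pairing x (G.liftBasis e i) (G.liftBasis e j) = 0 := by
  rcases i with i | i <;> rcases j with j | j <;>
    simp only [liftBasis_inl, liftBasis_inr, pairing_lift_lift]
  · rw [h i j fun h => hij (by rw [h]), mul_zero]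
  · norm_num
  · norm_num
  · rw [h i j fun h => hij (by rw [h]), mul_zero]

theorem form_liftBasis_orthogonal (h : ∀ i j, i ≠ j → G.baseMetric x (e i) (e j) = 0)
    (i j : ι ⊕ ι) (hij : i ≠ j) : G.form x (G.liftBasis e i) (G.liftBasis e j) = 0 := by
  have h1 : (1 : ℝ) * 1 = 1 := by norm_num
  have h2 : (-1 : ℝ) * -1 = 1 := by norm_num
  rcases i with i | i <;> rcases j with j | j <;>
    simp only [liftBasis_inl, liftBasis_inr, G.form_lift_lift h1, G.form_lift_lift h2]
  · rw [h i j fun h => hij (by rw [h]), mul_zero]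
  · norm_num
  · norm_num
  · rw [h i j fun h => hij (by rw [h]), mul_zero]

theorem pairing_liftBasis_inl (i : ι) :
    A.pairing x (G.liftBasis e (Sum.inl i)) (G.liftBasis e (Sum.inl i))
      = G.baseMetric x (e i) (e i) := by
  rw [liftBasis_inl, pairing_lift_lift]; ring

theorem pairing_liftBasis_inr (i : ι) :
    A.pairing x (G.liftBasis e (Sum.inr i)) (G.liftBasis e (Sum.inr i))
      = -G.baseMetric x (e i) (e i) := by
  rw [liftBasis_inr, pairing_lift_lift]; ring

theorem form_liftBasis_inl (i : ι) :
    G.form x (G.liftBasis e (Sum.inl i)) (G.liftBasis e (Sum.inl i))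
      = G.baseMetric x (e i) (e i) := by
  rw [liftBasis_inl, G.form_lift_lift (by norm_num)]; ring

theorem form_liftBasis_inr (i : ι) :
    G.form x (G.liftBasis e (Sum.inr i)) (G.liftBasis e (Sum.inr i))
      = G.baseMetric x (e i) (e i) := by
  rw [liftBasis_inr, G.form_lift_lift (by norm_num)]; ring

end OrthogonalBasis

theorem formMap_nondegenerate (x : M) (u : E x) (h : ∀ v, G.formMap x u v = 0) : u = 0 := by
  have h0 : G.endo x u = 0 := A.pairing_nondegenerate x _ h
  rw [← G.endo_involutive x u, h0, map_zero]

theorem formMap_symm (x : M) (u v : E x) : G.formMap x u v = G.formMap x v u := by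
  simp only [formMap, LinearMap.comp_apply]
  rw [G.endo_symm, A.pairing_symm]

end GeneralizedMetric

namespace GeneralizedConnection

variable (D : GeneralizedConnection A) (G : GeneralizedMetric A)

/-- The scalar curvature is a sum of contributions of `E₊` and `E₋`. -/
theorem scalarCurvature_eq_sum {ι : Type*} [Fintype ι] {x : M}
    (e : Basis ι ℝ (TangentSpace 𝓘(ℝ, V) x)) (Y : ι → 𝔛) (hY : ∀ i, Y i x = e i)
    (h : ∀ i j, i ≠ j → G.baseMetric x (e i) (e j) = 0)
    (h0 : ∀ i, G.baseMetric x (e i) (e i) ≠ 0) :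
    D.scalarCurvature G x = 1 / 2 *
      (∑ j, ∑ i, (G.baseMetric x (e j) (e j))⁻¹ * ((G.baseMetric x (e i) (e i))⁻¹ *
          D.riemann (G.liftSection 1 (Y i)) (G.liftSection 1 (Y j)) (G.liftSection 1 (Y i))
            (G.liftSection 1 (Y j)) x)
      - ∑ j, ∑ i, (G.baseMetric x (e j) (e j))⁻¹ * ((G.baseMetric x (e i) (e i))⁻¹ *
          D.riemann (G.liftSection (-1) (Y i)) (G.liftSection (-1) (Y j)) (G.liftSection (-1) (Y i))
            (G.liftSection (-1) (Y j)) x)) := by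
  have : Module.Finite ℝ (E x) := VectorBundle.finiteDimensional ℝ F E x
  obtain ⟨T, hT⟩ := D.exists_riemann_eq x
  have hsw : ∀ a b, T a b a b = T b a b a := fun a b => by
    have h1 := D.riemann_swap (extendSection V F b) (extendSection V F a) (extendSection V F b)
      (extendSection V F a) x
    simpa only [hT, extendSection_apply] using h1
  have hric : D.ricci x = fun b w => metricTrace (fun u u' => A.pairing x u u') fun a v =>
      T a b v w := by
    funext b w
    simp only [ricci, hT, extendSection_apply]
  have key := metricTrace_metricTrace (G.liftBasis e) (β := A.pairing x) (γ := G.formMap x)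
    (A.pairing_nondegenerate x) (A.pairing_symm x) (G.pairing_liftBasis_orthogonal h)
    (by
      rintro (i | i)
      · rw [G.pairing_liftBasis_inl]; exact h0 i
      · rw [G.pairing_liftBasis_inr]; exact neg_ne_zero.2 (h0 i))
    (G.formMap_nondegenerate x) (G.formMap_symm x) (G.form_liftBasis_orthogonal h)
    (by
      rintro (i | i)
      · exact (G.form_liftBasis_inl i).trans_ne (h0 i)
      · exact (G.form_liftBasis_inr i).trans_ne (h0 i)) T
  have hform : ∀ i, G.formMap x (G.liftBasis e i) (G.liftBasis e i)
      = G.form x (G.liftBasis e i) (G.liftBasis e i) := fun i => rfl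
  have hscal : D.scalarCurvature G x = 1 / 2 * metricTrace (fun u v => G.formMap x u v)
      (fun b w => metricTrace (fun u u' => A.pairing x u u') fun a v => T a b v w) := by
    rw [scalarCurvature, hric]; rfl
  rw [hscal, key]
  simp only [Fintype.sum_sum_type, hform, G.form_liftBasis_inl, G.form_liftBasis_inr,
    G.pairing_liftBasis_inl, G.pairing_liftBasis_inr, Finset.sum_add_distrib]
  simp only [hT, GeneralizedMetric.liftSection_apply, hY, G.liftBasis_inl, G.liftBasis_inr,
    inv_neg]
  -- The inner trace uses the pairing, hence the weight -g_ii⁻¹ on E₋, while the outer one uses 𝒢.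
  -- The two mixed blocks therefore have opposite signs, and pair symmetry `hsw` makes them cancel.
  have hmix : ∑ j, ∑ i, (G.baseMetric x (e j) (e j))⁻¹ * (-(G.baseMetric x (e i) (e i))⁻¹ *
        T (G.lift (-1) x (e i)) (G.lift 1 x (e j)) (G.lift (-1) x (e i)) (G.lift 1 x (e j)))
      = -∑ j, ∑ i, (G.baseMetric x (e j) (e j))⁻¹ * ((G.baseMetric x (e i) (e i))⁻¹ *
        T (G.lift 1 x (e i)) (G.lift (-1) x (e j)) (G.lift 1 x (e i)) (G.lift (-1) x (e j))) := by
    rw [Finset.sum_comm, ← Finset.sum_neg_distrib]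
    refine Finset.sum_congr rfl fun j _ => ?_
    rw [← Finset.sum_neg_distrib]
    refine Finset.sum_congr rfl fun i _ => ?_
    rw [hsw]
    ring
  rw [hmix]
  simp only [neg_mul, mul_neg, Finset.sum_neg_distrib]
  ring

end GeneralizedConnection

/-! ### Traces in orthogonal and in normal frames -/

namespace GeneralizedMetric

variable (G : GeneralizedMetric A)

section OrthogonalBasis

variable {ι : Type*} [Fintype ι] {x : M} {e : Basis ι ℝ (TangentSpace 𝓘(ℝ, V) x)}

theorem eq_sum_of_orthogonal (h : ∀ i j, i ≠ j → G.baseMetric x (e i) (e j) = 0)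
    (h0 : ∀ i, G.baseMetric x (e i) (e i) ≠ 0) (X : TangentSpace 𝓘(ℝ, V) x) :
    X = ∑ k, ((G.baseMetric x (e k) (e k))⁻¹ * G.baseMetric x X (e k)) • e k := by
  classical
  have hr : ∀ k, G.baseMetric x X (e k) = e.repr X k * G.baseMetric x (e k) (e k) := fun k => by
    conv_lhs => rw [← e.sum_repr X]
    rw [← metricMap_apply, map_sum, LinearMap.sum_apply, Finset.sum_eq_single k]
    · rw [map_smul, LinearMap.smul_apply, metricMap_apply, smul_eq_mul]
    · intro j _ hj
      rw [map_smul, LinearMap.smul_apply, metricMap_apply, h j k hj, smul_zero]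
    · simp
  conv_lhs => rw [← e.sum_repr X]
  refine Finset.sum_congr rfl fun k _ => ?_
  rw [hr, mul_comm (e.repr X k), inv_mul_cancel_left₀ (h0 k)]

theorem baseMetric_eq_sum (h : ∀ i j, i ≠ j → G.baseMetric x (e i) (e j) = 0)
    (h0 : ∀ i, G.baseMetric x (e i) (e i) ≠ 0) (X Z : TangentSpace 𝓘(ℝ, V) x) :
    G.baseMetric x X Z
      = ∑ k, (G.baseMetric x (e k) (e k))⁻¹
        * (G.baseMetric x X (e k) * G.baseMetric x Z (e k)) := by
  conv_lhs => rw [G.eq_sum_of_orthogonal h h0 X]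
  rw [← metricMap_apply, map_sum, LinearMap.sum_apply]
  refine Finset.sum_congr rfl fun k _ => ?_
  rw [map_smul, LinearMap.smul_apply, metricMap_apply, smul_eq_mul, G.baseMetric_symm x (e k) Z]
  ring

theorem trace_eq_sum_of_orthogonal (h : ∀ i j, i ≠ j → G.baseMetric x (e i) (e j) = 0)
    (h0 : ∀ i, G.baseMetric x (e i) (e i) ≠ 0)
    (L : TangentSpace 𝓘(ℝ, V) x →ₗ[ℝ] TangentSpace 𝓘(ℝ, V) x) :
    LinearMap.trace ℝ _ L
      = ∑ k, (G.baseMetric x (e k) (e k))⁻¹ * G.baseMetric x (L (e k)) (e k) := by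
  classical
  rw [LinearMap.trace_eq_matrix_trace ℝ e, Matrix.trace]
  refine Finset.sum_congr rfl fun k _ => ?_
  rw [Matrix.diag_apply, LinearMap.toMatrix_apply]
  conv_lhs => rw [G.eq_sum_of_orthogonal h h0 (L (e k))]
  rw [map_sum, Finsupp.finsetSum_apply, Finset.sum_eq_single k]
  · simp
  · intro j _ hj
    simp [hj]
  · simp

/-- The derivative of a trace, in terms of a frame that is parallel and orthogonal at a point. -/
theorem dirDeriv_trace_eq_sum (h : ∀ i j, i ≠ j → G.baseMetric x (e i) (e j) = 0)
    (h0 : ∀ i, G.baseMetric x (e i) (e i) ≠ 0) {Y : ι → 𝔛} (hY : ∀ i, Y i x = e i)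
    (hn : ∀ i Z, G.nabla Z (Y i) x = 0) (U : ι → 𝔛)
    (L : ∀ y, TangentSpace 𝓘(ℝ, V) y →ₗ[ℝ] TangentSpace 𝓘(ℝ, V) y)
    (hL : ∀ i y, L y (Y i y) = U i y) (v : TangentSpace 𝓘(ℝ, V) x) :
    dirDeriv (fun y => LinearMap.trace ℝ _ (L y)) x v
      = ∑ k, (G.baseMetric x (e k) (e k))⁻¹
          * dirDeriv (fun y => G.baseMetric y (U k y) (Y k y)) x v := by
  classical
  obtain ⟨hli, hc⟩ := exists_frame_coefficients e Y hY
  choose c hc using fun k => hc (U k)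
  have hcard : ∀ y : M, Fintype.card ι = finrank ℝ (TangentSpace 𝓘(ℝ, V) y) := fun y =>
    (finrank_eq_card_basis e).symm
  -- Away from x the frame need not be orthogonal, so the trace is first written with the diagonal
  -- frame coefficients of L Y_k = U_k.
  have htr : (fun y => LinearMap.trace ℝ _ (L y)) =ᶠ[𝓝 x] fun y => ∑ k, c k k y := by
    filter_upwards [hli, Filter.eventually_all.2 hc] with y hy hcy
    let b : Basis ι ℝ (TangentSpace 𝓘(ℝ, V) y) := basisOfLinearIndependentOfCardEqFinrank' _ hy
      (hcard y)
    have hb : ∀ i, b i = Y i y := fun i => by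
      simp only [b, coe_basisOfLinearIndependentOfCardEqFinrank']
    rw [LinearMap.trace_eq_matrix_trace ℝ b, Matrix.trace]
    refine Finset.sum_congr rfl fun k _ => ?_
    rw [Matrix.diag_apply, LinearMap.toMatrix_apply, hb, hL, hcy]
    simp only [← hb]
    rw [map_sum, Finsupp.finsetSum_apply, Finset.sum_eq_single k]
    · simp
    · intro j _ hj
      simp [hj]
    · simp
  rw [dirDeriv_congr htr, dirDeriv_sum _ fun k => mdiffAt_fun (c k k) x]
  refine Finset.sum_congr rfl fun k _ => ?_
  have hg : (fun y => G.baseMetric y (U k y) (Y k y))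
      =ᶠ[𝓝 x] fun y => ∑ j, c k j y * G.baseMetric y (Y j y) (Y k y) := by
    filter_upwards [hc k] with y hy
    rw [hy, ← metricMap_apply, map_sum, LinearMap.sum_apply]
    refine Finset.sum_congr rfl fun j _ => ?_
    rw [map_smul, LinearMap.smul_apply, metricMap_apply, smul_eq_mul]
  -- The Gram matrix of the frame is stationary at x, so only the coefficients `c` are
  -- differentiated there.
  have hz : ∀ j, dirDeriv (fun y => G.baseMetric y (Y j y) (Y k y)) x v = 0 := fun j => by
    have := G.nabla_metric (extendVector v) (Y j) (Y k) x
    rwa [hn, hn, baseMetric_zero_left, baseMetric_zero_right, add_zero, extendVector_apply] at this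
  rw [dirDeriv_congr hg, dirDeriv_sum _
    (f := fun j y => c k j y * G.baseMetric y (Y j y) (Y k y)) fun j =>
      (mdiffAt_fun (c k j) x).mul (G.mdiffAt_baseMetric (Y j) (Y k) x), Finset.sum_eq_single k]
  · rw [dirDeriv_mul (mdiffAt_fun (c k k) x) (G.mdiffAt_baseMetric (Y k) (Y k) x), hz, hY,
      mul_zero, zero_add, inv_mul_cancel_left₀ (h0 k)]
  · intro j _ hj
    rw [dirDeriv_mul (mdiffAt_fun (c k j) x) (G.mdiffAt_baseMetric (Y j) (Y k) x), hz, hY, hY,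
      h j k hj, mul_zero, zero_mul, add_zero]
  · simp

end OrthogonalBasis

theorem divergence_eq_trace (X : 𝔛) (x : M) :
    ExactCourant.divergence G.baseMetric X x = LinearMap.trace ℝ _ (G.nablaMap X x) := by
  classical
  obtain ⟨e, h, h0⟩ := exists_orthogonal_basis_of_nondegenerate (β := G.metricMap x)
    (G.metricMap_nondegenerate x)
    (fun u v => by rw [metricMap_apply, metricMap_apply, baseMetric_symm])
  rw [G.divergence_eq_sum e (fun i => extendVector (e i)) (fun i => extendVector_apply _),
    inv_gram_of_orthogonal h h0]
  simp only [metricMap_apply] at h h0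
  rw [G.trace_eq_sum_of_orthogonal h h0]
  refine Finset.sum_congr rfl fun k _ => ?_
  rw [Finset.sum_eq_single k, Matrix.diagonal_apply_eq, ← nablaMap_apply, extendVector_apply,
    metricMap_apply]
  · intro j _ hj
    rw [Matrix.diagonal_apply_ne' _ hj, zero_mul]
  · simp

theorem nablaMap_add (X Y : 𝔛) (x : M) :
    G.nablaMap (X + Y) x = G.nablaMap X x + G.nablaMap Y x := by
  ext v
  obtain ⟨Z, rfl⟩ := exists_section (V := V) (F := V)
    (E := (TangentSpace 𝓘(ℝ, V) : M → Type _)) x v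
  rw [LinearMap.add_apply, nablaMap_apply, nablaMap_apply, nablaMap_apply, nabla_add_right]
  rfl

theorem divergence_add (X Y : 𝔛) (x : M) :
    ExactCourant.divergence G.baseMetric (X + Y : 𝔛) x
      = ExactCourant.divergence G.baseMetric X x + ExactCourant.divergence G.baseMetric Y x := by
  rw [divergence_eq_trace, divergence_eq_trace, divergence_eq_trace, nablaMap_add, map_add]

theorem divergence_sub (X Y : 𝔛) (x : M) :
    ExactCourant.divergence G.baseMetric (X - Y : 𝔛) x
      = ExactCourant.divergence G.baseMetric X x - ExactCourant.divergence G.baseMetric Y x := by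
  rw [eq_sub_iff_add_eq, ← divergence_add, sub_add_cancel]

theorem baseMetric_neg_left (x : M) (X Z : TangentSpace 𝓘(ℝ, V) x) :
    G.baseMetric x (-X) Z = -G.baseMetric x X Z := by
  simp [← metricMap_apply]

theorem pairing_eq_zero_of_endo {s : ℝ} (hs : s * s = 1) {x : M} {u v : E x}
    (hu : G.endo x u = s • u) (hv : G.endo x v = (-s) • v) : A.pairing x u v = 0 := by
  have h1 := G.lift_anchor hs hu
  have h2 := G.lift_anchor (s := -s) (by linarith) hv
  rw [← h1, ← h2, pairing_lift_lift]
  ring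

theorem eq_lift_add_lift_of_sq {s : ℝ} (hs : s * s = 1) (x : M) (u : E x) :
    u = G.lift s x (G.part s x u) + G.lift (-s) x (G.part (-s) x u) := by
  rw [G.lift_part hs, G.lift_part (s := -s) (by linarith)]
  module

/-- Insert id = (lift ∘ part)₊ + (lift ∘ part)₋ and use cyclicity of the trace. -/
theorem trace_eq_trace_add_trace {s : ℝ} (hs : s * s = 1) (x : M) (T : E x →ₗ[ℝ] E x) :
    LinearMap.trace ℝ (E x) T = LinearMap.trace ℝ _ (G.part s x ∘ₗ T ∘ₗ G.lift s x)
      + LinearMap.trace ℝ _ (G.part (-s) x ∘ₗ T ∘ₗ G.lift (-s) x) := by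
  have : Module.Finite ℝ (E x) := VectorBundle.finiteDimensional ℝ F E x
  have hid : T = G.lift s x ∘ₗ G.part s x ∘ₗ T + G.lift (-s) x ∘ₗ G.part (-s) x ∘ₗ T := by
    ext u
    exact G.eq_lift_add_lift_of_sq hs x (T u)
  conv_lhs => rw [hid]
  rw [map_add, LinearMap.trace_comp_comm', LinearMap.trace_comp_comm' _ (G.lift (-s) x)]
  rfl

end GeneralizedMetric

/-! ### Structure of Levi-Civita generalised connections; the contorsion -/

namespace GeneralizedConnection

variable (D : GeneralizedConnection A) {G : GeneralizedMetric A}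

theorem D_const_smul (c : ℝ) (b : Γ) (x : M) (u : E x) : D.D (c • b) x u = c • D.D b x u := by
  have h := D.leibniz ⟨fun _ => c, contMDiff_const⟩ b x u
  have h2 : dirDeriv (fun _ : M => c) x (A.anchor x u) = 0 := dirDeriv_const c x _
  change D.D (c • b) x u = c • D.D b x u + dirDeriv (fun _ : M => c) x (A.anchor x u) • b x at h
  rwa [h2, zero_smul, add_zero] at h

variable {D}

/-- Compare D𝒢 = 0 for (b, c) with compatibility with the pairing for (𝒢^end b, c): both
differentiate the same function. Consequently D preserves E_±. -/
theorem IsLeviCivita.endo_D (hD : D.IsLeviCivita G) (b : Γ) (x : M) (u : E x) :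
    G.endo x (D.D b x u) = D.D (G.endoSection b) x u := by
  refine pairing_section_ext (A := A) fun c => ?_
  have h1 := hD.metric b c x u
  have h2 := D.metric (G.endoSection b) c x u
  have h3 := h1.symm.trans h2
  exact add_right_cancel h3

theorem IsLeviCivita.endo_D_liftSection (hD : D.IsLeviCivita G) {q : ℝ} (hq : q * q = 1) (Y : 𝔛)
    (x : M) (u : E x) :
    G.endo x (D.D (G.liftSection q Y) x u) = q • D.D (G.liftSection q Y) x u := by
  have h : G.endoSection (G.liftSection q Y) = q • G.liftSection q Y := by
    ext y; exact G.endo_lift hq y _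
  rw [hD.endo_D, h, D_const_smul]

variable (D G)

/-- The connection on `TM ≅ E_q` induced by `D` along `E_q`. -/
def covPart (q : ℝ) (X Y : 𝔛) : 𝔛 :=
  G.partSection q (D.cov (G.liftSection q X) (G.liftSection q Y))

/-- The difference of the connection induced by `D` on `TM ≅ E_q` and the Levi-Civita connection. -/
def contorsion (q : ℝ) (X Y : 𝔛) : 𝔛 := D.covPart G q X Y - G.nabla X Y

/-- The contorsion as an endomorphism in its first argument. -/
def contorsionMap (q : ℝ) (Y : 𝔛) (x : M) :
    TangentSpace 𝓘(ℝ, V) x →ₗ[ℝ] TangentSpace 𝓘(ℝ, V) x :=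
  G.part q x ∘ₗ D.D (G.liftSection q Y) x ∘ₗ G.lift q x - G.nablaMap Y x

theorem contorsionMap_apply (q : ℝ) (X Y : 𝔛) (x : M) :
    D.contorsionMap G q Y x (X x) = D.contorsion G q X Y x := by
  rw [contorsionMap, LinearMap.sub_apply, G.nablaMap_apply]; rfl

variable {D G}

namespace IsLeviCivita

open GeneralizedMetric (lieSection_swap liftSection_apply partSection_apply lift_apply anchor_lift
  pairing_lift_lift baseMetric_sub_left baseMetric_neg_left)

variable {q : ℝ}

theorem cov_liftSection_liftSection (hD : D.IsLeviCivita G) (hq : q * q = 1) (X Y : 𝔛) :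
    D.cov (G.liftSection q X) (G.liftSection q Y) = G.liftSection q (D.covPart G q X Y) := by
  ext x
  have h := hD.endo_D_liftSection hq Y x (G.lift q x (X x))
  rw [cov_apply, G.liftSection_apply, liftSection_apply, covPart, partSection_apply, G.lift_part hq,
    cov_apply, liftSection_apply, h, smul_smul, hq]
  module

/-- In the torsion of (X_{-q}, Y_q, Z_q) two terms pair a derivative of X_{-q}, which stays in
E_{-q}, with E_q and vanish. So the mixed derivatives are dictated by the bracket. -/
theorem cov_liftSection_neg (hD : D.IsLeviCivita G) (hq : q * q = 1) (X Y : 𝔛) :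
    D.cov (G.liftSection (-q) X) (G.liftSection q Y) = G.liftSection q (G.bismut q X Y) := by
  have hq' : -q * -q = 1 := by linarith
  ext x
  have h := hD.endo_D_liftSection hq Y x (G.lift (-q) x (X x))
  have hpart : D.cov (G.liftSection (-q) X) (G.liftSection q Y) x
      = G.lift q x (G.part q x (D.cov (G.liftSection (-q) X) (G.liftSection q Y) x)) := by
    rw [G.lift_part hq, cov_apply, liftSection_apply, h, smul_smul, hq]
    module
  rw [hpart, liftSection_apply]
  congr 1
  refine G.baseMetric_section_ext fun Z => ?_
  have ht := hD.torsion (G.liftSection (-q) X) (G.liftSection q Y) (G.liftSection q Z) x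
  have h1 : A.pairing x (D.cov (G.liftSection q Y) (G.liftSection (-q) X) x)
      (G.liftSection q Z x) = 0 := by
    rw [A.pairing_symm]
    exact G.pairing_eq_zero_of_endo hq (G.endo_lift hq x _) (hD.endo_D_liftSection hq' X x _)
  have h2 : A.pairing x (D.cov (G.liftSection q Z) (G.liftSection (-q) X) x)
      (G.liftSection q Y x) = 0 := by
    rw [A.pairing_symm]
    exact G.pairing_eq_zero_of_endo hq (G.endo_lift hq x _) (hD.endo_D_liftSection hq' X x _)
  simp only [sub_section_apply, map_sub, LinearMap.sub_apply] at ht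
  rw [h1, h2] at ht
  simp only [liftSection_apply, G.pairing_lift_right hq] at ht
  have h3 : q * (q * (G.baseMetric x
      (G.part q x (D.cov (G.liftSection (-q) X) (G.liftSection q Y) x)) (Z x)
      - G.baseMetric x (G.bismut q X Y x) (Z x))) = 0 := by
    rw [GeneralizedMetric.bismut, partSection_apply]
    linear_combination q * ht
  rw [← mul_assoc, hq, one_mul] at h3
  exact sub_eq_zero.1 h3

theorem covPart_metric (hD : D.IsLeviCivita G) (hq : q * q = 1) (X Y Z : 𝔛) (x : M) :
    dirDeriv (fun y => G.baseMetric y (Y y) (Z y)) x (X x)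
      = G.baseMetric x (D.covPart G q X Y x) (Z x)
        + G.baseMetric x (Y x) (D.covPart G q X Z x) := by
  have h := D.dirDeriv_pairing (G.liftSection q X) (G.liftSection q Y) (G.liftSection q Z) x
  rw [G.dirDeriv_pairing_liftSection, hD.cov_liftSection_liftSection hq,
    hD.cov_liftSection_liftSection hq] at h
  simp only [liftSection_apply, anchor_lift, pairing_lift_lift] at h
  linear_combination q * h + (G.baseMetric x (D.covPart G q X Y x) (Z x)
    + G.baseMetric x (Y x) (D.covPart G q X Z x)
    - dirDeriv (fun y => G.baseMetric y (Y y) (Z y)) x (X x)) * hq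

theorem contorsion_skew (hD : D.IsLeviCivita G) (hq : q * q = 1) (X Y Z : 𝔛) (x : M) :
    G.baseMetric x (D.contorsion G q X Z x) (Y x)
      = -G.baseMetric x (D.contorsion G q X Y x) (Z x) := by
  have h1 := hD.covPart_metric hq X Y Z x
  have h2 := G.nabla_metric X Y Z x
  simp only [contorsion, sub_section_apply, baseMetric_sub_left]
  rw [G.baseMetric_symm x (Y x)] at h1 h2
  linarith

/-- This is the torsion condition within E_q. After subtracting ∇, which accounts for the derivative
and Lie bracket terms, only H/2 from the bracket is left; the factor q comes from the pairing q·g on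
E_q. -/
theorem contorsion_cyclic (hD : D.IsLeviCivita G) (hq : q * q = 1) (X Y Z : 𝔛) (x : M) :
    G.baseMetric x (D.contorsion G q X Y x) (Z x) + G.baseMetric x (D.contorsion G q Y Z x) (X x)
      + G.baseMetric x (D.contorsion G q Z X x) (Y x) = q / 2 * G.flux X Y Z x := by
  have ht := hD.torsion (G.liftSection q X) (G.liftSection q Y) (G.liftSection q Z) x
  simp only [sub_section_apply, map_sub, LinearMap.sub_apply,
    hD.cov_liftSection_liftSection hq] at ht
  have hb := G.pairing_bracket_lift_lift q q q X Y Z x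
  have h1 := G.baseMetric_nabla X Y Z x
  have h2 := G.baseMetric_nabla Y X Z x
  have h3 := G.baseMetric_nabla Z X Y x
  have hs := hD.contorsion_skew hq Y X Z x
  simp only [koszul, ← coe_lieSection, G.baseMetric_fun_symm Y X, G.baseMetric_fun_symm Z X,
    G.baseMetric_fun_symm Z Y, lieSection_swap Y X, lieSection_swap Z X, lieSection_swap Z Y,
    G.baseMetric_neg_left] at h1 h2 h3
  rw [hs]
  simp only [liftSection_apply, pairing_lift_lift, hb] at ht
  simp only [contorsion, sub_section_apply, baseMetric_sub_left]
  -- Multiplication by q turns the pairing on E_q into g; the last summand collects the resulting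
  -- multiples of q² - 1.
  linear_combination q * ht - 1 / 2 * h1 + 1 / 2 * h2 - 1 / 2 * h3
    - (G.baseMetric x (D.covPart G q X Y x) (Z x) - G.baseMetric x (D.covPart G q Y X x) (Z x)
      + G.baseMetric x (D.covPart G q Z X x) (Y x) - 1 / 2 *
      (G.baseMetric x (lieSection X Y x) (Z x)
        + (dirDeriv (fun y => G.baseMetric y (Y y) (Z y)) x (X x)
          - G.baseMetric x (lieSection X Z x) (Y x))
        + (dirDeriv (fun y => G.baseMetric y (X y) (Y y)) x (Z x)
          - dirDeriv (fun y => G.baseMetric y (X y) (Z y)) x (Y x)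
          + G.baseMetric x (lieSection Y Z x) (X x)))) * hq

/-- The derivative of Y_q takes values in E_q, so its trace over E is the trace of the E_q-block,
that is, of ∇Y + κ(·,Y). The ∇-part is div_g Y, and κ must supply -⟨e, Y_q⟩. -/
theorem trace_contorsionMap (hD : D.IsLeviCivita G) (hq : q * q = 1) {e : Γ}
    (hdiv : D.divergence = G.divergenceOperator e) (Y : 𝔛) (x : M) :
    LinearMap.trace ℝ _ (D.contorsionMap G q Y x)
      = -(q * G.baseMetric x (G.partSection q e x) (Y x)) := by
  have : Module.Finite ℝ (E x) := VectorBundle.finiteDimensional ℝ F E x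
  have h := congrFun (congrFun hdiv (G.liftSection q Y)) x
  have hz : G.part (-q) x ∘ₗ D.D (G.liftSection q Y) x = 0 := by
    ext u
    have h1 := hD.endo_D_liftSection hq Y x u
    rw [LinearMap.comp_apply, ← G.lift_anchor hq h1]
    have := G.part_lift_neg (s := -q) (by linarith) x (A.anchor x (D.D (G.liftSection q Y) x u))
    rwa [neg_neg] at this
  have htr : LinearMap.trace ℝ (E x) (D.D (G.liftSection q Y) x)
      = LinearMap.trace ℝ _ (G.part q x ∘ₗ D.D (G.liftSection q Y) x ∘ₗ G.lift q x) := by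
    rw [G.trace_eq_trace_add_trace hq, ← LinearMap.comp_assoc (G.lift (-q) x), hz,
      LinearMap.zero_comp, map_zero, add_zero]
  have hn : G.metricDivergence (G.liftSection q Y) x = LinearMap.trace ℝ _ (G.nablaMap Y x) := by
    rw [← G.divergence_eq_trace, GeneralizedMetric.metricDivergence]
    simp only [liftSection_apply, anchor_lift]
  rw [GeneralizedConnection.divergence, GeneralizedMetric.divergenceOperator, htr, hn,
    liftSection_apply, G.pairing_lift_right hq] at h
  rw [contorsionMap, map_sub, h, partSection_apply]
  ring

end IsLeviCivita

end GeneralizedConnection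

/-! ### Index identities behind the contraction of the curvature -/

section TripleSum

variable {ι : Type*} [Fintype ι]

/-- The sum `∑ ε_i ε_j ε_k f(i,j,k)`. -/
def tripleSum (ε : ι → ℝ) : (ι → ι → ι → ℝ) →ₗ[ℝ] ℝ where
  toFun f := ∑ i, ∑ j, ∑ k, ε i * ε j * ε k * f i j k
  map_add' f g := by simp only [Pi.add_apply, mul_add, Finset.sum_add_distrib]
  map_smul' c f := by
    simp only [Pi.smul_apply, smul_eq_mul, RingHom.id_apply, Finset.mul_sum, mul_left_comm]

variable (ε : ι → ℝ)

theorem tripleSum_apply (f : ι → ι → ι → ℝ) :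
    tripleSum ε f = ∑ i, ∑ j, ∑ k, ε i * ε j * ε k * f i j k := rfl

theorem tripleSum_rotate (f : ι → ι → ι → ℝ) :
    tripleSum ε (fun i j k => f j k i) = tripleSum ε f := by
  rw [tripleSum_apply, tripleSum_apply, Finset.sum_comm]
  refine Finset.sum_congr rfl fun j _ => ?_
  rw [Finset.sum_comm]
  refine Finset.sum_congr rfl fun k _ => Finset.sum_congr rfl fun i _ => ?_
  ring

/-- The algebraic identity relating a metric connection with torsion to its torsion. -/
theorem tripleSum_contorsion {q : ℝ} (hq : q * q = 1) {h κ : ι → ι → ι → ℝ}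
    (h1 : ∀ i j k, h j i k = -h i j k) (h2 : ∀ i j k, h i k j = -h i j k)
    (hκ : ∀ i j k, κ i k j = -κ i j k)
    (hc : ∀ i j k, κ i j k + κ j k i + κ k i j = q / 2 * h i j k) :
    tripleSum ε (fun i j k => κ i j k * κ j i k - q / 2 * (h i j k * κ k j i)
      + 1 / 4 * (h i j k * h k j i) + 1 / 2 * (κ k i j * κ k j i - 1 / 4 * (h k i j * h k j i)))
      = -(1 / 12 * tripleSum ε fun i j k => h i j k ^ 2) := by
  have e1 := tripleSum_rotate ε fun i j k => κ i j k ^ 2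
  have e2 := tripleSum_rotate ε fun i j k => κ k i j ^ 2
  have e3 := tripleSum_rotate ε fun i j k => κ i j k * κ j k i
  have e4 := tripleSum_rotate ε fun i j k => κ k i j * κ i j k
  -- The summand differs from -h²/12 only by differences of a function of (i, j, k) and a cyclic
  -- rotation of it; these have zero weighted sum.
  have hF : (fun i j k => κ i j k * κ j i k - q / 2 * (h i j k * κ k j i)
      + 1 / 4 * (h i j k * h k j i) + 1 / 2 * (κ k i j * κ k j i - 1 / 4 * (h k i j * h k j i)))
      = -((1 / 12 : ℝ) • fun i j k => h i j k ^ 2)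
        + (1 / 6 : ℝ) • ((fun i j k => κ k i j ^ 2) - fun i j k => κ i j k ^ 2)
        + (1 / 6 : ℝ) • ((fun i j k => κ k i j ^ 2) - fun i j k => κ j k i ^ 2)
        + (2 / 3 : ℝ) • ((fun i j k => κ j k i * κ k i j) - fun i j k => κ i j k * κ j k i)
        + (2 / 3 : ℝ) • ((fun i j k => κ k i j * κ i j k) - fun i j k => κ i j k * κ j k i) := by
    funext i j k
    have hh : h i j k = 2 * q * (κ i j k + κ j k i + κ k i j) := by
      rw [hc]; linear_combination -(h i j k) * hq
    simp only [Pi.add_apply, Pi.neg_apply, Pi.sub_apply, Pi.smul_apply, smul_eq_mul]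
    rw [hκ j k i, hκ k i j, h2 k i j, ← neg_neg (h k i j), ← h1 k i j, ← h2 i k j, hh]
    linear_combination (κ k i j * (κ i j k + κ j k i + κ k i j) - 1 / 6 *
      (κ i j k + κ j k i + κ k i j) ^ 2) * hq
  rw [hF]
  simp only [map_add, map_sub, map_smul, map_neg, e1, e2, e3, e4, smul_eq_mul]
  linarith

theorem tripleSum_eq_sum_sum (f : ι → ι → ι → ℝ) :
    tripleSum ε f = ∑ j, ∑ i, ε j * (ε i * ∑ k, ε k * f i j k) := by
  rw [tripleSum_apply, Finset.sum_comm]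
  refine Finset.sum_congr rfl fun j _ => Finset.sum_congr rfl fun i _ => ?_
  rw [Finset.mul_sum, Finset.mul_sum]
  exact Finset.sum_congr rfl fun k _ => by ring

theorem tripleSum_mul_contracted (u : ι → ι → ℝ) :
    tripleSum ε (fun i j k => u j k * u i k) = ∑ k, ε k * (∑ i, ε i * u i k) ^ 2 := by
  rw [← tripleSum_rotate, tripleSum_apply]
  refine Finset.sum_congr rfl fun k _ => ?_
  rw [sq, Finset.sum_mul_sum, Finset.mul_sum]
  refine Finset.sum_congr rfl fun i _ => ?_
  rw [Finset.mul_sum]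
  exact Finset.sum_congr rfl fun j _ => by ring

/-- Bookkeeping for the contraction over E_q: N and T are q times the curvature and trace terms of
ℛm, R is the Riemann tensor of g, d a derivative of κ, while δ and w stand for ∇e_q and e_q. Only
`hd` and `hw`, the traces of d and κ, bring in the divergence. -/
theorem sum_sum_curvature {q : ℝ} (hq : q * q = 1) {N T R d : ι → ι → ℝ} {h κ : ι → ι → ι → ℝ}
    {δ w : ι → ℝ}
    (hN : ∀ i j, N i j = R i j - d j i - d i j - ∑ k, ε k * (κ j j k * κ i i k - κ i j k * κ j i k
      + q / 2 * (h i j k * κ k j i) - 1 / 4 * (h i j k * h k j i)))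
    (hT : ∀ i j, T i j = ∑ k, ε k * (κ k i j * κ k j i - 1 / 4 * (h k i j * h k j i)))
    (hd : ∀ j, ∑ i, ε i * d i j = -(q * δ j)) (hw : ∀ k, ∑ i, ε i * κ i i k = q * w k) :
    ∑ j, ∑ i, ε j * (ε i * (1 / 2 * (N i j + N j i + T i j)))
      = (∑ j, ∑ i, ε j * (ε i * R i j)) + 2 * q * ∑ k, ε k * δ k - ∑ k, ε k * (w k * w k)
        + tripleSum ε (fun i j k => κ i j k * κ j i k - q / 2 * (h i j k * κ k j i)
          + 1 / 4 * (h i j k * h k j i)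
          + 1 / 2 * (κ k i j * κ k j i - 1 / 4 * (h k i j * h k j i))) := by
  have hcomm : ∀ f : ι → ι → ℝ, ∑ j, ∑ i, ε j * (ε i * f j i) = ∑ j, ∑ i, ε j * (ε i * f i j) :=
    fun f => by
      rw [Finset.sum_comm]
      exact Finset.sum_congr rfl fun j _ => Finset.sum_congr rfl fun i _ => by ring
  have hsd : ∑ j, ∑ i, ε j * (ε i * d i j) = -(q * ∑ k, ε k * δ k) := by
    rw [Finset.mul_sum, ← Finset.sum_neg_distrib]
    refine Finset.sum_congr rfl fun j _ => ?_
    rw [← Finset.mul_sum, hd]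
    ring
  -- Among the quadratic terms only this one factors through the trace of κ; it yields |e_q|².
  have hsw : tripleSum ε (fun i j k => κ j j k * κ i i k) = ∑ k, ε k * (w k * w k) := by
    rw [tripleSum_mul_contracted ε fun i k => κ i i k]
    refine Finset.sum_congr rfl fun k _ => ?_
    rw [hw]
    linear_combination (ε k * w k ^ 2) * hq
  have hp : ∀ i j, N i j + 1 / 2 * T i j = R i j - d j i - d i j
      - ∑ k, ε k * (κ j j k * κ i i k) + ∑ k, ε k * (κ i j k * κ j i k
        - q / 2 * (h i j k * κ k j i) + 1 / 4 * (h i j k * h k j i)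
        + 1 / 2 * (κ k i j * κ k j i - 1 / 4 * (h k i j * h k j i))) := fun i j => by
    rw [hN, hT, Finset.mul_sum, sub_add, sub_add, ← Finset.sum_sub_distrib,
      ← Finset.sum_sub_distrib]
    congr 1
    exact Finset.sum_congr rfl fun k _ => by ring
  -- N_ij and N_ji have the same weighted sum, so the two curvature terms of ℛm may be merged into
  -- one.
  have hsplit : ∑ j, ∑ i, ε j * (ε i * (1 / 2 * (N i j + N j i + T i j)))
      = ∑ j, ∑ i, ε j * (ε i * (N i j + 1 / 2 * T i j)) := by
    have h1 := hcomm N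
    have h2 : ∀ i j, ε j * (ε i * (1 / 2 * (N i j + N j i + T i j)))
        = ε j * (ε i * (N i j + 1 / 2 * T i j))
          + 1 / 2 * (ε j * (ε i * N j i) - ε j * (ε i * N i j)) := fun i j => by ring
    simp only [h2, Finset.sum_add_distrib, ← Finset.mul_sum, Finset.sum_sub_distrib]
    simp only [← Finset.mul_sum] at h1
    rw [h1]
    ring
  rw [hsplit, tripleSum_eq_sum_sum, ← hsw, tripleSum_eq_sum_sum]
  simp only [hp, mul_add, mul_sub, Finset.sum_add_distrib, Finset.sum_sub_distrib]
  rw [hcomm d, hsd]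
  ring

end TripleSum

/-! ### The curvature of D in a normal frame -/

namespace GeneralizedConnection

namespace IsLeviCivita

open GeneralizedMetric (lieSection_swap liftSection_apply partSection_apply lift_apply anchor_lift
  pairing_lift_lift baseMetric_sub_left baseMetric_neg_left baseMetric_zero_left
  baseMetric_zero_right baseMetric_add_left)

variable {D : GeneralizedConnection A} {G : GeneralizedMetric A} {q : ℝ}

theorem covPart_eq (X Y : 𝔛) : D.covPart G q X Y = G.nabla X Y + D.contorsion G q X Y := by
  rw [contorsion]; abel

/-- Move the outer derivative onto g(D_Y Z, W) by metricity. As W is parallel at x, its derivative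
there is κ(X, W) alone, and the ∇-part of D_Y Z gives the second covariant derivative for the
Riemann tensor. -/
theorem pairing_cov_cov (hD : D.IsLeviCivita G) (hq : q * q = 1) (X Y Z : 𝔛) {W : 𝔛} {x : M}
    (hW : ∀ U, G.nabla U W x = 0) :
    q * A.pairing x (D.cov (G.liftSection q X) (D.cov (G.liftSection q Y) (G.liftSection q Z)) x)
        (G.lift q x (W x))
      = G.baseMetric x (G.nabla X (G.nabla Y Z) x) (W x)
        + dirDeriv (fun y => G.baseMetric y (D.contorsion G q Y Z y) (W y)) x (X x)
        - G.baseMetric x (D.covPart G q Y Z x) (D.contorsion G q X W x) := by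
  rw [hD.cov_liftSection_liftSection hq, hD.cov_liftSection_liftSection hq, liftSection_apply,
    pairing_lift_lift]
  have h1 := hD.covPart_metric hq X (D.covPart G q Y Z) W x
  have h2 := G.nabla_metric X (G.nabla Y Z) W x
  have h3 : (fun y => G.baseMetric y (D.covPart G q Y Z y) (W y)) = fun y =>
      G.baseMetric y (G.nabla Y Z y) (W y) + G.baseMetric y (D.contorsion G q Y Z y) (W y) := by
    funext y
    rw [← baseMetric_add_left, covPart_eq]; rfl
  rw [h3, dirDeriv_add (G.mdiffAt_baseMetric _ _ x) (G.mdiffAt_baseMetric _ _ x), h2, hW,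
    baseMetric_zero_right, covPart_eq X W, add_section_apply, hW, zero_add] at h1
  linear_combination (G.baseMetric x (D.covPart G q X (D.covPart G q Y Z) x) (W x)) * hq - h1

section NormalFrame

variable {ι : Type*} [Fintype ι] {x : M} {e : Basis ι ℝ (TangentSpace 𝓘(ℝ, V) x)}

/-- Parallel at x means that Lie brackets and derivatives of metric coefficients vanish there. Only
H survives, whatever the signs p, q, r. -/
theorem pairing_bracket_of_nabla_eq_zero (G : GeneralizedMetric A) (p q r : ℝ) {X Y Z : 𝔛} {x : M}
    (hX : ∀ U, G.nabla U X x = 0) (hY : ∀ U, G.nabla U Y x = 0) (hZ : ∀ U, G.nabla U Z x = 0) :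
    A.pairing x (A.bracket (G.liftSection p X) (G.liftSection q Y) x) (G.lift r x (Z x))
      = 1 / 2 * G.flux X Y Z x := by
  rw [G.pairing_bracket_lift_lift, ← G.nabla_torsion, ← G.nabla_torsion, ← G.nabla_torsion,
    G.nabla_metric, G.nabla_metric, G.nabla_metric]
  simp only [hX, hY, hZ, sub_self, baseMetric_zero_left, baseMetric_zero_right]
  ring

theorem baseMetric_part_bracket (G : GeneralizedMetric A) (q : ℝ) {r : ℝ} (hr : r * r = 1)
    {X Y Z : 𝔛} {x : M} (hX : ∀ U, G.nabla U X x = 0) (hY : ∀ U, G.nabla U Y x = 0)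
    (hZ : ∀ U, G.nabla U Z x = 0) :
    G.baseMetric x (G.part r x (A.bracket (G.liftSection q X) (G.liftSection q Y) x)) (Z x)
      = r / 2 * G.flux X Y Z x := by
  have h := pairing_bracket_of_nabla_eq_zero G q q r hX hY hZ
  rw [G.pairing_lift_right hr] at h
  linear_combination r * h - (G.baseMetric x (G.part r x
    (A.bracket (G.liftSection q X) (G.liftSection q Y) x)) (Z x)) * hr

theorem pairing_cov_same (hD : D.IsLeviCivita G) (hq : q * q = 1) (X : 𝔛) {Y : 𝔛} (Z : 𝔛) {x : M}
    (hY : ∀ U, G.nabla U Y x = 0) :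
    A.pairing x (D.D (G.liftSection q Y) x (G.lift q x (X x))) (G.lift q x (Z x))
      = q * G.baseMetric x (D.contorsion G q X Y x) (Z x) := by
  have h : D.D (G.liftSection q Y) x (G.lift q x (X x))
      = G.lift q x (D.covPart G q X Y x) :=
    DFunLike.congr_fun (hD.cov_liftSection_liftSection hq X Y) x
  rw [h, pairing_lift_lift, covPart_eq, add_section_apply, hY, zero_add]
  ring

theorem pairing_cov_neg (hD : D.IsLeviCivita G) (hq : q * q = 1) (X : 𝔛) {Y : 𝔛} (Z : 𝔛) {x : M}
    (hY : ∀ U, G.nabla U Y x = 0) :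
    A.pairing x (D.D (G.liftSection q Y) x (G.lift (-q) x (X x))) (G.lift q x (Z x))
      = 1 / 2 * G.flux X Y Z x := by
  have h : D.D (G.liftSection q Y) x (G.lift (-q) x (X x))
      = G.lift q x (G.bismut q X Y x) :=
    DFunLike.congr_fun (hD.cov_liftSection_neg hq X Y) x
  rw [h, pairing_lift_lift, G.baseMetric_bismut hq, ← G.baseMetric_nabla, hY,
    baseMetric_zero_left]
  linear_combination (1 / 2 * G.flux X Y Z x) * hq

/-- At x the E_q- and E_{-q}-parts of [Y_v, Y_w] are q/2 and -q/2 times H(Y_v, Y_w, ·). Along the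
first D acts by κ, giving H·κ; along the second it acts by the Bismut connection, giving H·H. -/
theorem pairing_cov_bracket (hD : D.IsLeviCivita G) (hq : q * q = 1) {Y : ι → 𝔛}
    (h : ∀ i j, i ≠ j → G.baseMetric x (e i) (e j) = 0)
    (h0 : ∀ i, G.baseMetric x (e i) (e i) ≠ 0) (hY : ∀ i, Y i x = e i)
    (hn : ∀ i Z, G.nabla Z (Y i) x = 0) (a b v w : ι) :
    q * A.pairing x (D.cov (A.bracket (G.liftSection q (Y v)) (G.liftSection q (Y w)))
        (G.liftSection q (Y b)) x) (G.lift q x (Y a x))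
      = ∑ k, (G.baseMetric x (e k) (e k))⁻¹ *
        (q / 2 * (G.flux (Y v) (Y w) (Y k) x
            * G.baseMetric x (D.contorsion G q (Y k) (Y b) x) (Y a x))
          - 1 / 4 * (G.flux (Y v) (Y w) (Y k) x * G.flux (Y k) (Y b) (Y a) x)) := by
  have hq' : -q * -q = 1 := by linarith
  set u := A.bracket (G.liftSection q (Y v)) (G.liftSection q (Y w)) x with hu
  have h1 := G.eq_lift_add_lift_of_sq hq x u
  rw [G.eq_sum_of_orthogonal h h0 (G.part q x u), G.eq_sum_of_orthogonal h h0 (G.part (-q) x u)] at h1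
  simp only [← hY, hu] at h1
  simp only [baseMetric_part_bracket G q hq (hn v) (hn w) (hn _),
    baseMetric_part_bracket G q hq' (hn v) (hn w) (hn _), map_sum, map_smul] at h1
  rw [cov_apply, h1]
  simp only [map_add, map_sum, map_smul, LinearMap.add_apply, LinearMap.sum_apply,
    LinearMap.smul_apply, hD.pairing_cov_same hq _ _ (hn b), hD.pairing_cov_neg hq _ _ (hn b),
    smul_eq_mul, ← hY, mul_add, Finset.mul_sum]
  rw [← Finset.sum_add_distrib]
  refine Finset.sum_congr rfl fun k _ => ?_
  linear_combination ((G.baseMetric x (Y k x) (Y k x))⁻¹ * (q / 2 * (G.flux (Y v) (Y w) (Y k) x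
            * G.baseMetric x (D.contorsion G q (Y k) (Y b) x) (Y a x))
          - 1 / 4 * (G.flux (Y v) (Y w) (Y k) x * G.flux (Y k) (Y b) (Y a) x))) * hq

theorem naiveCurvature_eq_sum (hD : D.IsLeviCivita G) (hq : q * q = 1) {Y : ι → 𝔛}
    (h : ∀ i j, i ≠ j → G.baseMetric x (e i) (e j) = 0)
    (h0 : ∀ i, G.baseMetric x (e i) (e i) ≠ 0) (hY : ∀ i, Y i x = e i)
    (hn : ∀ i Z, G.nabla Z (Y i) x = 0) (a b v w : ι) :
    q * D.naiveCurvature (G.liftSection q (Y a)) (G.liftSection q (Y b)) (G.liftSection q (Y v))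
        (G.liftSection q (Y w)) x
      = G.baseMetric x (G.curv (Y v) (Y w) (Y b) x) (Y a x)
        + dirDeriv (fun y => G.baseMetric y (D.contorsion G q (Y w) (Y b) y) (Y a y)) x (Y v x)
        - dirDeriv (fun y => G.baseMetric y (D.contorsion G q (Y v) (Y b) y) (Y a y)) x (Y w x)
        - ∑ k, (G.baseMetric x (e k) (e k))⁻¹ *
          (G.baseMetric x (D.contorsion G q (Y w) (Y b) x) (Y k x)
              * G.baseMetric x (D.contorsion G q (Y v) (Y a) x) (Y k x)
            - G.baseMetric x (D.contorsion G q (Y v) (Y b) x) (Y k x)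
              * G.baseMetric x (D.contorsion G q (Y w) (Y a) x) (Y k x)
            + q / 2 * (G.flux (Y v) (Y w) (Y k) x
              * G.baseMetric x (D.contorsion G q (Y k) (Y b) x) (Y a x))
            - 1 / 4 * (G.flux (Y v) (Y w) (Y k) x * G.flux (Y k) (Y b) (Y a) x)) := by
  rw [naiveCurvature_eq]
  simp only [curvOp, sub_section_apply, map_sub, LinearMap.sub_apply, mul_sub, liftSection_apply]
  rw [hD.pairing_cov_bracket hq h h0 hY hn, hD.pairing_cov_cov hq _ _ _ (hn a),
    hD.pairing_cov_cov hq _ _ _ (hn a)]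
  simp only [covPart_eq, add_section_apply, hn, zero_add, GeneralizedMetric.curv,
    sub_section_apply, baseMetric_sub_left, sub_zero]
  rw [G.baseMetric_eq_sum h h0 (D.contorsion G q (Y w) (Y b) x),
    G.baseMetric_eq_sum h h0 (D.contorsion G q (Y v) (Y b) x)]
  simp only [hY, mul_sub, mul_add, Finset.sum_add_distrib, Finset.sum_sub_distrib]
  ring

/-- The directions in E_q contribute κ·κ. Those in E_{-q}, where the pairing has the opposite sign,
contribute H·H through the Bismut connection. -/
theorem derivTrace_eq_sum (hD : D.IsLeviCivita G) (hq : q * q = 1) {Y : ι → 𝔛}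
    (h : ∀ i j, i ≠ j → G.baseMetric x (e i) (e j) = 0)
    (h0 : ∀ i, G.baseMetric x (e i) (e i) ≠ 0) (hY : ∀ i, Y i x = e i)
    (hn : ∀ i Z, G.nabla Z (Y i) x = 0) (a b v w : ι) :
    q * D.derivTrace (G.liftSection q (Y a)) (G.liftSection q (Y b)) (G.liftSection q (Y v))
        (G.liftSection q (Y w)) x
      = ∑ k, (G.baseMetric x (e k) (e k))⁻¹ *
          (G.baseMetric x (D.contorsion G q (Y k) (Y v) x) (Y w x)
              * G.baseMetric x (D.contorsion G q (Y k) (Y b) x) (Y a x)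
            - 1 / 4 * (G.flux (Y k) (Y v) (Y w) x * G.flux (Y k) (Y b) (Y a) x)) := by
  have : Module.Finite ℝ (E x) := VectorBundle.finiteDimensional ℝ F E x
  have ht := metricTrace_eq_sum (G.liftBasis e) (β := A.pairing x)
    (A.pairing_nondegenerate x) (A.pairing_symm x) (G.pairing_liftBasis_orthogonal h)
    (by
      rintro (i | i)
      · rw [G.pairing_liftBasis_inl]; exact h0 i
      · rw [G.pairing_liftBasis_inr]; exact neg_ne_zero.2 (h0 i))
    (LinearMap.mk₂ ℝ (fun u u' => A.pairing x (D.D (G.liftSection q (Y v)) x u) (G.lift q x (Y w x))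
      * A.pairing x (D.D (G.liftSection q (Y b)) x u') (G.lift q x (Y a x)))
      (fun _ _ _ => by simp only [map_add, LinearMap.add_apply, add_mul])
      (fun _ _ _ => by simp only [map_smul, LinearMap.smul_apply, smul_eq_mul, mul_assoc])
      (fun _ _ _ => by simp only [map_add, LinearMap.add_apply, mul_add])
      (fun _ _ _ => by simp only [map_smul, LinearMap.smul_apply, smul_eq_mul]; ring))
  simp only [LinearMap.mk₂_apply] at ht
  rw [derivTrace]
  refine (congrArg (q * ·) ht).trans ?_
  simp only [Fintype.sum_sum_type, G.pairing_liftBasis_inl, G.pairing_liftBasis_inr]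
  simp only [G.liftBasis_inl, G.liftBasis_inr, ← hY]
  have hcases : q = 1 ∨ q = -1 := mul_self_eq_one_iff.1 hq
  rw [← Finset.sum_add_distrib, Finset.mul_sum]
  refine Finset.sum_congr rfl fun k _ => ?_
  have hs := fun b a => hD.pairing_cov_same hq (Y k) (Y a) (hn b)
  have hm := fun b a => hD.pairing_cov_neg hq (Y k) (Y a) (hn b)
  rcases hcases with rfl | rfl
  · rw [hs, hs, hm, hm, inv_neg]; ring
  · rw [neg_neg] at hm
    rw [hs, hs, hm, hm, inv_neg]; ring

end NormalFrame

end IsLeviCivita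

end GeneralizedConnection

/-! ### Contraction of the curvature to the scalar curvature -/

namespace GeneralizedConnection

namespace IsLeviCivita

variable {D : GeneralizedConnection A} {G : GeneralizedMetric A} {q : ℝ}
  {ι : Type*} [Fintype ι] {x : M} {b : Basis ι ℝ (TangentSpace 𝓘(ℝ, V) x)}

/-- The trace of κ(·, Y_j) is known at every point, not only at x, so it may be differentiated.
Since Y_j is parallel at x, the derivative falls on e_q. -/
theorem sum_dirDeriv_contorsion (hD : D.IsLeviCivita G) (hq : q * q = 1) {e : Γ}
    (hdiv : D.divergence = G.divergenceOperator e) {Y : ι → 𝔛}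
    (h : ∀ i j, i ≠ j → G.baseMetric x (b i) (b j) = 0)
    (h0 : ∀ i, G.baseMetric x (b i) (b i) ≠ 0) (hY : ∀ i, Y i x = b i)
    (hn : ∀ i Z, G.nabla Z (Y i) x = 0) (j : ι) (v : TangentSpace 𝓘(ℝ, V) x) :
    ∑ i, (G.baseMetric x (b i) (b i))⁻¹ *
        dirDeriv (fun y => G.baseMetric y (D.contorsion G q (Y i) (Y j) y) (Y i y)) x v
      = -(q * G.baseMetric x (G.nablaMap (G.partSection q e) x v) (b j)) := by
  rw [← G.dirDeriv_trace_eq_sum h h0 hY hn (fun i => D.contorsion G q (Y i) (Y j))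
    (fun y => D.contorsionMap G q (Y j) y) (fun i y => D.contorsionMap_apply G q (Y i) (Y j) y),
    funext fun y => hD.trace_contorsionMap hq hdiv (Y j) y, dirDeriv_neg,
    dirDeriv_const_mul q (G.mdiffAt_baseMetric _ _ x)]
  have hm := G.nabla_metric (extendVector v) (G.partSection q e) (Y j) x
  rw [hn, G.baseMetric_zero_right, add_zero, ← G.nablaMap_apply, extendVector_apply, hY] at hm
  rw [hm]

theorem sum_contorsion (hD : D.IsLeviCivita G) (hq : q * q = 1) {e : Γ}
    (hdiv : D.divergence = G.divergenceOperator e) {Y : ι → 𝔛}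
    (h : ∀ i j, i ≠ j → G.baseMetric x (b i) (b j) = 0)
    (h0 : ∀ i, G.baseMetric x (b i) (b i) ≠ 0) (hY : ∀ i, Y i x = b i) (k : ι) :
    ∑ i, (G.baseMetric x (b i) (b i))⁻¹ *
        G.baseMetric x (D.contorsion G q (Y i) (Y i) x) (Y k x)
      = q * G.baseMetric x (G.partSection q e x) (b k) := by
  have ht := hD.trace_contorsionMap hq hdiv (Y k) x
  rw [G.trace_eq_sum_of_orthogonal h h0] at ht
  simp only [← hY, contorsionMap_apply] at ht ⊢
  rw [← neg_eq_iff_eq_neg.2 ht, ← Finset.sum_neg_distrib]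
  refine Finset.sum_congr rfl fun i _ => ?_
  rw [hD.contorsion_skew hq (Y i) (Y i) (Y k) x, mul_neg, neg_neg]

/-- The right-hand side involves D only through e: the undetermined part of κ has dropped out of the
contraction. This is why the scalar curvature does not depend on D. -/
theorem sum_riemann (hD : D.IsLeviCivita G) (hq : q * q = 1) {e : Γ}
    (hdiv : D.divergence = G.divergenceOperator e) {Y : ι → 𝔛}
    (h : ∀ i j, i ≠ j → G.baseMetric x (b i) (b j) = 0)
    (h0 : ∀ i, G.baseMetric x (b i) (b i) ≠ 0) (hY : ∀ i, Y i x = b i)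
    (hn : ∀ i Z, G.nabla Z (Y i) x = 0) :
    q * (∑ j, ∑ i, (G.baseMetric x (b j) (b j))⁻¹ * ((G.baseMetric x (b i) (b i))⁻¹ *
        D.riemann (G.liftSection q (Y i)) (G.liftSection q (Y j)) (G.liftSection q (Y i))
          (G.liftSection q (Y j)) x))
      = ExactCourant.scalarCurvature G.baseMetric x
        - normSq₃ (G.baseMetric x) (G.threeForm x) / 12
        + 2 * q * ExactCourant.divergence G.baseMetric (G.partSection q e) x
        - G.baseMetric x (G.partSection q e x) (G.partSection q e x) := by
  have hN := fun i j => hD.naiveCurvature_eq_sum hq h h0 hY hn i j i j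
  have hT := fun i j => hD.derivTrace_eq_sum hq h h0 hY hn i j i j
  have hdd := hD.sum_dirDeriv_contorsion hq hdiv h h0 hY hn
  have hdt := hD.sum_contorsion hq hdiv h h0 hY
  -- Skewness is recorded at every point because it is used under a derivative, to bring both
  -- derivative terms of the curvature to the form `d`.
  have hsk : ∀ i j (y : M), G.baseMetric y (D.contorsion G q (Y j) (Y j) y) (Y i y)
      = -G.baseMetric y (D.contorsion G q (Y j) (Y i) y) (Y j y) := fun i j y =>
    hD.contorsion_skew hq (Y j) (Y i) (Y j) y
  have hsc := G.scalarCurvature_eq_sum b Y hY h h0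
  have hH := G.normSq₃_threeForm_eq_sum b h h0
  have hdv := G.divergence_eq_trace (G.partSection q e) x
  rw [G.trace_eq_sum_of_orthogonal h h0] at hdv
  have hW := G.baseMetric_eq_sum h h0 (G.partSection q e x) (G.partSection q e x)
  simp only [← hY, G.threeForm_eq_flux] at hH
  set ε : ι → ℝ := fun i => (G.baseMetric x (b i) (b i))⁻¹ with hε
  have hcore := tripleSum_contorsion ε hq (h := fun i j k => G.flux (Y i) (Y j) (Y k) x)
    (κ := fun i j k => G.baseMetric x (D.contorsion G q (Y i) (Y j) x) (Y k x))
    (fun i j k => G.flux_swap _ _ _ x) (fun i j k => G.flux_swap_right _ _ _ x)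
    (fun i j k => hD.contorsion_skew hq _ _ _ x) (fun i j k => hD.contorsion_cyclic hq _ _ _ x)
  have hmain := sum_sum_curvature ε hq
    (N := fun i j => q * D.naiveCurvature (G.liftSection q (Y i)) (G.liftSection q (Y j))
      (G.liftSection q (Y i)) (G.liftSection q (Y j)) x)
    (T := fun i j => q * D.derivTrace (G.liftSection q (Y i)) (G.liftSection q (Y j))
      (G.liftSection q (Y i)) (G.liftSection q (Y j)) x)
    (R := fun i j => G.baseMetric x (G.curv (Y i) (Y j) (Y j) x) (Y i x))
    (d := fun i j => dirDeriv (fun y => G.baseMetric y (D.contorsion G q (Y i) (Y j) y) (Y i y)) x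
      (Y j x))
    (h := fun i j k => G.flux (Y i) (Y j) (Y k) x)
    (κ := fun i j k => G.baseMetric x (D.contorsion G q (Y i) (Y j) x) (Y k x))
    (δ := fun j => G.baseMetric x (G.nablaMap (G.partSection q e) x (b j)) (b j))
    (w := fun k => G.baseMetric x (G.partSection q e x) (b k))
    (fun i j => by rw [hN i j, funext (hsk i j), dirDeriv_neg, ← sub_eq_add_neg]) hT
    (fun j => by rw [hY]; exact hdd j (b j)) hdt
  rw [hsc, hH, hdv, hW]
  rw [hcore] at hmain
  rw [Finset.mul_sum]
  refine Eq.trans (Finset.sum_congr rfl fun j _ => ?_) (hmain.trans ?_)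
  · rw [Finset.mul_sum]
    refine Finset.sum_congr rfl fun i _ => ?_
    rw [riemann_eq]
    ring
  · rw [tripleSum_apply]
    simp only [hY]
    ring

/-- The generalised scalar curvature of a Levi-Civita generalised connection. -/
theorem scalarCurvature_eq (hD : D.IsLeviCivita G) {e : Γ}
    (hdiv : D.divergence = G.divergenceOperator e) (x : M) :
    D.scalarCurvature G x = ExactCourant.scalarCurvature G.baseMetric x
      - normSq₃ (G.baseMetric x) (G.threeForm x) / 12
      + G.metricDivergence (fun y => G.plusPart y (e y) - G.minusPart y (e y)) x
      - 1 / 2 * G.form x (e x) (e x) := by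
  obtain ⟨b, h, h0⟩ := exists_orthogonal_basis_of_nondegenerate (β := G.metricMap x)
    (G.metricMap_nondegenerate x)
    (fun u v => by rw [G.metricMap_apply, G.metricMap_apply, G.baseMetric_symm])
  simp only [G.metricMap_apply] at h h0
  obtain ⟨Y, hY, hn⟩ := G.exists_normal_frame b
  have hp : (1 : ℝ) * 1 = 1 := by norm_num
  have hm : (-1 : ℝ) * -1 = 1 := by norm_num
  have h1 := hD.sum_riemann hp hdiv h h0 hY hn
  have h2 := hD.sum_riemann hm hdiv h h0 hY hn
  have hdivergence : G.metricDivergence (fun y => G.plusPart y (e y) - G.minusPart y (e y)) x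
      = ExactCourant.divergence G.baseMetric (G.partSection 1 e) x
        - ExactCourant.divergence G.baseMetric (G.partSection (-1) e) x := by
    have hs : (fun y => A.anchor y (G.plusPart y (e y) - G.minusPart y (e y)))
        = (G.partSection 1 e - G.partSection (-1) e : 𝔛) := by
      funext y
      rw [← G.lift_part_plus, ← G.lift_part_minus, map_sub, G.anchor_lift, G.anchor_lift]
      rfl
    rw [GeneralizedMetric.metricDivergence, hs, G.divergence_sub]
  have hform : G.form x (e x) (e x)
      = G.baseMetric x (G.partSection 1 e x) (G.partSection 1 e x)
        + G.baseMetric x (G.partSection (-1) e x) (G.partSection (-1) e x) := by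
    have hl : ∀ u v : E x, G.form x u v = G.formMap x u v := fun _ _ => rfl
    conv_lhs => rw [hl, G.eq_lift_add_lift x (e x)]
    simp only [map_add, LinearMap.add_apply, ← hl, G.form_lift_lift hp, G.form_lift_lift hm,
      GeneralizedMetric.partSection_apply]
    ring
  rw [D.scalarCurvature_eq_sum G b Y hY h h0, hdivergence, hform]
  linear_combination 1 / 2 * h1 + 1 / 2 * h2

end IsLeviCivita

end GeneralizedConnection

/-! ### Existence of Levi-Civita generalised connections -/

namespace GeneralizedMetric

variable (G : GeneralizedMetric A)

/-- The smooth function `g(X, Y)`. -/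
def metricFun (X Y : 𝔛) : C∞M := ⟨fun y => G.baseMetric y (X y) (Y y), G.contMDiff_baseMetric X Y⟩

theorem metricFun_apply (X Y : 𝔛) (x : M) :
    G.metricFun X Y x = G.baseMetric x (X x) (Y x) := rfl

/-- The metric connection with torsion a third of `H`, and with trace of the contorsion prescribed
by `W`. -/
def metricConnection (s c : ℝ) (W X Y : 𝔛) : 𝔛 :=
  (2 / 3 : ℝ) • G.bismut s X Y + (1 / 3 : ℝ) • G.bismut (-s) X Y
    + (s * c) • (smulSection (G.metricFun X Y) W - smulSection (G.metricFun W Y) X)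

/-- The weights 2/3 and 1/3 give (s/2)(2/3 - 1/3) = s/6, a third of the cyclic sum required of the
contorsion. The W-term is skew in Y, Z and has zero cyclic sum, so it adjusts the trace without
disturbing metricity or torsion. -/
theorem baseMetric_metricConnection {s : ℝ} (hs : s * s = 1) (c : ℝ) (W X Y Z : 𝔛) (x : M) :
    G.baseMetric x (G.metricConnection s c W X Y x) (Z x)
      = G.baseMetric x (G.nabla X Y x) (Z x) + s / 6 * G.flux X Y Z x
        + s * c * (G.baseMetric x (X x) (Y x) * G.baseMetric x (W x) (Z x)
          - G.baseMetric x (W x) (Y x) * G.baseMetric x (X x) (Z x)) := by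
  have h1 := G.baseMetric_nabla X Y Z x
  simp only [metricConnection, add_section_apply, smul_section_apply, sub_section_apply,
    smulSection_apply, metricFun_apply, baseMetric_add_left, baseMetric_sub_left,
    baseMetric_smul_left, G.baseMetric_bismut hs,
    G.baseMetric_bismut (s := -s) (by linarith)]
  linear_combination -1 / 2 * h1

theorem metricConnection_add_left (s c : ℝ) (W X X' Y : 𝔛) :
    G.metricConnection s c W (X + X') Y
      = G.metricConnection s c W X Y + G.metricConnection s c W X' Y := by
  ext x
  simp only [metricConnection, bismut_add_left, add_section_apply, smul_section_apply,
    sub_section_apply, smulSection_apply, metricFun_apply, baseMetric_add_left]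
  module

theorem metricConnection_smul_left {s : ℝ} (hs : s * s = 1) (c : ℝ) (f : C∞M) (W X Y : 𝔛) :
    G.metricConnection s c W (smulSection f X) Y
      = smulSection f (G.metricConnection s c W X Y) := by
  ext x
  simp only [metricConnection, G.bismut_smul_left hs,
    G.bismut_smul_left (s := -s) (by linarith), add_section_apply, smul_section_apply,
    sub_section_apply, smulSection_apply, metricFun_apply, baseMetric_smul_left]
  module

theorem metricConnection_add_right (s c : ℝ) (W X Y Y' : 𝔛) :
    G.metricConnection s c W X (Y + Y')
      = G.metricConnection s c W X Y + G.metricConnection s c W X Y' := by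
  ext x
  simp only [metricConnection, bismut_add_right, add_section_apply, smul_section_apply,
    sub_section_apply, smulSection_apply, metricFun_apply, baseMetric_add_right]
  module

theorem metricConnection_smul_right {s : ℝ} (hs : s * s = 1) (c : ℝ) (f : C∞M) (W X Y : 𝔛) :
    G.metricConnection s c W X (smulSection f Y)
      = smulSection (derivFun X f) Y + smulSection f (G.metricConnection s c W X Y) := by
  ext x
  simp only [metricConnection, G.bismut_smul_right hs,
    G.bismut_smul_right (s := -s) (by linarith), add_section_apply, smul_section_apply,
    sub_section_apply, smulSection_apply, metricFun_apply, baseMetric_smul_right]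
  module

/-- The `E_s`-part of the generalised connection given by `metricConnection`. -/
def connectionPart (s c : ℝ) (W : 𝔛) (a b : Γ) : 𝔛 :=
  G.bismut s (G.partSection (-s) a) (G.partSection s b)
    + G.metricConnection s c W (G.partSection s a) (G.partSection s b)

theorem connectionPart_add_left (s c : ℝ) (W : 𝔛) (a a' b : Γ) :
    G.connectionPart s c W (a + a') b
      = G.connectionPart s c W a b + G.connectionPart s c W a' b := by
  simp only [connectionPart, partSection_add, bismut_add_left, metricConnection_add_left]
  abel

theorem connectionPart_smul_left {s : ℝ} (hs : s * s = 1) (c : ℝ) (W : 𝔛) (f : C∞M) (a b : Γ) :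
    G.connectionPart s c W (smulSection f a) b = smulSection f (G.connectionPart s c W a b) := by
  simp only [connectionPart, partSection_smulSection, G.bismut_smul_left hs,
    G.metricConnection_smul_left hs]
  ext x
  simp only [add_section_apply, smulSection_apply, smul_add]

theorem connectionPart_add_right (s c : ℝ) (W : 𝔛) (a b b' : Γ) :
    G.connectionPart s c W a (b + b')
      = G.connectionPart s c W a b + G.connectionPart s c W a b' := by
  simp only [connectionPart, partSection_add, bismut_add_right, metricConnection_add_right]
  abel

theorem part_add_part_neg (s : ℝ) (x : M) (u : E x) :
    G.part s x u + G.part (-s) x u = A.anchor x u := by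
  simp only [part, LinearMap.comp_apply, LinearMap.smul_apply, LinearMap.add_apply,
    LinearMap.id_apply, map_smul, map_add]
  module

theorem connectionPart_smul_right {s : ℝ} (hs : s * s = 1) (c : ℝ) (W : 𝔛) (f : C∞M) (a b : Γ)
    (x : M) :
    G.connectionPart s c W a (smulSection f b) x = f x • G.connectionPart s c W a b x
      + dirDeriv f x (A.anchor x (a x)) • G.part s x (b x) := by
  rw [← G.part_add_part_neg s, dirDeriv_add_right]
  simp only [connectionPart, partSection_smulSection, G.bismut_smul_right hs,
    G.metricConnection_smul_right hs, add_section_apply, smulSection_apply, derivFun_apply,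
    partSection_apply]
  module

theorem dirDeriv_baseMetric_partSection {s : ℝ} (hs : s * s = 1) (c : ℝ) (W : 𝔛) (a b b' : Γ)
    (x : M) :
    dirDeriv (fun y => G.baseMetric y (G.partSection s b y) (G.partSection s b' y)) x
        (A.anchor x (a x))
      = G.baseMetric x (G.connectionPart s c W a b x) (G.part s x (b' x))
        + G.baseMetric x (G.part s x (b x)) (G.connectionPart s c W a b' x) := by
  rw [G.baseMetric_symm x (G.part s x (b x)), ← G.part_add_part_neg s, dirDeriv_add_right,
    ← partSection_apply, ← partSection_apply, ← partSection_apply, ← partSection_apply]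
  simp only [connectionPart, add_section_apply, baseMetric_add_left,
    G.baseMetric_metricConnection hs, G.baseMetric_bismut hs, ← G.baseMetric_nabla,
    G.nabla_metric, G.flux_swap_right _ (G.partSection s b') (G.partSection s b)]
  rw [G.baseMetric_symm x (G.partSection s b x), G.baseMetric_symm x (G.partSection s b x)]
  ring

/-- A Levi-Civita generalised connection of `𝒢` as an operator on sections. -/
def connection (c : ℝ) (e a b : Γ) : Γ :=
  G.liftSection 1 (G.connectionPart 1 c (G.partSection 1 e) a b)
    + G.liftSection (-1) (G.connectionPart (-1) c (G.partSection (-1) e) a b)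

theorem pairing_eq_sum (x : M) (u v : E x) :
    A.pairing x u v = G.baseMetric x (G.part 1 x u) (G.part 1 x v)
      - G.baseMetric x (G.part (-1) x u) (G.part (-1) x v) := by
  conv_lhs => rw [G.eq_lift_add_lift x v]
  rw [map_add, G.pairing_lift_right (by norm_num), G.pairing_lift_right (by norm_num)]
  ring

theorem part_endo {s : ℝ} (hs : s * s = 1) (x : M) (u : E x) :
    G.part s x (G.endo x u) = s • G.part s x u := by
  simp only [part, LinearMap.comp_apply, LinearMap.smul_apply, LinearMap.add_apply,
    LinearMap.id_apply, G.endo_involutive, map_smul, map_add, smul_add, smul_smul]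
  rw [show s * (1 / 2 * s) = 1 / 2 by linear_combination 1 / 2 * hs]
  module

theorem form_eq_sum (x : M) (u v : E x) :
    G.form x u v = G.baseMetric x (G.part 1 x u) (G.part 1 x v)
      + G.baseMetric x (G.part (-1) x u) (G.part (-1) x v) := by
  rw [form, pairing_eq_sum, G.part_endo (by norm_num), G.part_endo (by norm_num),
    baseMetric_smul_left, baseMetric_smul_left]
  ring

theorem part_connection_one (c : ℝ) (e a b : Γ) (x : M) :
    G.part 1 x (G.connection c e a b x) = G.connectionPart 1 c (G.partSection 1 e) a b x := by
  rw [connection, add_section_apply, map_add, liftSection_apply, liftSection_apply,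
    G.part_lift_self (by norm_num), G.part_lift_neg (by norm_num), add_zero]

theorem part_connection_neg_one (c : ℝ) (e a b : Γ) (x : M) :
    G.part (-1) x (G.connection c e a b x)
      = G.connectionPart (-1) c (G.partSection (-1) e) a b x := by
  have h := G.part_lift_neg (s := -1) (by norm_num) x
    (G.connectionPart 1 c (G.partSection 1 e) a b x)
  rw [neg_neg] at h
  rw [connection, add_section_apply, map_add, liftSection_apply, liftSection_apply, h,
    G.part_lift_self (by norm_num), zero_add]

theorem connection_add_left (c : ℝ) (e a a' b : Γ) :
    G.connection c e (a + a') b = G.connection c e a b + G.connection c e a' b := by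
  simp only [connection, connectionPart_add_left, liftSection_add]
  abel

theorem connection_smul_left (c : ℝ) (e : Γ) (f : C∞M) (a b : Γ) :
    G.connection c e (smulSection f a) b = smulSection f (G.connection c e a b) := by
  have h1 : (1 : ℝ) * 1 = 1 := by norm_num
  have h2 : (-1 : ℝ) * -1 = 1 := by norm_num
  simp only [connection, G.connectionPart_smul_left h1, G.connectionPart_smul_left h2,
    liftSection_smulSection]
  ext x
  simp only [add_section_apply, smulSection_apply, smul_add]

theorem connection_add_right (c : ℝ) (e a b b' : Γ) :
    G.connection c e a (b + b') = G.connection c e a b + G.connection c e a b' := by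
  simp only [connection, connectionPart_add_right, liftSection_add]
  abel

theorem connection_smul_right (c : ℝ) (e : Γ) (f : C∞M) (a b : Γ) (x : M) :
    G.connection c e a (smulSection f b) x = f x • G.connection c e a b x
      + dirDeriv f x (A.anchor x (a x)) • b x := by
  conv_rhs => rw [G.eq_lift_add_lift x (b x)]
  simp only [connection, add_section_apply, liftSection_apply,
    G.connectionPart_smul_right (s := 1) (by norm_num),
    G.connectionPart_smul_right (s := -1) (by norm_num), map_add, map_smul, smul_add]
  abel

theorem mdiffAt_partSection (s : ℝ) (b b' : Γ) (x : M) : MDifferentiableAt 𝓘(ℝ, V) 𝓘(ℝ, ℝ)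
    (fun y => G.baseMetric y (G.part s y (b y)) (G.part s y (b' y))) x :=
  G.mdiffAt_baseMetric (G.partSection s b) (G.partSection s b') x

theorem connection_metric (c : ℝ) (e a b b' : Γ) (x : M) :
    dirDeriv (fun y => A.pairing y (b y) (b' y)) x (A.anchor x (a x))
      = A.pairing x (G.connection c e a b x) (b' x)
        + A.pairing x (b x) (G.connection c e a b' x) := by
  have h1 := G.dirDeriv_baseMetric_partSection (s := 1) (by norm_num) c (G.partSection 1 e) a b b' x
  have h2 := G.dirDeriv_baseMetric_partSection (s := -1) (by norm_num) c (G.partSection (-1) e)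
    a b b' x
  simp only [partSection_apply] at h1 h2
  simp only [G.pairing_eq_sum, part_connection_one, part_connection_neg_one]
  rw [dirDeriv_sub (G.mdiffAt_partSection _ _ _ x) (G.mdiffAt_partSection _ _ _ x), h1, h2]
  ring

theorem connection_form (c : ℝ) (e a b b' : Γ) (x : M) :
    dirDeriv (fun y => G.form y (b y) (b' y)) x (A.anchor x (a x))
      = G.form x (G.connection c e a b x) (b' x)
        + G.form x (b x) (G.connection c e a b' x) := by
  have h1 := G.dirDeriv_baseMetric_partSection (s := 1) (by norm_num) c (G.partSection 1 e) a b b' x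
  have h2 := G.dirDeriv_baseMetric_partSection (s := -1) (by norm_num) c (G.partSection (-1) e)
    a b b' x
  simp only [partSection_apply] at h1 h2
  simp only [form_eq_sum, part_connection_one, part_connection_neg_one]
  rw [dirDeriv_add (G.mdiffAt_partSection _ _ _ x) (G.mdiffAt_partSection _ _ _ x), h1, h2]
  ring

/-- The Levi-Civita generalised connection with divergence determined by `c` and `e`. -/
def leviCivitaConnection (c : ℝ) (e : Γ) : GeneralizedConnection A where
  D b x := tensorialMap (fun a => G.connection c e a b x)
    (fun a a' => by rw [connection_add_left]; rfl) (fun f a => by rw [connection_smul_left]; rfl)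
  smooth a b := (G.connection c e a b).contMDiff.congr fun x => by
    rw [tensorialMap_apply (fun a => G.connection c e a b x)]
  add a b x := LinearMap.ext fun u => by
    obtain ⟨v, rfl⟩ := exists_section (V := V) (F := F) x u
    rw [LinearMap.add_apply, tensorialMap_apply (fun v => G.connection c e v (a + b) x),
      tensorialMap_apply (fun v => G.connection c e v a x),
      tensorialMap_apply (fun v => G.connection c e v b x), connection_add_right]
    rfl
  leibniz f b x u := by
    obtain ⟨v, rfl⟩ := exists_section (V := V) (F := F) x u
    rw [tensorialMap_apply (fun v => G.connection c e v (smulSection f b) x),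
      tensorialMap_apply (fun v => G.connection c e v b x), connection_smul_right]
  metric b b' x u := by
    obtain ⟨v, rfl⟩ := exists_section (V := V) (F := F) x u
    rw [tensorialMap_apply (fun v => G.connection c e v b x),
      tensorialMap_apply (fun v => G.connection c e v b' x), connection_metric]

theorem leviCivitaConnection_D (c : ℝ) (e a b : Γ) (x : M) :
    (G.leviCivitaConnection c e).D b x (a x) = G.connection c e a b x := by
  rw [leviCivitaConnection, tensorialMap_apply (fun a => G.connection c e a b x)]

theorem cov_leviCivitaConnection (c : ℝ) (e a b : Γ) :
    (G.leviCivitaConnection c e).cov a b = G.connection c e a b := by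
  ext x; exact G.leviCivitaConnection_D c e a b x

/-- One formula for all eight sign patterns: the value vanishes for t ≠ r, the coefficient of H is
t/2 for s ≠ t (Bismut) and t/6 for s = t, and the W-term is present only for s = t. -/
theorem pairing_connection_lift {s t r : ℝ} (hs : s = 1 ∨ s = -1) (ht : t = 1 ∨ t = -1)
    (hr : r = 1 ∨ r = -1) (c : ℝ) (e : Γ) (X Y Z : 𝔛) (x : M) :
    A.pairing x (G.connection c e (G.liftSection s X) (G.liftSection t Y) x) (G.lift r x (Z x))
      = (t + r) / 2 * (G.baseMetric x (G.nabla X Y x) (Z x)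
        + t / 2 * ((1 - s * t) / 2 + (1 + s * t) / 6) * G.flux X Y Z x
        + (1 + s * t) / 2 * (t * c * (G.baseMetric x (X x) (Y x)
            * G.baseMetric x (G.partSection t e x) (Z x)
          - G.baseMetric x (G.partSection t e x) (Y x) * G.baseMetric x (X x) (Z x)))) := by
  have h1 : (1 : ℝ) * 1 = 1 := by norm_num
  have h2 : (-1 : ℝ) * -1 = 1 := by norm_num
  have hz : ∀ X : 𝔛, G.partSection 1 (G.liftSection (-1) X) = 0 := fun X => by
    ext y; exact G.part_lift_neg h1 y _
  have hz' : ∀ X : 𝔛, G.partSection (-1) (G.liftSection 1 X) = 0 := fun X => by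
    ext y
    have := G.part_lift_neg h2 y (X y)
    rwa [neg_neg] at this
  have hb : ∀ s Y, G.bismut s 0 Y = 0 := fun s Y => by
    simpa using G.bismut_add_left s 0 0 Y
  have hb' : ∀ s Y, G.bismut s Y 0 = 0 := fun s Y => by
    simpa using G.bismut_add_right s Y 0 0
  have hm : ∀ s W Y, G.metricConnection s c W 0 Y = 0 := fun s W Y => by
    simpa using G.metricConnection_add_left s c W 0 0 Y
  have hm' : ∀ s W Y, G.metricConnection s c W Y 0 = 0 := fun s W Y => by
    simpa using G.metricConnection_add_right s c W Y 0 0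
  rcases hs with rfl | rfl <;> rcases ht with rfl | rfl <;> rcases hr with rfl | rfl <;>
    simp only [G.pairing_lift_right h1, G.pairing_lift_right h2, part_connection_one,
      part_connection_neg_one, connectionPart, G.partSection_liftSection h1,
      G.partSection_liftSection h2, hz, hz', neg_neg, hb, hb', hm, hm', add_zero, zero_add,
      G.baseMetric_metricConnection h1, G.baseMetric_metricConnection h2,
      G.baseMetric_bismut h1, G.baseMetric_bismut h2, ← G.baseMetric_nabla,
      ContMDiffSection.coe_zero, Pi.zero_apply, baseMetric_zero_left] <;> ring

/-- For equal signs the three H-terms of weight 1/6 add up to the H/2 of the bracket and the W-terms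
cancel cyclically. For mixed signs a single derivative survives, with the full H/2. -/
theorem torsion_connection_lift {s t r : ℝ} (hs : s = 1 ∨ s = -1) (ht : t = 1 ∨ t = -1)
    (hr : r = 1 ∨ r = -1) (c : ℝ) (e : Γ) (X Y Z : 𝔛) (x : M) :
    A.pairing x (G.connection c e (G.liftSection s X) (G.liftSection t Y) x) (G.lift r x (Z x))
      - A.pairing x (G.connection c e (G.liftSection t Y) (G.liftSection s X) x)
        (G.lift r x (Z x))
      - A.pairing x (A.bracket (G.liftSection s X) (G.liftSection t Y) x) (G.lift r x (Z x))
      + A.pairing x (G.connection c e (G.liftSection r Z) (G.liftSection s X) x)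
        (G.lift t x (Y x)) = 0 := by
  have h1 := G.baseMetric_nabla X Y Z x
  have h2 := G.baseMetric_nabla Y X Z x
  have h3 := G.baseMetric_nabla Z X Y x
  simp only [koszul, ← coe_lieSection, G.baseMetric_fun_symm Y X, G.baseMetric_fun_symm Z X,
    G.baseMetric_fun_symm Z Y, lieSection_swap Y X, lieSection_swap Z X, lieSection_swap Z Y,
    G.baseMetric_neg_left] at h1 h2 h3
  rw [G.pairing_connection_lift hs ht hr, G.pairing_connection_lift ht hs hr,
    G.pairing_connection_lift hr hs ht, G.pairing_bracket_lift_lift, G.flux_swap X Y,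
    G.flux_swap_right Z Y X, G.flux_swap Y Z X, G.flux_swap_right Y X Z, G.flux_swap X Y Z,
    G.baseMetric_symm x (Y x) (X x), G.baseMetric_symm x (Z x) (X x),
    G.baseMetric_symm x (Z x) (Y x)]
  rcases hs with rfl | rfl <;> rcases ht with rfl | rfl <;> rcases hr with rfl | rfl
  · linear_combination 1 / 2 * h1 - 1 / 2 * h2 + 1 / 2 * h3
  · linear_combination 1 / 2 * h3
  · linear_combination -1 / 2 * h2
  · linear_combination -1 / 2 * h1
  · linear_combination 1 / 2 * h1
  · linear_combination 1 / 2 * h2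
  · linear_combination -1 / 2 * h3
  · linear_combination -1 / 2 * h1 + 1 / 2 * h2 - 1 / 2 * h3

theorem exists_eq_liftSection_add (a : Γ) :
    ∃ X Y : 𝔛, a = G.liftSection 1 X + G.liftSection (-1) Y :=
  ⟨_, _, G.eq_liftSection_add a⟩

theorem torsion_connection (c : ℝ) (e a b b' : Γ) (x : M) :
    A.pairing x (G.connection c e a b x) (b' x) - A.pairing x (G.connection c e b a x) (b' x)
      - A.pairing x (A.bracket a b x) (b' x) + A.pairing x (G.connection c e b' a x) (b x) = 0 := by
  obtain ⟨X, X', rfl⟩ := G.exists_eq_liftSection_add a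
  obtain ⟨Y, Y', rfl⟩ := G.exists_eq_liftSection_add b
  obtain ⟨Z, Z', rfl⟩ := G.exists_eq_liftSection_add b'
  have hp : (1 : ℝ) = 1 ∨ (1 : ℝ) = -1 := Or.inl rfl
  have hm : (-1 : ℝ) = 1 ∨ (-1 : ℝ) = -1 := Or.inr rfl
  simp only [connection_add_left, connection_add_right, map_add, LinearMap.add_apply,
    add_section_apply, liftSection_apply]
  linear_combination G.torsion_connection_lift hp hp hp c e X Y Z x
    + G.torsion_connection_lift hp hp hm c e X Y Z' x
    + G.torsion_connection_lift hp hm hp c e X Y' Z x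
    + G.torsion_connection_lift hp hm hm c e X Y' Z' x
    + G.torsion_connection_lift hm hp hp c e X' Y Z x
    + G.torsion_connection_lift hm hp hm c e X' Y Z' x
    + G.torsion_connection_lift hm hm hp c e X' Y' Z x
    + G.torsion_connection_lift hm hm hm c e X' Y' Z' x

theorem isLeviCivita_leviCivitaConnection (c : ℝ) (e : Γ) :
    (G.leviCivitaConnection c e).IsLeviCivita G where
  metric b b' x u := by
    obtain ⟨a, rfl⟩ := exists_section (V := V) (F := F) x u
    rw [leviCivitaConnection_D, leviCivitaConnection_D, connection_form]
  torsion a b b' x := by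
    simp only [cov_leviCivitaConnection, sub_section_apply, map_sub, LinearMap.sub_apply]
    exact G.torsion_connection c e a b b' x

theorem trace_metricConnection {s : ℝ} (hs : s * s = 1) {c : ℝ} {W : 𝔛} {x : M}
    (hc : W = 0 ∨ c * (finrank ℝ V - 1) = 1) (Y : 𝔛)
    (L : TangentSpace 𝓘(ℝ, V) x →ₗ[ℝ] TangentSpace 𝓘(ℝ, V) x)
    (hL : ∀ X : 𝔛, L (X x) = G.metricConnection s c W X Y x) :
    LinearMap.trace ℝ _ L = ExactCourant.divergence G.baseMetric Y x
      - s * G.baseMetric x (W x) (Y x) := by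
  obtain ⟨b, h, h0⟩ := exists_orthogonal_basis_of_nondegenerate (β := G.metricMap x)
    (G.metricMap_nondegenerate x)
    (fun u v => by rw [G.metricMap_apply, G.metricMap_apply, G.baseMetric_symm])
  simp only [G.metricMap_apply] at h h0
  rw [G.divergence_eq_trace, G.trace_eq_sum_of_orthogonal h h0, G.trace_eq_sum_of_orthogonal h h0]
  -- H(X, Y, X) = 0, so the torsion part of the connection does not affect the trace.
  have hflux : ∀ X : 𝔛, G.flux X Y X x = 0 := fun X => by
    have h1 := G.flux_swap_right X X Y x
    have h2 := G.flux_swap X X Y x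
    linarith
  -- The middle term sums to s·c·g(W,Y), while the last is the same for every k and is counted d
  -- times. Together they give -s·c·(d - 1) g(W,Y).
  have hk : ∀ k, (G.baseMetric x (b k) (b k))⁻¹ * G.baseMetric x (L (b k)) (b k)
      = (G.baseMetric x (b k) (b k))⁻¹ * G.baseMetric x (G.nablaMap Y x (b k)) (b k)
        + s * c * ((G.baseMetric x (b k) (b k))⁻¹
            * (G.baseMetric x (W x) (b k) * G.baseMetric x (Y x) (b k)))
        - s * c * G.baseMetric x (W x) (Y x) := fun k => by
    have h1 := G.baseMetric_metricConnection hs c W (extendVector (b k)) Y (extendVector (b k)) x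
    rw [← hL, ← G.nablaMap_apply, hflux] at h1
    simp only [extendVector_apply] at h1
    rw [h1, G.baseMetric_symm x (Y x)]
    linear_combination (-(s * c * G.baseMetric x (W x) (Y x))) * inv_mul_cancel₀ (h0 k)
  simp only [hk, Finset.sum_add_distrib, Finset.sum_sub_distrib, ← Finset.mul_sum,
    Finset.sum_const, Finset.card_univ, Fintype.card_fin, nsmul_eq_mul]
  rw [← G.baseMetric_eq_sum h h0]
  change W = 0 ∨ c * (finrank ℝ (TangentSpace 𝓘(ℝ, V) x) - 1) = 1 at hc
  rcases hc with rfl | hc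
  · simp [baseMetric_zero_left]
  · linear_combination (-(s * G.baseMetric x (W x) (Y x))) * hc

theorem divergence_leviCivitaConnection {c : ℝ} {e : Γ}
    (hc : e = 0 ∨ c * (finrank ℝ V - 1) = 1) :
    (G.leviCivitaConnection c e).divergence = G.divergenceOperator e := by
  have h1 : (1 : ℝ) * 1 = 1 := by norm_num
  have h2 : (-1 : ℝ) * -1 = 1 := by norm_num
  have hW : ∀ s, G.partSection s e = 0 ∨ c * (finrank ℝ V - 1) = 1 := fun s => by
    refine hc.imp_left ?_
    rintro rfl
    ext x
    exact map_zero (G.part s x)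
  funext b x
  have hz : ∀ X : 𝔛, G.partSection 1 (G.liftSection (-1) X) = 0 := fun X => by
    ext y; exact G.part_lift_neg h1 y _
  have hz' : ∀ X : 𝔛, G.partSection (-1) (G.liftSection 1 X) = 0 := fun X => by
    ext y
    have := G.part_lift_neg h2 y (X y)
    rwa [neg_neg] at this
  have hb : ∀ s Y, G.bismut s 0 Y = 0 := fun s Y => by
    simpa using G.bismut_add_left s 0 0 Y
  have ht1 := G.trace_metricConnection h1 (hW 1) (G.partSection 1 b)
    (G.part 1 x ∘ₗ (G.leviCivitaConnection c e).D b x ∘ₗ G.lift 1 x) fun X => by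
      rw [LinearMap.comp_apply, LinearMap.comp_apply, ← liftSection_apply,
        leviCivitaConnection_D, part_connection_one, connectionPart, hz', hb,
        G.partSection_liftSection h1, zero_add]
  have ht2 := G.trace_metricConnection h2 (hW (-1)) (G.partSection (-1) b)
    (G.part (-1) x ∘ₗ (G.leviCivitaConnection c e).D b x ∘ₗ G.lift (-1) x) fun X => by
      rw [LinearMap.comp_apply, LinearMap.comp_apply, ← liftSection_apply,
        leviCivitaConnection_D, part_connection_neg_one, connectionPart, neg_neg, hz, hb,
        G.partSection_liftSection h2, zero_add]
  have hanchor : (fun y => A.anchor y (b y)) = (G.partSection 1 b + G.partSection (-1) b : 𝔛) := by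
    funext y
    exact (G.part_add_part_neg 1 y (b y)).symm
  rw [GeneralizedConnection.divergence, G.trace_eq_trace_add_trace h1, ht1, ht2,
    divergenceOperator, metricDivergence, hanchor, G.divergence_add, G.pairing_eq_sum]
  simp only [partSection_apply]
  ring

theorem exists_isLeviCivita {e : Γ} (h : 2 ≤ finrank ℝ V ∨ e = 0) :
    ∃ D : GeneralizedConnection A, D.IsLeviCivita G ∧ D.divergence = G.divergenceOperator e := by
  -- c = 1/(d - 1) normalises the trace. In case e = 0 the value of c is irrelevant, so d = 1, where
  -- this inverse is 0 by convention, does no harm.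
  refine ⟨G.leviCivitaConnection (finrank ℝ V - 1 : ℝ)⁻¹ e,
    G.isLeviCivita_leviCivitaConnection _ e, G.divergence_leviCivitaConnection ?_⟩
  refine h.symm.imp_right fun h => inv_mul_cancel₀ ?_
  have : (2 : ℝ) ≤ finrank ℝ V := by exact_mod_cast h
  linarith

end GeneralizedMetric

end Calculus

end ExactCourant

theorem mainTheorem1
    {V : Type*} [NormedAddCommGroup V] [NormedSpace ℝ V] [FiniteDimensional ℝ V]
    {M : Type*} [TopologicalSpace M] [ChartedSpace V M] [IsManifold 𝓘(ℝ, V) ∞ M]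
    [T2Space M] [SigmaCompactSpace M]
    {F : Type*} [NormedAddCommGroup F] [NormedSpace ℝ F] [FiniteDimensional ℝ F]
    {E : M → Type*} [TopologicalSpace (TotalSpace F E)]
    [∀ x, TopologicalSpace (E x)] [∀ x, AddCommGroup (E x)] [∀ x, Module ℝ (E x)]
    [FiberBundle F E] [VectorBundle ℝ F E] [ContMDiffVectorBundle ∞ F E 𝓘(ℝ, V)]
    (A : ExactCourant.ExactCourantAlgebroid V F E) (G : ExactCourant.GeneralizedMetric A)
    (e : Cₛ^∞⟮𝓘(ℝ, V); F, E⟯) :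
    ((2 ≤ finrank ℝ V ∨ e = 0) → ∃ D : ExactCourant.GeneralizedConnection A,
      D.IsLeviCivita G ∧ D.divergence = G.divergenceOperator e) ∧
    ∀ D : ExactCourant.GeneralizedConnection A,
      D.IsLeviCivita G → D.divergence = G.divergenceOperator e → ∀ x : M,
        D.scalarCurvature G x =
          ExactCourant.scalarCurvature G.baseMetric x
            - ExactCourant.normSq₃ (G.baseMetric x) (G.threeForm x) / 12
            + G.metricDivergence (fun y => G.plusPart y (e y) - G.minusPart y (e y)) x
            - 1 / 2 * G.form x (e x) (e x) := by
  exact ⟨fun h => G.exists_isLeviCivita h, fun _ hD hdiv x => hD.scalarCurvature_eq hdiv x⟩
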